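/- A constraint is a function $f:\{0,1\}^k\to\{0,1\}$ ($k\ge 0$ is its arity); it is trivial if it is constant. Its characteristic polynomial $P_f$ is the unique multilinear real polynomial in $k$ variables that agrees with $f$ on $\{0,1\}^k$, and $\deg(f)=\deg(P_f)$. A constraint $f$ is 0-valid if $f(0,\dots,0)=1$, 1-valid if $f(1,\dots,1)=1$, and 2-monotone if it is equivalent to a DNF formula with one or two terms, at most one of which is a nonempty conjunction of positive literals and at most one a nonempty conjunction of negative literals. A constraint language $\Gamma$ is a finite set of constraints; $\deg(\Gamma)=\max_{f\in\Gamma}\deg(f)$; it is non-trivial if it contains a non-trivial constraint, and it is 0-valid (1-valid, 2-monotone) if all its non-trivial constraints are. For $\mathbb W\in\{\mathbb Z,\mathbb N\}$ (with $0\in\mathbb N$), a formula $\Phi$ of $CS(\Gamma,\mathbb W)$ over $n$ Boolean variables is a finite set of constraint applications $\langle f,(i_1,\dots,i_k),w\rangle$ with $f\in\Gamma$ of arity $k$, $i_1,\dots,i_k\in\{1,\dots,n\}$ (repetitions allowed) and weight $w\in\mathbb W$. Let $|\Phi|$ be the number of applications, $\|\Phi\|$ the sum of the absolute values of the weights and,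 for $x\in\{0,1\}^n$, $\Phi(x)$ the sum of the weights of the applications satisfied by $x$. A linear transformation from $CS(\Gamma_1,\mathbb W_1)$ to $CS(\Gamma_2,\mathbb W_2)$ is a polynomial-time procedure (weights and thresholds being written in binary, and the number of variables and the variable indices in unary) that, given a formula $\Phi_1$ of $CS(\Gamma_1,\mathbb W_1)$ over $n_1$ variables and $t_1\in\mathbb Z$, returns a formula $\Phi_2$ of $CS(\Gamma_2,\mathbb W_2)$ over $n_2$ variables and $t_2\in\mathbb Z$ such that 1. $n_2=\mathcal O(n_1)$, 2. $|\Phi_2|=\mathcal O(|\Phi_1|+n_1)$, 3. $\|\Phi_2\|\le\|\Phi_1\|\cdot n_1^{\mathcal O(1)}$, 4. $\exists x\;\Phi_1(x)=t_1\iff\exists y\;\Phi_2(y)=t_2$, 5. $\exists x\;\Phi_1(x)\ge t_1\iff\exists y\;\Phi_2(y)\ge t_2$, where the implied constants depend only on $\Gamma_1,\Gamma_2$. **Corollary.** Let $\Gamma_1,\Gamma_2$ be non-trivial constraint languages such that $\deg(\Gamma_1)\le\deg(\Gamma_2)$ and $\Gamma_2$ is neither 0-valid, nor 1-valid, nor 2-monotone.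 Then there is a linear transformation from $CS(\Gamma_1,\mathbb Z)$ to $CS(\Gamma_2,\mathbb N)$. -/

import Mathlib

namespace MaxCSP

/-- A Boolean constraint: a function `{0,1}^k → {0,1}`, where `k` is its arity (`k = 0` allowed). -/
structure Constraint where
  arity : ℕ
  toFun : (Fin arity → Bool) → Bool

namespace Constraint

/-- Always 0 or always 1, regardless of the arguments. -/
def IsTrivial (f : Constraint) : Prop :=
  (∀ x, f.toFun x = false) ∨ (∀ x, f.toFun x = true)

def IsZeroValid (f : Constraint) : Prop := f.toFun (fun _ => false) = true

def IsOneValid (f : Constraint) : Prop := f.toFun (fun _ => true) = true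

/-- `f` is a DNF formula with one or two terms, at most one of them a (nonempty) conjunction of
positive literals `⋀_{i ∈ P} x_i` and at most one of them a (nonempty) conjunction of negative
literals `⋀_{j ∈ Q} ¬ x_j`. An empty index set stands for an absent term. -/
def IsTwoMonotone (f : Constraint) : Prop :=
  ∃ P Q : Finset (Fin f.arity), (P.Nonempty ∨ Q.Nonempty) ∧
    ∀ x, f.toFun x = true ↔
      (P.Nonempty ∧ ∀ i ∈ P, x i = true) ∨ (Q.Nonempty ∧ ∀ j ∈ Q, x j = false)

open MvPolynomial in
/-- The characteristic polynomial `P_f = ∑_{s : f(s) = 1} ∏_i R_i^s`, with `R_i^s = x_i` if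
`s_i = 1` and `R_i^s = 1 - x_i` otherwise: the multilinear real polynomial that agrees with `f`
on `{0,1}^k`. -/
noncomputable def charPoly (f : Constraint) : MvPolynomial (Fin f.arity) ℝ :=
  ∑ s : Fin f.arity → Bool with f.toFun s = true, ∏ i, if s i = true then X i else 1 - X i

noncomputable def deg (f : Constraint) : ℕ := f.charPoly.totalDegree

end Constraint

/-- A constraint language is a finite set of constraints, of possibly different arities. -/
abbrev ConstraintLanguage := Finset Constraint

namespace ConstraintLanguage

/-- Some constraint of the language is non-trivial. -/
def IsNontrivial (Γ : ConstraintLanguage) : Prop := ∃ f ∈ Γ, ¬ f.IsTrivial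

/-- All non-trivial constraints of the language are 0-valid. -/
def IsZeroValid (Γ : ConstraintLanguage) : Prop := ∀ f ∈ Γ, ¬ f.IsTrivial → f.IsZeroValid

/-- All non-trivial constraints of the language are 1-valid. -/
def IsOneValid (Γ : ConstraintLanguage) : Prop := ∀ f ∈ Γ, ¬ f.IsTrivial → f.IsOneValid

/-- All non-trivial constraints of the language are 2-monotone. -/
def IsTwoMonotone (Γ : ConstraintLanguage) : Prop := ∀ f ∈ Γ, ¬ f.IsTrivial → f.IsTwoMonotone

/-- `deg(Γ) = max_{f ∈ Γ} deg(P_f)`. -/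
noncomputable def deg (Γ : ConstraintLanguage) : ℕ := Γ.sup Constraint.deg

end ConstraintLanguage

/-- The weight range `ℤ`. -/
abbrev intWeights : Set ℤ := Set.univ

/-- The weight range `ℕ` (with 0), as a set of integers. -/
abbrev natWeights : Set ℤ := {w | 0 ≤ w}

/-- A constraint application `⟨f, (i_1, …, i_k), w⟩` with `f ∈ Γ` and `w ∈ W` over the variables
`0, …, n - 1`. The indices may repeat. -/
structure Application (Γ : ConstraintLanguage) (W : Set ℤ) (n : ℕ) where
  con : {f : Constraint // f ∈ Γ}
  idx : Fin con.val.arity → Fin n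
  weight : W

/-- An instance (formula) of the constraint system `CS(Γ, W)`: a number `n` of variables and a
finite set of constraint applications over them, listed in some order and without repetitions. -/
structure Formula (Γ : ConstraintLanguage) (W : Set ℤ) where
  n : ℕ
  apps : List (Application Γ W n)
  nodup : apps.Nodup

namespace Formula

variable {Γ : ConstraintLanguage} {W : Set ℤ}

/-- `|Φ|`, the number of constraint applications. -/
def size (Φ : Formula Γ W) : ℕ := Φ.apps.length

/-- `‖Φ‖`, the sum of the absolute values of all weights. -/
def totalWeight (Φ : Formula Γ W) : ℕ := (Φ.apps.map fun a => (a.weight : ℤ).natAbs).sum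

/-- `Φ(x)`, the sum of the weights of the constraint applications satisfied by `x`. -/
def value (Φ : Formula Γ W) (x : Fin Φ.n → Bool) : ℤ :=
  (Φ.apps.map fun a =>
    if a.con.val.toFun (fun j => x (a.idx j)) = true then (a.weight : ℤ) else 0).sum

end Formula

/-- The finite alphabet over which instances are written: one symbol for each constraint of `Γ`,
a tick and a separator for numbers in unary, and signs and bits for integers in binary. -/
inductive Symbol (Γ : ConstraintLanguage) : Type
  | con (f : {f : Constraint // f ∈ Γ})
  | tick
  | sep
  | sign (negative : Bool)
  | bit (b : Bool)

section Encoding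

variable {Γ : ConstraintLanguage} {W : Set ℤ}

/-- An integer is written as a sign followed by the binary digits of its absolute value. -/
def encodeInt (Γ : ConstraintLanguage) (z : ℤ) : List (Symbol Γ) :=
  Symbol.sign (decide (z < 0)) :: (Computability.encodeNat z.natAbs).map Symbol.bit

def encodeIndex (Γ : ConstraintLanguage) (i : ℕ) : List (Symbol Γ) :=
  List.replicate i Symbol.tick ++ [Symbol.sep]

def encodeApplication {n : ℕ} (a : Application Γ W n) : List (Symbol Γ) :=
  Symbol.con a.con ::
    ((List.ofFn a.idx).flatMap (fun i => encodeIndex Γ i.val) ++ encodeInt Γ a.weight)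

/-- A formula together with an integer threshold is written as the number of variables in unary,
the threshold in binary, and the list of constraint applications (weights in binary). -/
def encodeInstance (p : Formula Γ W × ℤ) : List (Symbol Γ) :=
  List.replicate p.1.n Symbol.tick ++ encodeInt Γ p.2 ++ p.1.apps.flatMap encodeApplication

end Encoding

/-- `CS(Γ₁, W₁) ≤_LIN CS(Γ₂, W₂)`: there is a linear transformation, that is, a function `F`
computed by a Turing machine in polynomial time which maps a formula `Φ₁` over `n₁` variables and
an integer `t₁` to a formula `Φ₂` over `n₂` variables and an integer `t₂` such that
`n₂ = O(n₁)`, `|Φ₂| = O(|Φ₁| + n₁)`, `‖Φ₂‖ ≤ ‖Φ₁‖ · n₁ ^ O(1)`, and the exact and the threshold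
questions for `(Φ₁, t₁)` and `(Φ₂, t₂)` have the same answers. -/
def LinearlyTransforms (Γ₁ : ConstraintLanguage) (W₁ : Set ℤ)
    (Γ₂ : ConstraintLanguage) (W₂ : Set ℤ) : Prop :=
  ∃ F : Formula Γ₁ W₁ × ℤ → Formula Γ₂ W₂ × ℤ,
    Nonempty (Turing.TM2ComputableInPolyTime encodeInstance encodeInstance F) ∧
    ∃ A B c : ℕ, ∀ (Φ₁ : Formula Γ₁ W₁) (t₁ : ℤ) (Φ₂ : Formula Γ₂ W₂) (t₂ : ℤ),
      F (Φ₁, t₁) = (Φ₂, t₂) →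
        Φ₂.n ≤ A * Φ₁.n ∧
        Φ₂.size ≤ B * (Φ₁.size + Φ₁.n) ∧
        Φ₂.totalWeight ≤ Φ₁.totalWeight * Φ₁.n ^ c ∧
        ((∃ x, Φ₁.value x = t₁) ↔ ∃ y, Φ₂.value y = t₂) ∧
        ((∃ x, Φ₁.value x ≥ t₁) ↔ ∃ y, Φ₂.value y ≥ t₂)

end MaxCSP

/-! Suppose first that negated variables and the constants 0 and 1 may be used as arguments. Let `g`
be a constraint of `Γ₂` of maximal degree, with a top monomial on the argument set `T₀`. The
alternating sum of `g` over the subsets of `T₀`, with 0 for all other arguments, equals the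
coefficient of this monomial times the product of the arguments in `T₀`: if one of these is 0, the
terms cancel in pairs (`Constraint.sum_restrict`). Putting 1 for surplus arguments yields every
monomial of degree at most `deg Γ₂`. Characteristic polynomials have integer coefficients, so a
fixed positive multiple of each constraint of `Γ₁`, or of its negative, is an integer combination of
applications of `g`. Negative coefficients disappear because the sum of `g` over all ways to flip
its arguments is constant (`Expresses.neg_single`). This gives `exists_factor`, up to additive
constants.

Literals and constants are simulated over `2 * n + 2` variables by a sum of applications that is
maximal exactly if two given variables differ and two others are the constants
(`exists_negation_gadget`). Constraints that are not 0-valid and not 1-valid give a sum that is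
maximal either only at the pair (0,1) or exactly at the unequal pairs. In the second case a
constraint that is not invariant under complementation breaks the tie; if there is none,
complementing an assignment changes no value and the ambiguity is harmless. Once the constants are
there, a constraint that is not 2-monotone supplies a function which is easily completed to a test
for inequality (`exists_xor_part`).

The gadgets receive a weight larger than all that the other applications contribute. Assignments
that violate a gadget then stay below a base value, and the others, up to complementation, have the
base value plus a positive multiple of `Φ₁(x)` plus a constant (`Gadgets.Correct.large_cases`). The
threshold is transformed in the same way. Formulas with at most one variable are solved directly.

For the running time, a small language of stack programs is compiled to Turing machines. Values are
trees in prefix notation on one stack, and the functions computed in polynomial time (`PT`) are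
closed under composition, pairing, case distinction and recursion along lists with controlled
growth. `nonempty_polyTime_of_PT` leads back to machines that act on encodings. -/

namespace MaxCSP

/-! ### A structured language for stack machines -/

/-- Structured programs over a family of stacks. -/
inductive Cmd {K : Type} (G : K → Type) : Type
  | skip : Cmd G
  | push (k : K) (a : G k) : Cmd G
  | pop (k : K) : Cmd G
  | seq (c d : Cmd G) : Cmd G
  | cases (k : K) (f : Option (G k) → Cmd G) : Cmd G
  | loop (k : K) (p : Option (G k) → Bool) (c : Cmd G) : Cmd G

namespace Cmd

variable {K : Type} {G : K → Type}

/-- `Runs c S S' t`: started in the store `S`, the program `c` ends in `S'` after `t` steps. -/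
inductive Runs [DecidableEq K] : Cmd G → (∀ k, List (G k)) → (∀ k, List (G k)) → ℕ → Prop
  | skip (S) : Runs .skip S S 1
  | push (k a S) : Runs (.push k a) S (Function.update S k (a :: S k)) 1
  | pop (k S) : Runs (.pop k) S (Function.update S k (S k).tail) 1
  | seq {c d S S' S'' t t'} (h : Runs c S S' t) (h' : Runs d S' S'' t') :
      Runs (.seq c d) S S'' (t + t')
  | cases {k f S S' t} (h : Runs (f (S k).head?) S S' t) : Runs (.cases k f) S S' (t + 1)
  | loop_false {k p c S} (h : p (S k).head? = false) : Runs (.loop k p c) S S 1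
  | loop_true {k p c S S' S'' t t'} (h : p (S k).head? = true) (hc : Runs c S S' t)
      (hw : Runs (.loop k p c) S' S'' t') : Runs (.loop k p c) S S'' (t + t' + 1)

/-- The program labels of the machine that executes `c`. -/
def Lab : Cmd G → Type
  | .skip => Unit
  | .push _ _ => Unit
  | .pop _ => Unit
  | .seq c d => Lab c ⊕ Lab d
  -- The label `none` belongs to the inspection of the stack, before a branch is entered; likewise
  -- for `loop`.
  | .cases k f => Option (Σ o : Option (G k), Lab (f o))
  | .loop _ _ c => Option (Lab c)

theorem finite_lab [∀ k, Finite (G k)] (c : Cmd G) : Finite c.Lab := by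
  induction c with
  | skip => exact inferInstanceAs (Finite Unit)
  | push => exact inferInstanceAs (Finite Unit)
  | pop => exact inferInstanceAs (Finite Unit)
  | seq c d hc hd => exact inferInstanceAs (Finite (Lab c ⊕ Lab d))
  | cases k f h => exact inferInstanceAs (Finite (Option (Σ o : Option (G k), Lab (f o))))
  | loop k p c h => exact inferInstanceAs (Finite (Option (Lab c)))

def entry : (c : Cmd G) → c.Lab
  | .skip => ()
  | .push _ _ => ()
  | .pop _ => ()
  | .seq c _ => Sum.inl c.entry
  | .cases _ _ => none
  | .loop _ _ _ => none

open Turing.TM2 in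
/-- The machine code of `c`; it uses the labels `e l` and leaves through the label `x`. -/
def code [DecidableEq K] {L : Type} : (c : Cmd G) → (c.Lab → L) → L → c.Lab →
    Stmt G L (∀ k, Option (G k))
  | .skip, _, x, _ => .goto fun _ => x
  | .push k a, _, x, _ => .push k (fun _ => a) (.goto fun _ => x)
  | .pop k, _, x, _ => .pop k (fun v _ => v) (.goto fun _ => x)
  | .seq c d, e, _, .inl l => c.code (fun l => e (.inl l)) (e (.inr d.entry)) l
  | .seq _ d, e, x, .inr l => d.code (fun l => e (.inr l)) x l
  | .cases k f, e, _, none =>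
      -- The symbol is stored in the finite control, with one slot per stack, since a jump can
      -- depend only on the control.
      .peek k (fun v o => Function.update v k o) (.goto fun v => e (some ⟨v k, (f (v k)).entry⟩))
  | .cases _ f, e, x, some ⟨o, l⟩ => (f o).code (fun l => e (some ⟨o, l⟩)) x l
  | .loop k p c, e, x, none =>
      .peek k (fun v o => Function.update v k o)
        (.branch (fun v => p (v k)) (.goto fun _ => e (some c.entry)) (.goto fun _ => x))
  | .loop _ _ c, e, _, some l => c.code (fun l => e (some l)) (e none) l

-- Each rule of `Runs` charges exactly the machine steps of its code. The embedding `e` and the exit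
-- `x` vary so that the induction can place a program inside a larger one. The control left behind
-- is irrelevant, as every test reads its symbol afresh.
open Turing.TM2 in
theorem iterate_of_runs [DecidableEq K] {L : Type} {m : L → Stmt G L (∀ k, Option (G k))}
    {c : Cmd G} {S S' : ∀ k, List (G k)} {t : ℕ} (h : Runs c S S' t) :
    ∀ (e : c.Lab → L) (x : L), (∀ l, m (e l) = c.code e x l) → ∀ v, ∃ v',
      (flip bind (step m))^[t] (some ⟨some (e c.entry), v, S⟩) = some ⟨some x, v', S'⟩ := by
  induction h with
  | skip S =>
    intro e x hm v
    exact ⟨v, by simp [flip, step, hm]; rfl⟩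
  | push k a S =>
    intro e x hm v
    exact ⟨v, by simp [flip, step, hm]; rfl⟩
  | pop k S =>
    intro e x hm v
    exact ⟨v, by simp [flip, step, hm]; rfl⟩
  | @seq c d S S' S'' t t' h h' ih ih' =>
    intro e x hm v
    obtain ⟨v₁, h₁⟩ := ih (fun l => e (.inl l)) (e (.inr d.entry)) (fun l => hm (.inl l)) v
    obtain ⟨v₂, h₂⟩ := ih' (fun l => e (.inr l)) x (fun l => hm (.inr l)) v₁
    refine ⟨v₂, ?_⟩
    rw [Nat.add_comm, Function.iterate_add_apply]
    exact (congrArg _ h₁).trans h₂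
  | @cases k f S S' t h ih =>
    intro e x hm v
    obtain ⟨v₁, h₁⟩ := ih (fun l => e (some ⟨_, l⟩)) x (fun l => hm (some ⟨_, l⟩))
      (Function.update v k (S k).head?)
    refine ⟨v₁, ?_⟩
    rw [Function.iterate_succ_apply, ← h₁]
    congr 1
    simp [flip, step, hm]
    simp only [entry, code, stepAux]
    -- The type of the target label depends on the stored symbol, which must become a variable
    -- before it can be rewritten.
    generalize ho : Function.update v k (S k).head? k = o
    rw [Function.update_self] at ho
    subst ho
    rfl
  | @loop_false k p c S h =>
    intro e x hm v
    exact ⟨Function.update v k (S k).head?, by simp [flip, step, hm]; simp [entry, code, h]⟩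
  | @loop_true k p c S S' S'' t t' h hc hw ihc ihw =>
    intro e x hm v
    obtain ⟨v₁, h₁⟩ := ihc (fun l => e (some l)) (e none) (fun l => hm (some l))
      (Function.update v k (S k).head?)
    obtain ⟨v₂, h₂⟩ := ihw e x hm v₁
    refine ⟨v₂, ?_⟩
    rw [Function.iterate_succ_apply, Nat.add_comm t, Function.iterate_add_apply]
    refine Eq.trans (congrArg _ (Eq.trans (congrArg _ ?_) h₁)) h₂
    simp [flip, step, hm]
    simp [entry, code, h]

/-- A program for stacks over finite alphabets, as a Turing machine. -/
noncomputable def toFinTM2 [DecidableEq K] [Fintype K] [∀ k, Finite (G k)] (c : Cmd G)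
    (k₀ k₁ : K) : Turing.FinTM2 :=
  haveI := c.finite_lab
  { k₀ := k₀
    k₁ := k₁
    Γ := G
    Λ := Option c.Lab
    main := some c.entry
    ΛFin := Fintype.ofFinite _
    σ := ∀ k, Option (G k)
    initialState := fun _ => none
    σFin := Fintype.ofFinite _
    Γk₀Fin := Fintype.ofFinite _
    m := fun l => match l with
      -- A halting configuration must carry the initial control, which is restored here; this is the
      -- one step beyond the running time of the program.
      | none => .load (fun _ _ => none) .halt
      | some l => c.code some none l }

theorem outputsInTime_of_runs [DecidableEq K] [Fintype K] [∀ k, Finite (G k)] {c : Cmd G}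
    {k₀ k₁ : K} {x : List (G k₀)} {y : List (G k₁)} {t b : ℕ}
    (h : Runs c (Function.update (fun _ => []) k₀ x) (Function.update (fun _ => []) k₁ y) t)
    (hb : t + 1 ≤ b) :
    Nonempty (Turing.TM2OutputsInTime (c.toFinTM2 k₀ k₁) x (some y) b) := by
  obtain ⟨v, hv⟩ := iterate_of_runs (m := (c.toFinTM2 k₀ k₁).m) h some none (fun _ => rfl)
    (fun _ => none)
  refine ⟨⟨⟨t + 1, ?_⟩, hb⟩⟩
  have e₀ : Turing.initList (c.toFinTM2 k₀ k₁) x =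
      ⟨some (some c.entry), fun _ => none, Function.update (fun _ => []) k₀ x⟩ := by
    unfold Turing.initList
    congr 1
    refine funext fun (k : K) => ?_
    by_cases hk : k = k₀
    · subst hk
      exact Eq.trans (b := x) (dif_pos rfl) (Function.update_self k x (fun _ => [])).symm
    · exact Eq.trans (b := []) (dif_neg hk) (Function.update_of_ne hk x (fun _ => [])).symm
  have e₁ : Turing.haltList (c.toFinTM2 k₀ k₁) y =
      ⟨none, fun _ => none, Function.update (fun _ => []) k₁ y⟩ := by
    unfold Turing.haltList
    congr 1
    refine funext fun (k : K) => ?_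
    by_cases hk : k = k₁
    · subst hk
      exact Eq.trans (b := y) (dif_pos rfl) (Function.update_self k y (fun _ => [])).symm
    · exact Eq.trans (b := []) (dif_neg hk) (Function.update_of_ne hk y (fun _ => [])).symm
  rw [Function.iterate_succ_apply', e₀]
  refine (congrArg _ hv).trans ?_
  exact congrArg some e₁.symm

end Cmd


/-! ### Trees as data, and programs that act on the topmost tree of a stack -/

inductive BTree : Type
  | leaf : BTree
  | node (l r : BTree) : BTree

namespace BTree

/-- Prefix notation. -/
def word : BTree → List Bool
  | leaf => [false]
  | node l r => true :: (l.word ++ r.word)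

theorem length_word_pos (x : BTree) : 0 < x.word.length := by
  cases x <;> simp [word]

end BTree

/-- The work stacks. -/
inductive Work : Type
  | s | t | v | u
  deriving DecidableEq

/-- An input stack, an output stack, and the work stacks. -/
inductive Reg : Type
  | inp | out
  | work (x : Work)
  deriving DecidableEq

instance : Fintype Reg :=
  ⟨{.inp, .out, .work .s, .work .t, .work .v, .work .u}, by
    rintro (_ | _ | _ | _ | _ | _) <;> decide⟩

abbrev Alph (A B : Type) : Reg → Type
  | .inp => A
  | .out => B
  | .work _ => Bool

instance {A B : Type} [Finite A] [Finite B] (k : Reg) : Finite (Alph A B k) := by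
  cases k <;> (simp only [Alph]; infer_instance)

section Store

variable {A B : Type}

def store (i : List A) (o : List B) (f : Work → List Bool) : ∀ k, List (Alph A B k)
  | .inp => i
  | .out => o
  | .work x => f x

def wk (s t v u : List Bool) : Work → List Bool
  | .s => s
  | .t => t
  | .v => v
  | .u => u

/-- The store in which only the main work stack is in use. -/
abbrev main (i : List A) (o : List B) (s : List Bool) : ∀ k, List (Alph A B k) :=
  store i o (wk s [] [] [])

@[simp] theorem update_store (i : List A) (o : List B) (f : Work → List Bool) (x : Work)
    (l : List Bool) :
    Function.update (store i o f) (.work x) l = store i o (Function.update f x l) := by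
  funext k
  rcases k with _ | _ | y
  · rfl
  · rfl
  · by_cases h : y = x
    · subst h; simp [store]
    · rw [Function.update_of_ne (by simpa using h)]
      simp [store, Function.update_of_ne h]

@[simp] theorem update_store_inp (i i' : List A) (o : List B) (f : Work → List Bool) :
    Function.update (store i o f) .inp i' = store i' o f := by
  funext k
  rcases k with _ | _ | y <;> rfl

@[simp] theorem update_store_out (i : List A) (o o' : List B) (f : Work → List Bool) :
    Function.update (store i o f) .out o' = store i o' f := by
  funext k
  rcases k with _ | _ | y <;> rfl

@[simp] theorem store_work (i : List A) (o : List B) (f : Work → List Bool) (x : Work) :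
    store i o f (.work x) = f x := rfl

@[simp] theorem update_wk_s (s t v u l : List Bool) :
    Function.update (wk s t v u) .s l = wk l t v u := by funext k; cases k <;> rfl

@[simp] theorem update_wk_t (s t v u l : List Bool) :
    Function.update (wk s t v u) .t l = wk s l v u := by funext k; cases k <;> rfl

@[simp] theorem update_wk_v (s t v u l : List Bool) :
    Function.update (wk s t v u) .v l = wk s t l u := by funext k; cases k <;> rfl

@[simp] theorem update_wk_u (s t v u l : List Bool) :
    Function.update (wk s t v u) .u l = wk s t v l := by funext k; cases k <;> rfl

end Store

/-! ### Stack programs and their running times -/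

namespace Cmd

/-- `c` leads from `S` to `S'` in at most `b` steps. -/
def Takes {K : Type} [DecidableEq K] {G : K → Type} (c : Cmd G) (S S' : ∀ k, List (G k))
    (b : ℕ) : Prop :=
  ∃ t ≤ b, Runs c S S' t

section

variable {K : Type} [DecidableEq K] {G : K → Type} {c d : Cmd G} {S S' S'' : ∀ k, List (G k)}
  {a b : ℕ}

theorem Takes.mono (h : Takes c S S' a) (hab : a ≤ b) : Takes c S S' b :=
  let ⟨t, ht, hr⟩ := h
  ⟨t, ht.trans hab, hr⟩

theorem Takes.seq (h : Takes c S S' a) (h' : Takes d S' S'' b) :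
    Takes (.seq c d) S S'' (a + b) :=
  let ⟨t, ht, hr⟩ := h
  let ⟨t', ht', hr'⟩ := h'
  ⟨t + t', Nat.add_le_add ht ht', hr.seq hr'⟩

theorem Takes.cases {k : K} {f : Option (G k) → Cmd G} (h : Takes (f (S k).head?) S S' b) :
    Takes (.cases k f) S S' (b + 1) :=
  let ⟨t, ht, hr⟩ := h
  ⟨t + 1, Nat.add_le_add_right ht 1, hr.cases⟩

theorem Takes.loop_false {k : K} {p : Option (G k) → Bool} (h : p (S k).head? = false) :
    Takes (.loop k p c) S S 1 :=
  ⟨1, le_rfl, .loop_false h⟩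

theorem Takes.loop_true {k : K} {p : Option (G k) → Bool} (h : p (S k).head? = true)
    (hc : Takes c S S' a) (hw : Takes (.loop k p c) S' S'' b) :
    Takes (.loop k p c) S S'' (a + b + 1) :=
  let ⟨t, ht, hr⟩ := hc
  let ⟨t', ht', hr'⟩ := hw
  ⟨t + t' + 1, by omega, .loop_true h hr hr'⟩

theorem Takes.push (k : K) (x : G k) (S : ∀ k, List (G k)) :
    Takes (.push k x) S (Function.update S k (x :: S k)) 1 := ⟨1, le_rfl, .push k x S⟩

theorem Takes.pop (k : K) (S : ∀ k, List (G k)) :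
    Takes (.pop k) S (Function.update S k (S k).tail) 1 := ⟨1, le_rfl, .pop k S⟩

theorem Takes.skip (S : ∀ k, List (G k)) : Takes .skip S S 1 := ⟨1, le_rfl, .skip S⟩

/-- A step pushes at most one symbol. -/
theorem Takes.length_le (h : Takes c S S' b) (k : K) :
    (S' k).length ≤ (S k).length + b := by
  obtain ⟨t, ht, h⟩ := h
  suffices (S' k).length ≤ (S k).length + t by omega
  clear ht
  induction h with
  | skip => omega
  | push k' a S =>
    by_cases hk : k = k'
    · subst hk; simp
    · simp [Function.update_of_ne hk]
  | pop k' S =>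
    by_cases hk : k = k'
    · subst hk; simp; omega
    · simp [Function.update_of_ne hk]
  | seq => omega
  | cases => omega
  | loop_false => omega
  | loop_true => omega

end

variable {A B : Type}

/-- The alphabet of a work stack is `Bool`. -/
abbrev pushW (x : Work) (b : Bool) : Cmd (Alph A B) := .push (.work x) b

abbrev popW (x : Work) : Cmd (Alph A B) := .pop (.work x)

abbrev casesW (x : Work) (f : Option Bool → Cmd (Alph A B)) : Cmd (Alph A B) :=
  .cases (.work x) f

abbrev loopW (x : Work) (p : Option Bool → Bool) (c : Cmd (Alph A B)) : Cmd (Alph A B) :=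
  .loop (.work x) p c

theorem takes_pushW (x : Work) (b : Bool) (i : List A) (o : List B) (f : Work → List Bool) :
    Takes (pushW x b) (store i o f) (store i o (Function.update f x (b :: f x))) 1 := by
  simpa using Takes.push (G := Alph A B) (.work x) b (store i o f)

theorem takes_popW (x : Work) (i : List A) (o : List B) (f : Work → List Bool) :
    Takes (popW x) (store i o f) (store i o (Function.update f x (f x).tail)) 1 := by
  simpa using Takes.pop (G := Alph A B) (.work x) (store i o f)

theorem takes_push_s (b : Bool) (i : List A) (o : List B) (s t v u : List Bool) :
    Takes (pushW .s b) (store i o (wk s t v u)) (store i o (wk (b :: s) t v u)) 1 := by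
  simpa [wk] using takes_pushW .s b i o (wk s t v u)

theorem takes_pop_s (b : Bool) (i : List A) (o : List B) (s t v u : List Bool) :
    Takes (popW .s) (store i o (wk (b :: s) t v u)) (store i o (wk s t v u)) 1 := by
  simpa [wk] using takes_popW .s i o (wk (b :: s) t v u)

/-- Pops all symbols of `x`, and executes `c b` for each symbol `b`. -/
def moveAll (x : Work) (c : Bool → Cmd (Alph A B)) : Cmd (Alph A B) :=
  loopW x Option.isSome (casesW x fun o => .seq (popW x) (c (o.getD false)))

/-- `F l m` is the store with `l` still to be moved and `m` already moved. Each symbol costs `C`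
plus a loop test, an inspection and a pop. -/
theorem takes_moveAll {x : Work} {c : Bool → Cmd (Alph A B)} {i : List A} {o : List B}
    {C : ℕ} (F : List Bool → List Bool → Work → List Bool) (hx : ∀ l m, F l m x = l)
    (hu : ∀ l l' m, Function.update (F l m) x l' = F l' m)
    (hc : ∀ b l m, Takes (c b) (store i o (F l m)) (store i o (F l (b :: m))) C)
    (l m : List Bool) :
    Takes (moveAll x c) (store i o (F l m)) (store i o (F [] (l.reverse ++ m)))
      ((C + 3) * l.length + 1) := by
  induction l generalizing m with
  | nil => exact (Takes.loop_false (by simp [hx])).mono (by simp)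
  | cons b l ih =>
    have h₁ := takes_popW x i o (F (b :: l) m)
    rw [hx, hu] at h₁
    have h₂ : Takes (casesW x fun o => .seq (popW x) (c (o.getD false)))
        (store i o (F (b :: l) m)) (store i o (F l (b :: m))) (1 + C + 1) := by
      apply Takes.cases
      simpa [hx] using h₁.seq (hc b l m)
    have h₃ := ih (b :: m)
    rw [show (b :: l).reverse ++ m = l.reverse ++ b :: m by simp]
    refine (Takes.loop_true (by simp [hx]) h₂ h₃).mono ?_
    simp only [List.length_cons]
    ring_nf
    omega

/-- A node symbol replaces one awaited tree by two and a leaf completes one, so `u` becomes empty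
exactly at the end of the topmost tree. -/
def moveTreeBody (y : Work) : Cmd (Alph A B) :=
  casesW .s fun o =>
    if o = some true then
      .seq (popW .s) (.seq (pushW y true) (pushW .u true))
    else .seq (popW .s) (.seq (pushW y false) (popW .u))

/-- Moves the topmost tree of `s` to `y`, reversed, counting the trees still to come on `u`. -/
def moveTree (y : Work) : Cmd (Alph A B) :=
  .seq (pushW .u true) (loopW .u Option.isSome (moveTreeBody y))

/-- Lets `moveTree` be analysed once for both target stacks: `F s l u` is a store as a function of
the main stack, the target and the counter. -/
structure IsFrame (y : Work) (F : List Bool → List Bool → List Bool → Work → List Bool) :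
    Prop where
  s_eq (s l u : List Bool) : F s l u .s = s
  y_eq (s l u : List Bool) : F s l u y = l
  u_eq (s l u : List Bool) : F s l u .u = u
  upd_s (s l u x : List Bool) : Function.update (F s l u) .s x = F x l u
  upd_y (s l u x : List Bool) : Function.update (F s l u) y x = F s x u
  upd_u (s l u x : List Bool) : Function.update (F s l u) .u x = F s l x

theorem isFrame_t (v : List Bool) : IsFrame .t (fun s l u => wk s l v u) := by
  constructor <;> simp [wk]

theorem isFrame_v (t : List Bool) : IsFrame .v (fun s l u => wk s t l u) := by
  constructor <;> simp [wk]

/-- The remainder of the loop is a hypothesis, so that the induction passes from the left subtree to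
the right one and then to what follows. Each symbol costs a loop test, an inspection and three stack
operations. -/
theorem takes_moveTree_loop {y : Work} {F : List Bool → List Bool → List Bool → Work → List Bool}
    (hF : IsFrame y F) {i : List A} {o : List B} {S : ∀ k, List (Alph A B k)} (x : BTree)
    (r l u : List Bool) (b : ℕ)
    (h : Takes (loopW .u Option.isSome (moveTreeBody y))
      (store i o (F r (x.word.reverse ++ l) u)) S b) :
    Takes (loopW .u Option.isSome (moveTreeBody y))
      (store i o (F (x.word ++ r) l (true :: u))) S (b + 5 * x.word.length) := by
  induction x generalizing r l u b with
  | leaf =>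
    have h₁ := takes_popW .s i o (F (false :: r) l (true :: u))
    have h₂ := takes_pushW y false i o (F r l (true :: u))
    have h₃ := takes_popW .u i o (F r (false :: l) (true :: u))
    simp only [hF.s_eq, hF.y_eq, hF.u_eq, hF.upd_s, hF.upd_y, hF.upd_u, List.tail_cons] at h₁ h₂ h₃
    have h₄ : Takes (moveTreeBody y) (store i o (F (false :: r) l (true :: u)))
        (store i o (F r (false :: l) u)) (1 + (1 + 1) + 1) := by
      apply Takes.cases
      simpa [hF.s_eq] using h₁.seq (h₂.seq h₃)
    exact (Takes.loop_true (by simp [hF.u_eq]) h₄ h).mono (by simp [BTree.word]; omega)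
  | node x y' ihx ihy =>
    have h₁ := takes_popW .s i o (F (true :: (x.word ++ (y'.word ++ r))) l (true :: u))
    have h₂ := takes_pushW y true i o (F (x.word ++ (y'.word ++ r)) l (true :: u))
    have h₃ := takes_pushW .u true i o (F (x.word ++ (y'.word ++ r)) (true :: l) (true :: u))
    simp only [hF.s_eq, hF.y_eq, hF.u_eq, hF.upd_s, hF.upd_y, hF.upd_u, List.tail_cons] at h₁ h₂ h₃
    have h₄ : Takes (moveTreeBody y)
        (store i o (F (true :: (x.word ++ (y'.word ++ r))) l (true :: u)))
        (store i o (F (x.word ++ (y'.word ++ r)) (true :: l) (true :: true :: u)))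
          (1 + (1 + 1) + 1) := by
      apply Takes.cases
      simpa [hF.s_eq] using h₁.seq (h₂.seq h₃)
    have h₅ := ihx (y'.word ++ r) (true :: l) (true :: u) _
      (ihy r (x.word.reverse ++ true :: l) u b (by simpa [BTree.word] using h))
    have h₆ := Takes.loop_true (by simp [hF.u_eq]) h₄ h₅
    simp only [BTree.word, List.cons_append, List.append_assoc]
    refine h₆.mono ?_
    simp only [List.length_cons, List.length_append]
    omega

theorem takes_moveTree {y : Work} {F : List Bool → List Bool → List Bool → Work → List Bool}
    (hF : IsFrame y F) {i : List A} {o : List B} (x : BTree) (r l : List Bool) :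
    Takes (moveTree y) (store i o (F (x.word ++ r) l []))
      (store i o (F r (x.word.reverse ++ l) [])) (5 * x.word.length + 2) := by
  have h₁ := takes_pushW .u true i o (F (x.word ++ r) l [])
  simp only [hF.u_eq, hF.upd_u] at h₁
  exact (h₁.seq (takes_moveTree_loop hF x r l [] 1
    (Takes.loop_false (by simp [hF.u_eq])))).mono (by omega)

theorem takes_moveTree_t {i : List A} {o : List B} (x : BTree) (r t v : List Bool) :
    Takes (moveTree .t) (store i o (wk (x.word ++ r) t v []))
      (store i o (wk r (x.word.reverse ++ t) v [])) (5 * x.word.length + 2) :=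
  takes_moveTree (isFrame_t v) x r t

theorem takes_moveTree_v {i : List A} {o : List B} (x : BTree) (r t v : List Bool) :
    Takes (moveTree .v) (store i o (wk (x.word ++ r) t v []))
      (store i o (wk r t (x.word.reverse ++ v) [])) (5 * x.word.length + 2) :=
  takes_moveTree (isFrame_v t) x r v

theorem takes_t_to_s {i : List A} {o : List B} (s t v u : List Bool) :
    Takes (moveAll .t (pushW .s)) (store i o (wk s t v u))
      (store i o (wk (t.reverse ++ s) [] v u)) (4 * t.length + 1) :=
  takes_moveAll (fun l m => wk m l v u) (fun _ _ => rfl) (fun _ _ _ => by simp)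
    (fun b l m => takes_push_s b i o m l v u) t s

theorem takes_v_to_s {i : List A} {o : List B} (s t v u : List Bool) :
    Takes (moveAll .v (pushW .s)) (store i o (wk s t v u))
      (store i o (wk (v.reverse ++ s) t [] u)) (4 * v.length + 1) :=
  takes_moveAll (fun l m => wk m t l u) (fun _ _ => rfl) (fun _ _ _ => by simp)
    (fun b l m => takes_push_s b i o m t l u) v s

theorem takes_v_to_t {i : List A} {o : List B} (s t v u : List Bool) :
    Takes (moveAll .v (pushW .t)) (store i o (wk s t v u))
      (store i o (wk s (v.reverse ++ t) [] u)) (4 * v.length + 1) :=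
  takes_moveAll (fun l m => wk s m l u) (fun _ _ => rfl) (fun _ _ _ => by simp)
    (fun b l m => by simpa [wk] using takes_pushW .t b i o (wk s m l u)) v t

/-- Removes the topmost tree. -/
def drop : Cmd (Alph A B) := .seq (moveTree .t) (moveAll .t fun _ => .skip)

theorem takes_drop {i : List A} {o : List B} (x : BTree) (r : List Bool) :
    Takes drop (main i o (x.word ++ r)) (main i o r) (9 * x.word.length + 3) := by
  have h := takes_moveAll (i := i) (o := o) (x := .t) (c := fun _ => .skip) (C := 1)
    (fun l _ => wk r l [] []) (fun _ _ => rfl) (fun _ _ _ => by simp)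
    (fun b l m => Takes.skip _) x.word.reverse []
  have h' := takes_moveTree_t (i := i) (o := o) x r [] []
  simp only [List.append_nil] at h'
  exact (h'.seq h).mono (by simp; omega)

/-- Exchanges the two topmost trees. -/
def swap : Cmd (Alph A B) :=
  .seq (moveTree .t) (.seq (moveTree .v) (.seq (moveAll .t (pushW .s)) (moveAll .v (pushW .s))))

theorem takes_swap {i : List A} {o : List B} (x y : BTree) (r : List Bool) :
    Takes swap (main i o (x.word ++ (y.word ++ r))) (main i o (y.word ++ (x.word ++ r)))
      (9 * x.word.length + 9 * y.word.length + 6) := by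
  have h₁ := takes_moveTree_t (i := i) (o := o) x (y.word ++ r) [] []
  have h₂ := takes_moveTree_v (i := i) (o := o) y r x.word.reverse []
  have h₃ := takes_t_to_s (i := i) (o := o) r x.word.reverse y.word.reverse []
  have h₄ := takes_v_to_s (i := i) (o := o) (x.word ++ r) [] y.word.reverse []
  simp only [List.append_nil, List.reverse_reverse, List.length_reverse] at h₁ h₂ h₃ h₄
  exact (h₁.seq (h₂.seq (h₃.seq h₄))).mono (by omega)

/-- Doubles the topmost tree. -/
def dup : Cmd (Alph A B) :=
  .seq (moveTree .t) (.seq (moveAll .t fun b => .seq (pushW .s b) (pushW .v b))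
    (.seq (moveAll .v (pushW .t)) (moveAll .t (pushW .s))))

theorem takes_dup {i : List A} {o : List B} (x : BTree) (r : List Bool) :
    Takes dup (main i o (x.word ++ r)) (main i o (x.word ++ (x.word ++ r)))
      (18 * x.word.length + 5) := by
  have h₁ := takes_moveTree_t (i := i) (o := o) x r [] []
  have h₂ := takes_moveAll (i := i) (o := o) (x := .t)
    (c := fun b => .seq (pushW .s b) (pushW .v b)) (C := 2)
    (fun l m => wk (m ++ r) l m []) (fun _ _ => rfl) (fun _ _ _ => by simp)
    (fun b l m => (takes_push_s b i o (m ++ r) l m []).seq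
      (by simpa [wk] using takes_pushW .v b i o (wk (b :: (m ++ r)) l m []))) x.word.reverse []
  have h₃ := takes_v_to_t (i := i) (o := o) (x.word ++ r) [] x.word []
  have h₄ := takes_t_to_s (i := i) (o := o) (x.word ++ r) x.word.reverse [] []
  simp only [List.append_nil, List.reverse_reverse, List.length_reverse, List.nil_append]
    at h₁ h₂ h₃ h₄
  exact (h₁.seq (h₂.seq (h₃.seq h₄))).mono (by omega)

/-- Pushes the word `w`. -/
def pushWord : List Bool → Cmd (Alph A B)
  | [] => .skip
  | b :: w => .seq (pushWord w) (pushW .s b)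

theorem takes_pushWord {i : List A} {o : List B} (w r : List Bool) :
    Takes (pushWord w) (main i o r) (main i o (w ++ r)) (w.length + 1) := by
  induction w with
  | nil => exact Takes.skip _
  | cons b w ih => exact (ih.seq (takes_push_s b i o (w ++ r) [] [] [])).mono (by simp)

end Cmd


/-! ### Functions computed in polynomial time on tree-like data -/

/-- A type whose elements are represented by trees. -/
class Data (α : Type) where
  tree : α → BTree

section Instances

variable {α β : Type} [Data α] [Data β]

instance : Data Unit := ⟨fun _ => .leaf⟩

instance : Data (α × β) := ⟨fun x => .node (Data.tree x.1) (Data.tree x.2)⟩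

def listTree (e : α → BTree) : List α → BTree
  | [] => .leaf
  | a :: l => .node (e a) (listTree e l)

instance : Data (List α) := ⟨listTree Data.tree⟩

def natTree : ℕ → BTree
  | 0 => .leaf
  | n + 1 => .node .leaf (natTree n)

/-- Natural numbers are represented in unary. -/
instance : Data ℕ := ⟨natTree⟩

/-- The trees of both truth values have the same size. -/
instance : Data Bool := ⟨fun b => Data.tree (b.toNat, (!b).toNat)⟩

end Instances

def dword {α : Type} [Data α] (a : α) : List Bool := (Data.tree a).word

def dsize {α : Type} [Data α] (a : α) : ℕ := (dword a).length

section Sizes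

variable {α β : Type} [Data α] [Data β]

theorem dword_pair (a : α) (b : β) : dword (a, b) = true :: (dword a ++ dword b) := rfl

theorem dword_nil : dword ([] : List α) = [false] := rfl

theorem dword_cons (a : α) (l : List α) : dword (a :: l) = true :: (dword a ++ dword l) := rfl

theorem dword_succ (n : ℕ) : dword (n + 1) = true :: false :: dword n := rfl

theorem dsize_pair (a : α) (b : β) : dsize (a, b) = dsize a + dsize b + 1 := by
  simp [dsize, dword_pair]

theorem dsize_nil : dsize ([] : List α) = 1 := rfl

theorem dsize_cons (a : α) (l : List α) : dsize (a :: l) = dsize a + dsize l + 1 := by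
  simp [dsize, dword_cons]

theorem dsize_pos (a : α) : 0 < dsize a := BTree.length_word_pos _

theorem dsize_nat (n : ℕ) : dsize n = 2 * n + 1 := by
  induction n with
  | zero => rfl
  | succ n ih => simp [dsize, dword_succ] at ih ⊢; omega

theorem dsize_bool (b : Bool) : dsize b = 5 := by cases b <;> rfl

theorem dsize_append (l m : List α) : dsize (l ++ m) + 1 = dsize l + dsize m := by
  induction l with
  | nil => simp [dsize_nil]; omega
  | cons a l ih => simp [dsize_cons]; omega

theorem dsize_reverse (l : List α) : dsize l.reverse = dsize l := by
  induction l with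
  | nil => rfl
  | cons a l ih =>
    have := dsize_append l.reverse [a]
    simp only [dsize_cons, dsize_nil] at this
    simp [dsize_cons]; omega

theorem length_lt_dsize (l : List α) : l.length < dsize l := by
  induction l with
  | nil => simp [dsize_nil]
  | cons a l ih => simp [dsize_cons]; omega

end Sizes

theorem eval_mono (p : Polynomial ℕ) : Monotone fun n => p.eval n := by
  intro m n h
  simp only [Polynomial.eval_eq_sum_range]
  gcongr

/-- `f` is computed in polynomial time: some program replaces the topmost tree `x` of the main
stack by `f x`. -/
def PT (A B : Type) {α β : Type} [Data α] [Data β] (f : α → β) : Prop :=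
  ∃ (c : Cmd (Alph A B)) (p : Polynomial ℕ), ∀ x i o r,
    c.Takes (main i o (dword x ++ r)) (main i o (dword (f x) ++ r)) (p.eval (dsize x))

namespace PT

variable {A B : Type} {α β γ δ ι : Type} [Data α] [Data β] [Data γ] [Data δ] [Data ι]

/-- The result is written at one symbol per step, so the time bounds its size. This keeps
compositions polynomial. -/
theorem size_le {f : α → β} (hf : PT A B f) :
    ∃ q : Polynomial ℕ, ∀ x, dsize (f x) ≤ q.eval (dsize x) := by
  obtain ⟨c, p, h⟩ := hf
  refine ⟨.X + p, fun x => ?_⟩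
  have := (h x [] [] []).length_le (.work .s)
  simpa [main, wk, dsize] using this

/-- A change of type that keeps the representing word costs nothing; constructors and codes are
handled in this way. -/
theorem of_dword_eq {f : α → β} (h : ∀ x, dword (f x) = dword x) : PT A B f :=
  ⟨.skip, 1, fun x i o r => by rw [h]; exact (Cmd.Takes.skip _).mono (by simp)⟩

theorem id : PT A B (fun x : α => x) := of_dword_eq fun _ => rfl

theorem comp {g : β → γ} {f : α → β} (hg : PT A B g) (hf : PT A B f) :
    PT A B (fun x => g (f x)) := by
  obtain ⟨q, hq⟩ := hf.size_le
  obtain ⟨c, p, h⟩ := hf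
  obtain ⟨c', p', h'⟩ := hg
  refine ⟨.seq c c', p + p'.comp q, fun x i o r => ?_⟩
  refine ((h x i o r).seq (h' (f x) i o r)).mono ?_
  simp only [Polynomial.eval_add, Polynomial.eval_comp]
  exact Nat.add_le_add_left (eval_mono p' (hq x)) _

theorem const (b : β) : PT A B (fun _ : α => b) := by
  refine ⟨.seq .drop (.pushWord (dword b)), 9 * .X + (3 + ((dword b).length + 1 : ℕ)),
    fun x i o r => ?_⟩
  refine ((Cmd.takes_drop (Data.tree x) r).seq (Cmd.takes_pushWord (dword b) r)).mono ?_
  simp [dsize, dword]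
  omega

theorem pair {f : α → β} {g : α → γ} (hf : PT A B f) (hg : PT A B g) :
    PT A B (fun x => (f x, g x)) := by
  obtain ⟨q, hq⟩ := hf.size_le
  obtain ⟨q', hq'⟩ := hg.size_le
  obtain ⟨c, p, h⟩ := hf
  obtain ⟨c', p', h'⟩ := hg
  -- The swaps expose first the copy of `x` and then the first result; the final push is the node
  -- symbol that joins both results.
  refine ⟨.seq .dup (.seq c (.seq .swap (.seq c' (.seq .swap (Cmd.pushW .s true))))),
    (18 * .X + 5) + (p + ((9 * .X + 9 * q + 6) + (p' + ((9 * q + 9 * q' + 6) + 1)))),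
    fun x i o r => ?_⟩
  have h₁ := Cmd.takes_dup (i := i) (o := o) (Data.tree x) r
  have h₂ := h x i o (dword x ++ r)
  have h₃ := Cmd.takes_swap (i := i) (o := o) (Data.tree (f x)) (Data.tree x) r
  have h₄ := h' x i o (dword (f x) ++ r)
  have h₅ := Cmd.takes_swap (i := i) (o := o) (Data.tree (g x)) (Data.tree (f x)) r
  have h₆ := Cmd.takes_push_s true i o (dword (f x) ++ (dword (g x) ++ r)) [] [] []
  have h₇ := h₁.seq (h₂.seq (h₃.seq (h₄.seq (h₅.seq h₆))))
  rw [dword_pair]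
  simp only [List.cons_append, List.append_assoc]
  refine h₇.mono ?_
  have := hq x
  have := hq' x
  simp only [Polynomial.eval_add, Polynomial.eval_mul, Polynomial.eval_ofNat, Polynomial.eval_X,
    Polynomial.eval_one, dsize, dword] at *
  omega

theorem fst : PT A B (fun x : α × β => x.1) := by
  refine ⟨.seq (Cmd.popW .s) (.seq .swap .drop), 1 + ((18 * .X + 6) + (9 * .X + 3)),
    fun x i o r => ?_⟩
  have h₁ := Cmd.takes_pop_s true i o (dword x.1 ++ (dword x.2 ++ r)) [] [] []
  have h₂ := Cmd.takes_swap (i := i) (o := o) (Data.tree x.1) (Data.tree x.2) r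
  have h₃ := Cmd.takes_drop (i := i) (o := o) (Data.tree x.2) (dword x.1 ++ r)
  have h₄ := h₁.seq (h₂.seq h₃)
  rw [show dword x = dword (x.1, x.2) from rfl, dword_pair]
  simp only [List.cons_append, List.append_assoc]
  refine h₄.mono ?_
  have : dsize x = _ := dsize_pair x.1 x.2
  simp only [Polynomial.eval_add, Polynomial.eval_mul, Polynomial.eval_ofNat, Polynomial.eval_X,
    Polynomial.eval_one, dsize, dword] at *
  omega

theorem snd : PT A B (fun x : α × β => x.2) := by
  refine ⟨.seq (Cmd.popW .s) .drop, 1 + (9 * .X + 3), fun x i o r => ?_⟩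
  have h₁ := Cmd.takes_pop_s true i o (dword x.1 ++ (dword x.2 ++ r)) [] [] []
  have h₃ := Cmd.takes_drop (i := i) (o := o) (Data.tree x.1) (dword x.2 ++ r)
  have h₄ := h₁.seq h₃
  rw [show dword x = dword (x.1, x.2) from rfl, dword_pair]
  simp only [List.cons_append, List.append_assoc]
  refine h₄.mono ?_
  have : dsize x = _ := dsize_pair x.1 x.2
  simp only [Polynomial.eval_add, Polynomial.eval_mul, Polynomial.eval_ofNat, Polynomial.eval_X,
    Polynomial.eval_one, dsize, dword] at *
  omega

theorem comp₂ {g : β × γ → δ} {f : α → β} {f' : α → γ} (hg : PT A B g) (hf : PT A B f)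
    (hf' : PT A B f') : PT A B (fun x => g (f x, f' x)) :=
  hg.comp (hf.pair hf')

/-- Case distinction on whether the tree of `h x` is a leaf or a node. -/
theorem tree_cases {f : γ → δ} {h : γ → ι} {k₀ : γ → δ} {k₁ : γ × (α × β) → δ}
    (hh : PT A B h) (h₀ : PT A B k₀) (h₁ : PT A B k₁)
    (e : ∀ x, (dword (h x) = [false] ∧ f x = k₀ x) ∨
      ∃ a b, dword (h x) = dword (a, b) ∧ f x = k₁ (x, (a, b))) : PT A B f := by
  obtain ⟨q, hq⟩ := hh.size_le
  obtain ⟨c, p, hc⟩ := hh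
  obtain ⟨c₀, p₀, hc₀⟩ := h₀
  obtain ⟨c₁, p₁, hc₁⟩ := h₁
  -- `h` runs on a copy of `x`, and the first symbol of its result tells a leaf from a node. For a
  -- node, exchanging the two trees and pushing a node symbol already forms `(x, (a, b))`.
  refine ⟨.seq .dup (.seq c (Cmd.casesW .s fun t => if t = some true then
      .seq .swap (.seq (Cmd.pushW .s true) c₁) else .seq (Cmd.popW .s) c₀)),
    (18 * .X + 5) + (p + ((1 + p₀) + ((9 * q + 9 * .X + 6) + (1 + p₁.comp (.X + q + 1))) + 1)),
    fun x i o r => ?_⟩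
  have t₁ := Cmd.takes_dup (i := i) (o := o) (Data.tree x) r
  have t₂ := hc x i o (dword x ++ r)
  have t₃ : Cmd.Takes (Cmd.casesW .s fun t => if t = some true then
      .seq .swap (.seq (Cmd.pushW .s true) c₁) else .seq (Cmd.popW .s) c₀)
      (main i o (dword (h x) ++ (dword x ++ r))) (main i o (dword (f x) ++ r))
      (((1 + p₀) + ((9 * q + 9 * .X + 6) + (1 + p₁.comp (.X + q + 1))) + 1 :
        Polynomial ℕ).eval (dsize x)) := by
    simp only [Polynomial.eval_add, Polynomial.eval_mul, Polynomial.eval_ofNat, Polynomial.eval_X,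
      Polynomial.eval_one, Polynomial.eval_comp]
    rcases e x with ⟨e₁, e₂⟩ | ⟨a, b, e₁, e₂⟩
    · rw [e₁, e₂]
      apply Cmd.Takes.cases
      simp only [main, store_work, wk, List.cons_append, List.nil_append, List.head?_cons,
        Option.some.injEq, Bool.false_eq_true, if_false]
      exact ((Cmd.takes_pop_s false i o _ [] [] []).seq (hc₀ x i o r)).mono (by omega)
    · have hs := hq x
      rw [e₁, e₂]
      apply Cmd.Takes.cases
      rw [if_pos (by simp [main, wk, dword_pair])]
      have s₁ := Cmd.takes_swap (i := i) (o := o) (Data.tree (a, b)) (Data.tree x) r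
      have s₂ := Cmd.takes_push_s true i o (dword x ++ (dword (a, b) ++ r)) [] [] []
      have s₃ := hc₁ (x, (a, b)) i o r
      rw [dword_pair x, List.cons_append, List.append_assoc] at s₃
      refine (s₁.seq (s₂.seq s₃)).mono ?_
      have e₃ : (Data.tree (a, b)).word.length = dsize (h x) := congrArg List.length e₁.symm
      have e₄ : dsize (a, b) = dsize (h x) := congrArg List.length e₁.symm
      have e₅ : (Data.tree x).word.length = dsize x := rfl
      have := eval_mono p₁ (show dsize (x, (a, b)) ≤ dsize x + q.eval (dsize x) + 1 by
        rw [dsize_pair x, e₄]; omega)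
      rw [e₃, e₅]
      simp only at this
      omega
  refine (t₁.seq (t₂.seq t₃)).mono ?_
  simp only [Polynomial.eval_add, Polynomial.eval_mul, Polynomial.eval_ofNat, Polynomial.eval_X,
      Polynomial.eval_one, Polynomial.eval_comp, dsize, dword]
  omega

theorem list_cases {f : γ → δ} {h : γ → List α} {k₀ : γ → δ} {k₁ : γ × (α × List α) → δ}
    (hh : PT A B h) (h₀ : PT A B k₀) (h₁ : PT A B k₁) (e₀ : ∀ x, h x = [] → f x = k₀ x)
    (e₁ : ∀ x a l, h x = a :: l → f x = k₁ (x, (a, l))) : PT A B f :=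
  tree_cases hh h₀ h₁ fun x => by
    cases hx : h x with
    | nil => exact .inl ⟨rfl, e₀ x hx⟩
    | cons a l => exact .inr ⟨a, l, rfl, e₁ x a l hx⟩

theorem nat_cases {f : γ → δ} {h : γ → ℕ} {k₀ : γ → δ} {k₁ : γ × ℕ → δ}
    (hh : PT A B h) (h₀ : PT A B k₀) (h₁ : PT A B k₁) (e₀ : ∀ x, h x = 0 → f x = k₀ x)
    (e₁ : ∀ x n, h x = n + 1 → f x = k₁ (x, n)) : PT A B f :=
  tree_cases (α := Unit) (β := ℕ) (k₁ := fun x => k₁ (x.1, x.2.2)) hh h₀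
    (h₁.comp₂ fst (snd.comp snd)) fun x => by
    cases hx : h x with
    | zero => exact .inl ⟨rfl, e₀ x hx⟩
    | succ n => exact .inr ⟨(), n, rfl, e₁ x n hx⟩

theorem ite {c : γ → Bool} {f g : γ → δ} (hc : PT A B c) (hf : PT A B f) (hg : PT A B g) :
    PT A B (fun x => if c x = true then f x else g x) := by
  have hn : PT A B (fun b : Bool => b.toNat) :=
    fst.comp (of_dword_eq (f := fun b : Bool => (b.toNat, (!b).toNat)) fun _ => rfl)
  refine nat_cases (k₁ := fun x => f x.1) (hn.comp hc) hg (hf.comp fst) (fun x e => ?_)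
    (fun x n e => ?_)
  · cases hx : c x <;> simp_all
  · cases hx : c x <;> simp_all

theorem nil : PT A B (fun _ : γ => ([] : List α)) := const []

theorem cons {f : γ → α} {g : γ → List α} (hf : PT A B f) (hg : PT A B g) :
    PT A B (fun x => f x :: g x) :=
  (of_dword_eq (α := α × List α) (f := fun p => p.1 :: p.2) fun _ => rfl).comp₂ hf hg

theorem succ {f : γ → ℕ} (hf : PT A B f) : PT A B (fun x => f x + 1) :=
  (of_dword_eq (α := Unit × ℕ) (f := fun p => p.2 + 1) fun _ => rfl).comp₂ (const ()) hf

theorem tail {f : γ → List α} (hf : PT A B f) : PT A B (fun x => (f x).tail) :=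
  list_cases (k₀ := fun _ => []) (k₁ := fun y => y.2.2) hf nil (snd.comp snd)
    (fun x h => by simp [h]) (fun x a l h => by simp [h])

theorem headD {f : γ → List α} (hf : PT A B f) (d : α) : PT A B (fun x => (f x).headD d) :=
  list_cases (k₀ := fun _ => d) (k₁ := fun y => y.2.1) hf (const d) (fst.comp snd)
    (fun x h => by simp [h]) (fun x a l h => by simp [h])

theorem isEmpty {f : γ → List α} (hf : PT A B f) : PT A B (fun x => (f x).isEmpty) :=
  list_cases (k₀ := fun _ => true) (k₁ := fun _ => false) hf (const _) (const _)
    (fun x h => by simp [h]) (fun x a l h => by simp [h])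

theorem getD {f : γ → List α} (hf : PT A B f) (n : ℕ) (d : α) :
    PT A B (fun x => (f x).getD n d) := by
  induction n generalizing f with
  | zero =>
    have := hf.headD d
    simpa [List.headD_eq_head?_getD, List.head?_eq_getElem?, List.getD_eq_getElem?_getD] using this
  | succ n ih =>
    have := ih hf.tail
    simpa [List.getD_eq_getElem?_getD] using this

theorem not {f : γ → Bool} (hf : PT A B f) : PT A B (fun x => !f x) := by
  convert hf.ite (const (β := Bool) false) (const true) using 2 with x
  cases f x <;> rfl

theorem and {f g : γ → Bool} (hf : PT A B f) (hg : PT A B g) : PT A B (fun x => f x && g x) := by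
  convert hf.ite hg (const false) using 2 with x
  cases f x <;> rfl

theorem or {f g : γ → Bool} (hf : PT A B f) (hg : PT A B g) : PT A B (fun x => f x || g x) := by
  convert hf.ite (const true) hg using 2 with x
  cases f x <;> rfl

/-- Recursion along a list, with an accumulator of polynomially bounded size. -/
theorem foldl_state {h : α → ι → α} (hh : PT A B (fun p : α × ι => h p.1 p.2))
    (hb : ∃ q : Polynomial ℕ, ∀ s l, dsize (List.foldl h s l) ≤ q.eval (dsize s + dsize l)) :
    PT A B (fun p : List ι × α => List.foldl h p.2 p.1) := by
  obtain ⟨q, hq⟩ := hb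
  have hg : PT A B (fun p : List ι × α => (p.1.tail,
      match p.1 with
      | [] => p.2
      | a :: _ => h p.2 a)) :=
    pair fst.tail (list_cases (h := fun p : List ι × α => p.1) (k₀ := fun p => p.2)
      (k₁ := fun y => h y.1.2 y.2.1) fst snd
      (hh.comp₂ (snd.comp fst) (fst.comp snd)) (fun x e => by rw [e])
      (fun x a l e => by rw [e]))
  obtain ⟨c, p, hc⟩ := hg
  -- List and accumulator lie on the stack without their common node symbol, so that the loop test
  -- sees the first symbol of the list. The body adds the node symbol and removes it again.
  set body : Cmd (Alph A B) := .seq (Cmd.pushW .s true) (.seq c (Cmd.popW .s)) with hbody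
  -- `N` bounds the list and the accumulators after all prefixes, hence the cost of every round.
  have key : ∀ N : ℕ, ∀ l s i o r,
      (∀ l₁ l₂, l₁ ++ l₂ = l → dsize (List.foldl h s l₁) ≤ N) → dsize l ≤ N →
      Cmd.Takes (Cmd.loopW .s (fun t => t = some true) body)
        (main i o (dword l ++ (dword s ++ r)))
        (main i o (false :: (dword (List.foldl h s l) ++ r)))
        ((p.eval (2 * N + 1) + 3) * l.length + 1) := by
    intro N l
    induction l with
    | nil =>
      intro s i o r _ _
      exact (Cmd.Takes.loop_false (by simp [main, wk, dword_nil])).mono (by simp)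
    | cons a l ih =>
      intro s i o r h₁ h₂
      have t₁ := Cmd.takes_push_s true i o (dword (a :: l) ++ (dword s ++ r)) [] [] []
      have t₂ := hc (a :: l, s) i o r
      have t₃ := Cmd.takes_pop_s true i o (dword l ++ (dword (h s a) ++ r)) [] [] []
      rw [dword_pair, dword_pair] at t₂
      simp only [List.cons_append, List.append_assoc, List.tail_cons] at t₂
      have t₄ := ih (h s a) i o r
        (fun l₁ l₂ e => h₁ (a :: l₁) l₂ (by simp [e])) (by rw [dsize_cons] at h₂; omega)
      have t₅ := Cmd.Takes.loop_true (p := fun t => decide (t = some true))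
        (S := main i o (dword (a :: l) ++ (dword s ++ r))) (k := .work .s)
        (by simp [main, wk, dword_cons]) (t₁.seq (t₂.seq t₃)) t₄
      refine t₅.mono ?_
      have := eval_mono p (show dsize (a :: l, s) ≤ 2 * N + 1 by
        have := h₁ [] (a :: l) rfl
        simp only [List.foldl_nil] at this
        rw [dsize_pair]; omega)
      simp only [List.length_cons] at this ⊢
      ring_nf at this ⊢
      omega
  refine ⟨.seq (Cmd.popW .s) (.seq (Cmd.loopW .s (fun t => t = some true) body) (Cmd.popW .s)),
    1 + (((p.comp (2 * (q + .X) + 1) + 3) * .X + 1) + 1), fun x i o r => ?_⟩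
  obtain ⟨l, s⟩ := x
  have hN : dsize s + dsize l ≤ dsize (l, s) := by rw [dsize_pair]; omega
  have t₁ := Cmd.takes_pop_s true i o (dword l ++ (dword s ++ r)) [] [] []
  have t₂ := key (q.eval (dsize (l, s)) + dsize (l, s)) l s i o r (fun l₁ l₂ e => by
    refine (hq s l₁).trans (le_trans (eval_mono q (le_trans ?_ hN)) (Nat.le_add_right _ _))
    have := dsize_append l₁ l₂
    have := dsize_pos l₂
    rw [e] at *
    omega) (by omega)
  have t₃ := Cmd.takes_pop_s false i o (dword (List.foldl h s l) ++ r) [] [] []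
  rw [dword_pair, List.cons_append, List.append_assoc]
  refine (t₁.seq (t₂.seq t₃)).mono ?_
  simp only [Polynomial.eval_add, Polynomial.eval_mul, Polynomial.eval_ofNat, Polynomial.eval_X,
    Polynomial.eval_one, Polynomial.eval_comp]
  have : l.length ≤ dsize (l, s) := (length_lt_dsize l).le.trans (by omega)
  gcongr

/-- Recursion along a list; each step enlarges the accumulator by a polynomially bounded amount. -/
theorem foldl {h : γ → α → ι → α} {l : γ → List ι} {a : γ → α}
    (hh : PT A B (fun p : γ × (α × ι) => h p.1 p.2.1 p.2.2)) (hl : PT A B l) (ha : PT A B a)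
    (q : Polynomial ℕ) (hq : ∀ x s i, dsize (h x s i) ≤ dsize s + q.eval (dsize x + dsize i)) :
    PT A B (fun x => List.foldl (h x) (a x) (l x)) := by
  -- The parameter `x` travels with the accumulator, since a step of `foldl_state` sees only the
  -- state and the next element.
  have hs : ∀ (l : List ι) (p : γ × α), List.foldl (fun p i => (p.1, h p.1 p.2 i)) p l =
      (p.1, List.foldl (h p.1) p.2 l) := by
    intro l
    induction l with
    | nil => intro p; rfl
    | cons i l ih => intro p; simp [ih]
  have hb : ∀ (l : List ι) (x : γ) (s : α),
      dsize (List.foldl (h x) s l) ≤ dsize s + l.length * q.eval (dsize x + dsize l) := by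
    intro l
    induction l with
    | nil => intro x s; simp
    | cons i l ih =>
      intro x s
      have h₁ := ih x (h x s i)
      have h₂ := hq x s i
      have h₃ := eval_mono q (show dsize x + dsize i ≤ dsize x + dsize (i :: l) by
        rw [dsize_cons]; omega)
      have h₄ := eval_mono q (show dsize x + dsize l ≤ dsize x + dsize (i :: l) by
        rw [dsize_cons]; omega)
      simp only [List.foldl_cons, List.length_cons] at *
      have h₅ := Nat.mul_le_mul_left l.length h₄
      rw [Nat.add_mul, Nat.one_mul]
      omega
  have key := foldl_state (h := fun (p : γ × α) (i : ι) => (p.1, h p.1 p.2 i))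
    (pair (fst.comp fst) (hh.comp₂ (fst.comp fst) (pair (snd.comp fst) snd)))
    ⟨.X + .X * q + 1, fun p l => by
      rw [hs, dsize_pair]
      have h₁ := hb l p.1 p.2
      obtain ⟨x, s⟩ := p
      simp only [dsize_pair, Polynomial.eval_add, Polynomial.eval_mul, Polynomial.eval_X,
        Polynomial.eval_one] at *
      have h₂ := eval_mono q (show dsize x + dsize l ≤ dsize x + dsize s + 1 + dsize l by omega)
      have h₃ := Nat.mul_le_mul (show l.length ≤ dsize x + dsize s + 1 + dsize l by
        have := length_lt_dsize l; omega) h₂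
      simp only at h₃
      omega⟩
  have := snd.comp (key.comp₂ hl (pair id ha))
  simpa only [hs] using this

end PT


/-! ### List functions, iteration and finite case distinctions -/

namespace PT

variable {A B : Type} {α β γ δ ι : Type} [Data α] [Data β] [Data γ] [Data δ] [Data ι]

theorem reverse {l : γ → List α} (hl : PT A B l) : PT A B (fun x => (l x).reverse) := by
  have := foldl (A := A) (B := B) (γ := γ) (h := fun _ (s : List α) i => i :: s) (l := l)
    (a := fun _ => []) (cons (snd.comp snd) (fst.comp snd)) hl nil (.X + 1) (fun x s i => by
      simp [dsize_cons]; omega)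
  have e : ∀ l s : List α, List.foldl (fun s i => i :: s) s l = l.reverse ++ s := by
    intro l
    induction l with
    | nil => simp
    | cons i l ih => simp [ih]
  simpa [e] using this

theorem foldr {h : γ → ι → α → α} {l : γ → List ι} {a : γ → α}
    (hh : PT A B (fun p : γ × (ι × α) => h p.1 p.2.1 p.2.2)) (hl : PT A B l) (ha : PT A B a)
    (q : Polynomial ℕ) (hq : ∀ x i s, dsize (h x i s) ≤ dsize s + q.eval (dsize x + dsize i)) :
    PT A B (fun x => List.foldr (h x) (a x) (l x)) := by
  have := foldl (A := A) (B := B) (h := fun x s i => h x i s) (l := fun x => (l x).reverse) (a := a)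
    (hh.comp₂ fst (pair (snd.comp snd) (fst.comp snd))) hl.reverse ha q (fun x s i => hq x i s)
  simpa only [List.foldl_reverse] using this

theorem append {l m : γ → List α} (hl : PT A B l) (hm : PT A B m) :
    PT A B (fun x => l x ++ m x) := by
  have := foldr (A := A) (B := B) (h := fun (_ : γ) (i : α) (s : List α) => i :: s) (l := l) (a := m)
    (cons (fst.comp snd) (snd.comp snd)) hl hm (.X + 1) (fun x i s => by
      simp [dsize_cons]; omega)
  have e : ∀ l m : List α, List.foldr (fun i s => i :: s) m l = l ++ m := by simp
  simpa only [e] using this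

theorem map {f : γ → ι → α} {l : γ → List ι} (hf : PT A B (fun p : γ × ι => f p.1 p.2))
    (hl : PT A B l) : PT A B (fun x => (l x).map (f x)) := by
  obtain ⟨q, hq⟩ := hf.size_le
  have := foldr (A := A) (B := B) (h := fun (x : γ) (i : ι) (s : List α) => f x i :: s) (l := l)
    (a := fun _ => []) (cons (hf.comp₂ fst (fst.comp snd)) (snd.comp snd)) hl nil
    (q.comp (.X + 1) + 1) (fun x i s => by
      have := hq (x, i)
      simp only [dsize_pair] at this
      simp [dsize_cons]; omega)
  have e : ∀ x (l : List ι), List.foldr (fun i s => f x i :: s) [] l = l.map (f x) := by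
    intro x l
    induction l with
    | nil => rfl
    | cons i l ih => simp [ih]
  simpa only [e] using this

theorem flatMap {f : γ → ι → List α} {l : γ → List ι} (hf : PT A B (fun p : γ × ι => f p.1 p.2))
    (hl : PT A B l) : PT A B (fun x => (l x).flatMap (f x)) := by
  obtain ⟨q, hq⟩ := hf.size_le
  have := foldr (A := A) (B := B) (h := fun (x : γ) (i : ι) (s : List α) => f x i ++ s) (l := l)
    (a := fun _ => []) (append (hf.comp₂ fst (fst.comp snd)) (snd.comp snd)) hl nil
    (q.comp (.X + 1)) (fun x i s => by
      have := hq (x, i)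
      have := dsize_append (f x i) s
      simp only [dsize_pair] at *
      simp; omega)
  have e : ∀ x (l : List ι), List.foldr (fun i s => f x i ++ s) [] l = l.flatMap (f x) := by
    intro x l
    induction l with
    | nil => rfl
    | cons i l ih => simp [ih]
  simpa only [e] using this

/-- A unary number and a list of units have the same tree, which turns iteration into recursion
along a list. -/
theorem replicate_unit {n : γ → ℕ} (hn : PT A B n) :
    PT A B (fun x => List.replicate (n x) ()) := by
  refine (of_dword_eq (α := ℕ) (f := fun n => List.replicate n ()) fun n => ?_).comp hn
  induction n with
  | zero => rfl
  | succ n ih => rw [dword_succ, List.replicate_succ, dword_cons, ih]; rfl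

theorem replicate {n : γ → ℕ} {f : γ → α} (hn : PT A B n) (hf : PT A B f) :
    PT A B (fun x => List.replicate (n x) (f x)) := by
  have := map (A := A) (B := B) (f := fun (x : γ) (_ : Unit) => f x) (hf.comp fst)
    hn.replicate_unit
  simpa only [List.map_replicate] using this

/-- Iteration a number of times that is given in unary. -/
theorem iterate {h : γ → α → α} {n : γ → ℕ} {a : γ → α}
    (hh : PT A B (fun p : γ × α => h p.1 p.2)) (hn : PT A B n) (ha : PT A B a)
    (q : Polynomial ℕ) (hq : ∀ x s, dsize (h x s) ≤ dsize s + q.eval (dsize x)) :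
    PT A B (fun x => (h x)^[n x] (a x)) := by
  have := foldl (A := A) (B := B) (h := fun (x : γ) (s : α) (_ : Unit) => h x s)
    (hh.comp₂ fst (fst.comp snd)) hn.replicate_unit ha q (fun x s i =>
      (hq x s).trans (Nat.add_le_add_left (eval_mono q (Nat.le_add_right _ _)) _))
  have e : ∀ x s n, List.foldl (fun s (_ : Unit) => h x s) s (List.replicate n ()) = (h x)^[n] s := by
    intro x s n
    induction n generalizing s with
    | zero => rfl
    | succ n ih => simp [List.replicate_succ, ih]
  simpa only [e] using this

theorem length {l : γ → List α} (hl : PT A B l) : PT A B (fun x => (l x).length) := by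
  have := foldl (A := A) (B := B) (h := fun (_ : γ) (s : ℕ) (_ : α) => s + 1) (l := l)
    (a := fun _ => 0) (succ (fst.comp snd)) hl (const 0) 2 (fun x s i => by
      simp [dsize_nat]; omega)
  have e : ∀ (l : List α) (s : ℕ), List.foldl (fun s _ => s + 1) s l = s + l.length := by
    intro l
    induction l with
    | nil => simp
    | cons i l ih => intro s; simp [ih]; omega
  simpa only [e, Nat.zero_add] using this

theorem add {m n : γ → ℕ} (hm : PT A B m) (hn : PT A B n) : PT A B (fun x => m x + n x) := by
  have := iterate (A := A) (B := B) (h := fun (_ : γ) (s : ℕ) => s + 1) (succ snd) hn hm 2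
    (fun x s => by simp [dsize_nat]; omega)
  have e : ∀ n s : ℕ, (fun s => s + 1)^[n] s = s + n := by
    intro n
    induction n with
    | zero => simp
    | succ n ih => intro s; simp only [Function.iterate_succ_apply, ih]; omega
  simpa only [e] using this

/-- One list is traversed while the other is consumed; they agree if no comparison fails and nothing
is left over. -/
theorem list_beq [DecidableEq α] (h : PT A B (fun p : α × α => decide (p.1 = p.2))) :
    PT A B (fun p : List α × List α => decide (p.1 = p.2)) := by
  have key := foldl (A := A) (B := B) (γ := List α × List α)
    (h := fun _ (s : List α × Bool) (a : α) =>
      -- On an exhausted list the default value `a` passes the comparison, so emptiness is tested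
      -- separately.
      (s.1.tail, s.2 && (!s.1.isEmpty && decide (s.1.headD a = a))))
    (l := fun p => p.1) (a := fun p => (p.2, true))
    (pair (fst.comp (fst.comp snd)).tail
      (and (snd.comp (fst.comp snd)) (and (fst.comp (fst.comp snd)).isEmpty.not
        (h.comp₂ (list_cases (h := fun p => p.2.1.1) (k₀ := fun p => p.2.2) (k₁ := fun y => y.2.1)
          (fst.comp (fst.comp snd)) (snd.comp snd) (fst.comp snd) (fun x e => by simp [e])
          (fun x a l e => by simp [e])) (snd.comp snd)))))
    fst (pair snd (const true)) 0 (fun x s i => by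
      have : dsize s.1.tail ≤ dsize s.1 := by
        cases s.1 with
        | nil => simp
        | cons a l => rw [List.tail_cons, dsize_cons]; omega
      obtain ⟨m, b⟩ := s
      simp only [dsize_pair, dsize_bool] at *
      omega)
  have e : ∀ (l m : List α) (b : Bool),
      (let s := List.foldl (fun (s : List α × Bool) (a : α) =>
        (s.1.tail, s.2 && (!s.1.isEmpty && decide (s.1.headD a = a)))) (m, b) l
      s.2 && s.1.isEmpty) = (b && decide (l = m)) := by
    intro l
    induction l with
    | nil => intro m b; cases m <;> simp
    | cons a l ih =>
      intro m b
      simp only [List.foldl_cons, ih]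
      cases m with
      | nil => simp
      | cons c m =>
        simp only [List.isEmpty_cons, List.tail_cons, List.headD_cons, List.cons.injEq,
          Bool.decide_and, Bool.not_false, Bool.true_and, Bool.and_assoc]
        congr 2
        exact decide_eq_decide.2 eq_comm
  have := and (snd.comp key) (fst.comp key).isEmpty
  convert this using 2 with p
  rw [e p.1 p.2 true, Bool.true_and]

theorem nat_beq : PT A B (fun p : ℕ × ℕ => decide (p.1 = p.2)) := by
  have h : PT A B (fun p : Unit × Unit => decide (p.1 = p.2)) := by
    simpa using const (A := A) (B := B) (α := Unit × Unit) true
  have := h.list_beq.comp₂ (replicate_unit (A := A) (B := B) (fst (α := ℕ) (β := ℕ)))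
    snd.replicate_unit
  convert this using 2 with p
  simp

/-- `N` is fixed, so `N` nested case distinctions form a single program. -/
theorem min_cases (N : ℕ) {γ : Type} [Data γ] {k : ℕ → γ → δ} (hk : ∀ i, PT A B (k i)) {h : γ → ℕ}
    (hh : PT A B h) : PT A B (fun x => k (min (h x) N) x) := by
  induction N generalizing γ with
  | zero => simpa using hk 0
  | succ N ih =>
    refine nat_cases (k₁ := fun y => k (min y.2 N + 1) y.1) hh (hk 0)
      (ih (k := fun i y => k (i + 1) y.1) (fun i => comp (f := fun y : γ × ℕ => y.1) (hk (i + 1)) fst) snd) ?_ ?_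
    · intro x e; simp [e]
    · intro x n e; simp [e]

end PT

/-- A finite type whose elements are represented by their codes. -/
class Coded (ι : Type) where
  code : ι → ℕ
  code_injective : Function.Injective code
  bound : ℕ
  code_le : ∀ i, code i ≤ bound

@[reducible] noncomputable def Coded.ofFinite (ι : Type) [Finite ι] : Coded ι where
  code i := Finite.equivFin ι i
  code_injective _ _ h := (Finite.equivFin ι).injective (Fin.ext h)
  bound := Nat.card ι
  code_le i := (Finite.equivFin ι i).isLt.le

instance (priority := low) {ι : Type} [Coded ι] : Data ι := ⟨fun i => natTree (Coded.code i)⟩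

namespace PT

variable {A B : Type} {α β γ δ ι : Type} [Data α] [Data β] [Data γ] [Data δ] [Coded ι]

theorem code {h : γ → ι} (hh : PT A B h) : PT A B (fun x => Coded.code (h x)) :=
  (of_dword_eq (f := fun i : ι => Coded.code i) fun _ => rfl).comp hh

theorem dsize_coded_le (i : ι) : dsize i ≤ 2 * Coded.bound ι + 1 := by
  have h : dsize i = dsize (Coded.code i) := rfl
  have := Coded.code_le i
  rw [h, dsize_nat]
  omega

/-- Finite case distinction. -/
theorem finite_cases {k : ι → γ → δ} {h : γ → ι} (hk : ∀ i, PT A B (k i)) (hh : PT A B h) :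
    PT A B (fun x => k (h x) x) := by
  by_cases hι : Nonempty ι
  · have := min_cases (A := A) (B := B) (Coded.bound ι)
      (k := fun n => k (Function.invFun Coded.code n)) (fun i => hk _) hh.code
    convert this using 2 with x
    rw [Nat.min_eq_left (Coded.code_le _), Function.leftInverse_invFun Coded.code_injective]
  · exact ⟨.skip, 0, fun x => (hι ⟨h x⟩).elim⟩

/-- Finite case distinction over the truth values. -/
theorem bool_cases {k : Bool → γ → δ} {h : γ → Bool} (hk : ∀ b, PT A B (k b)) (hh : PT A B h) :
    PT A B (fun x => k (h x) x) := by
  convert hh.ite (hk true) (hk false) using 2 with x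
  cases h x <;> simp

end PT


/-! ### Binary arithmetic -/

/-- Natural numbers, represented in binary. -/
structure Bin : Type where
  val : ℕ

instance : Data Bin := ⟨fun n => Data.tree n.val.bits⟩

/-- The number with the given binary digits, the least significant one first. -/
def listVal (l : List Bool) : ℕ := l.foldr (fun b n => Nat.bit b n) 0

theorem listVal_nil : listVal [] = 0 := rfl

theorem listVal_cons (b : Bool) (l : List Bool) : listVal (b :: l) = b.toNat + 2 * listVal l := by
  simp [listVal, Nat.bit]
  cases b <;> simp; omega

theorem listVal_append (l m : List Bool) :
    listVal (l ++ m) = listVal l + 2 ^ l.length * listVal m := by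
  induction l with
  | nil => simp [listVal_nil]
  | cons b l ih => simp [listVal_cons, ih, pow_succ]; ring

theorem listVal_lt (l : List Bool) : listVal l < 2 ^ l.length := by
  induction l with
  | nil => simp [listVal_nil]
  | cons b l ih =>
    rw [listVal_cons, List.length_cons, pow_succ]
    cases b <;> simp <;> omega

theorem listVal_bits (n : ℕ) : listVal n.bits = n := by
  induction n using Nat.binaryRec' with
  | zero => simp [listVal_nil]
  | bit b n h ih =>
    rw [Nat.bits_append_bit n b h, listVal_cons, ih, Nat.bit]
    cases b <;> simp; omega

/-- A zero digit above which there is nothing is dropped. Applied along a list, this removes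
superfluous zeros, as `PT.bin_mk` needs. -/
theorem bits_listVal_cons (b : Bool) (l : List Bool) :
    (listVal (b :: l)).bits =
      if (listVal l).bits.isEmpty && !b then [] else b :: (listVal l).bits := by
  have e : listVal (b :: l) = Nat.bit b (listVal l) := rfl
  rw [e]
  by_cases h : listVal l = 0 ∧ b = false
  · obtain ⟨h₁, rfl⟩ := h
    simp [h₁]
  · rw [Nat.bits_append_bit _ _ (by intro h₁; simpa [h₁] using h)]
    rw [if_neg]
    intro h₂
    simp only [Bool.and_eq_true, List.isEmpty_iff, Bool.not_eq_true'] at h₂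
    refine h ⟨?_, h₂.2⟩
    rw [← listVal_bits (listVal l), h₂.1, listVal_nil]

theorem dsize_bools (l : List Bool) : dsize l = 6 * l.length + 1 := by
  induction l with
  | nil => rfl
  | cons b l ih => rw [dsize_cons, dsize_bool, ih, List.length_cons]; omega

theorem dsize_bin (n : Bin) : dsize n = 6 * Nat.size n.val + 1 :=
  (dsize_bools n.val.bits).trans (by rw [← Nat.size_eq_bits_len])

/-- The bound is additive because the recursion principles allow an accumulator to grow only by an
amount independent of itself. -/
theorem dsize_bin_add (m n : Bin) :
    dsize (Bin.mk (m.val + n.val)) ≤ dsize m + dsize n + 6 := by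
  simp only [dsize_bin]
  generalize m.val = m
  generalize n.val = n
  have : Nat.size (m + n) ≤ Nat.size m + Nat.size n + 1 := by
    rw [Nat.size_le]
    have h₁ := Nat.lt_size_self m
    have h₂ := Nat.lt_size_self n
    have h₃ : 2 ^ m.size ≤ 2 ^ (m.size + n.size) := Nat.pow_le_pow_right (by norm_num) (by omega)
    have h₄ : 2 ^ n.size ≤ 2 ^ (m.size + n.size) := Nat.pow_le_pow_right (by norm_num) (by omega)
    rw [pow_succ]
    omega
  omega

/-- State of a digit-serial operation: the remaining digits of the operands, the carry, and the
digits of the result in reverse order. -/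
abbrev SerialState : Type := (List Bool × List Bool) × (Bool × List Bool)

def serialStep (sum carry : Bool → Bool → Bool → Bool) (s : SerialState) : SerialState :=
  ((s.1.1.tail, s.1.2.tail),
    (carry (s.1.1.headD false) (s.1.2.headD false) s.2.1,
      sum (s.1.1.headD false) (s.1.2.headD false) s.2.1 :: s.2.2))

/-- The rounds exhaust both operands, and the last one emits the final carry. -/
def serialLoop (sum carry : Bool → Bool → Bool → Bool) (a b : List Bool) : SerialState :=
  (serialStep sum carry)^[a.length + b.length + 1] ((a, b), (false, []))

def sum₃ (a b c : Bool) : Bool := xor (xor a b) c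

def carryAdd (a b c : Bool) : Bool := (a && b) || (c && (a || b))

def carrySub (a b c : Bool) : Bool := ((!a) && (b || c)) || (b && c)

theorem listVal_eq_head_tail (l : List Bool) :
    listVal l = (l.headD false).toNat + 2 * listVal l.tail := by
  cases l with
  | nil => simp [listVal_nil]
  | cons b l => simp [listVal_cons]

/-- `ε = 1` is addition and `ε = -1` subtraction; `hc` is the identity for a single column. The
digits produced, plus the shifted value of what remains, are invariant. -/
theorem serial_invariant (carry : Bool → Bool → Bool → Bool) (ε : ℤ)
    (hc : ∀ a b c : Bool, ((sum₃ a b c).toNat : ℤ) + 2 * (ε * (carry a b c).toNat) =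
      a.toNat + ε * b.toNat + ε * c.toNat) (k : ℕ) (a b : List Bool) :
    let s := (serialStep sum₃ carry)^[k] ((a, b), (false, []))
    (listVal s.2.2.reverse : ℤ) + 2 ^ s.2.2.length *
      (listVal s.1.1 + ε * listVal s.1.2 + ε * s.2.1.toNat) = listVal a + ε * listVal b ∧
    s.1.1 = a.drop k ∧ s.1.2 = b.drop k := by
  induction k with
  | zero => simp [listVal_nil]
  | succ k ih =>
    rw [Function.iterate_succ_apply']
    set s := (serialStep sum₃ carry)^[k] ((a, b), (false, [])) with hs
    obtain ⟨ih, ih₁, ih₂⟩ := ih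
    refine ⟨?_, by simp [serialStep, ih₁, List.tail_drop], by simp [serialStep, ih₂, List.tail_drop]⟩
    rw [← ih]
    have h := hc (s.1.1.headD false) (s.1.2.headD false) s.2.1
    have h₁ := listVal_eq_head_tail s.1.1
    have h₂ := listVal_eq_head_tail s.1.2
    rw [h₁, h₂]
    simp only [serialStep, List.reverse_cons, listVal_append, listVal_cons, listVal_nil,
      List.length_reverse, List.length_cons, pow_succ]
    push_cast
    linear_combination (2 : ℤ) ^ s.2.2.length * h

theorem serialLoop_add (a b : List Bool) :
    listVal (serialLoop sum₃ carryAdd a b).2.2.reverse = listVal a + listVal b := by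
  have h := serial_invariant carryAdd 1 (by decide) (a.length + b.length) a b
  simp only [serialLoop]
  rw [Function.iterate_succ_apply']
  set s := (serialStep sum₃ carryAdd)^[a.length + b.length] ((a, b), (false, [])) with hs
  obtain ⟨h, h₁, h₂⟩ := h
  rw [List.drop_eq_nil_of_le (by omega)] at h₁ h₂
  simp only [serialStep, h₁, h₂, listVal_nil, List.reverse_cons, listVal_append, listVal_cons,
    List.length_reverse] at h ⊢
  zify
  rw [← Int.one_mul (listVal b : ℤ), ← h]
  cases s.2.1 <;> simp [sum₃]

/-- The digits produced represent a number below `2 ^ length`, so the last borrow shows the sign of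
the difference. -/
theorem serialLoop_sub (a b : List Bool) :
    ((serialLoop sum₃ carrySub a b).2.1 = decide (listVal a < listVal b)) ∧
    (listVal b ≤ listVal a →
      listVal (serialLoop sum₃ carrySub a b).2.2.reverse = listVal a - listVal b) := by
  have h := serial_invariant carrySub (-1) (by decide) (a.length + b.length + 1) a b
  simp only [serialLoop]
  set s := (serialStep sum₃ carrySub)^[a.length + b.length + 1] ((a, b), (false, [])) with hs
  obtain ⟨h, h₁, h₂⟩ := h
  rw [List.drop_eq_nil_of_le (by omega)] at h₁ h₂
  simp only [h₁, h₂, listVal_nil] at h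
  have hlt := listVal_lt s.2.2.reverse
  rw [List.length_reverse] at hlt
  zify at hlt
  cases hc : s.2.1 with
  | false =>
    rw [hc] at h
    simp only [Bool.toNat_false] at h
    simp at h
    refine ⟨?_, fun _ => ?_⟩
    · symm; rw [decide_eq_false_iff_not]; omega
    · omega
  | true =>
    rw [hc] at h
    simp only [Bool.toNat_true] at h
    simp at h
    refine ⟨?_, fun _ => ?_⟩
    · symm; rw [decide_eq_true_eq]; omega
    · omega

namespace PT

variable {A B : Type} {α β γ δ ι : Type} [Data α] [Data β] [Data γ] [Data δ] [Data ι]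

theorem bits {n : γ → Bin} (hn : PT A B n) : PT A B (fun x => (n x).val.bits) :=
  (of_dword_eq (f := fun n : Bin => n.val.bits) fun _ => rfl).comp hn

theorem bin_mk {l : γ → List Bool} (hl : PT A B l) : PT A B (fun x => Bin.mk (listVal (l x))) := by
  have h₁ := foldr (A := A) (B := B) (l := l) (a := fun _ => ([] : List Bool))
    (h := fun _ b s => if (s.isEmpty && !b) = true then [] else b :: s)
    (ite (and (snd.comp snd).isEmpty (fst.comp snd).not) nil (cons (fst.comp snd) (snd.comp snd)))
    hl nil 6 (fun x b s => by
      split_ifs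
      · have := dsize_pos s
        rw [dsize_nil]; omega
      · simp [dsize_cons, dsize_bool]; omega)
  have e : ∀ l : List Bool, List.foldr (fun b s => if (s.isEmpty && !b) = true then [] else b :: s)
      [] l = (listVal l).bits := by
    intro l
    induction l with
    | nil => simp [listVal_nil]
    | cons b l ih => rw [List.foldr_cons, ih, bits_listVal_cons]
  obtain ⟨c, p, h⟩ := h₁
  simp only [e] at h
  exact ⟨c, p, h⟩

theorem xor {f g : γ → Bool} (hf : PT A B f) (hg : PT A B g) :
    PT A B (fun x => Bool.xor (f x) (g x)) := by
  convert hf.ite hg.not hg using 2 with x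
  cases f x <;> simp

theorem serialLoop {sum carry : Bool → Bool → Bool → Bool}
    (hs : PT A B (fun p : Bool × (Bool × Bool) => sum p.1 p.2.1 p.2.2))
    (hc : PT A B (fun p : Bool × (Bool × Bool) => carry p.1 p.2.1 p.2.2))
    {a b : γ → List Bool} (ha : PT A B a) (hb : PT A B b) :
    PT A B (fun x => MaxCSP.serialLoop sum carry (a x) (b x)) := by
  have h₁ : PT A B (fun p : γ × SerialState => p.2.1.1) := fst.comp (fst.comp snd)
  have h₂ : PT A B (fun p : γ × SerialState => p.2.1.2) := snd.comp (fst.comp snd)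
  have h₃ : PT A B (fun p : γ × SerialState => p.2.2.1) := fst.comp (snd.comp snd)
  have h₄ : PT A B (fun p : γ × SerialState => p.2.2.2) := snd.comp (snd.comp snd)
  have hd := pair (h₁.headD false) (pair (h₂.headD false) h₃)
  exact iterate (A := A) (B := B) (h := fun _ s => serialStep sum carry s)
    (pair (pair h₁.tail h₂.tail) (pair (hc.comp hd) (cons (hs.comp hd) h₄)))
    (succ (add ha.length hb.length)) (pair (pair ha hb) (pair (const false) nil)) 6 (fun x s => by
      obtain ⟨⟨a, b⟩, c, l⟩ := s
      simp only [serialStep, dsize_pair, dsize_bool, dsize_bools, List.length_cons,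
        List.length_tail, Polynomial.eval_ofNat]
      omega)

theorem sum₃ : PT A B (fun p : Bool × (Bool × Bool) => MaxCSP.sum₃ p.1 p.2.1 p.2.2) :=
  xor (xor fst (fst.comp snd)) (snd.comp snd)

theorem bin_add {m n : γ → Bin} (hm : PT A B m) (hn : PT A B n) :
    PT A B (fun x => Bin.mk ((m x).val + (n x).val)) := by
  have hc : PT A B (fun p : Bool × (Bool × Bool) => carryAdd p.1 p.2.1 p.2.2) :=
    or (and fst (fst.comp snd)) (and (snd.comp snd) (or fst (fst.comp snd)))
  have := bin_mk (reverse (snd.comp (snd.comp (serialLoop sum₃ hc hm.bits hn.bits))))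
  simpa only [serialLoop_add, listVal_bits] using this

theorem carrySub : PT A B (fun p : Bool × (Bool × Bool) => MaxCSP.carrySub p.1 p.2.1 p.2.2) :=
  or (and fst.not (or (fst.comp snd) (snd.comp snd))) (and (fst.comp snd) (snd.comp snd))

theorem bin_lt {m n : γ → Bin} (hm : PT A B m) (hn : PT A B n) :
    PT A B (fun x => decide ((m x).val < (n x).val)) := by
  have := fst.comp (snd.comp (serialLoop sum₃ carrySub hm.bits hn.bits))
  simpa only [(serialLoop_sub _ _).1, listVal_bits] using this

theorem bin_sub {m n : γ → Bin} (hm : PT A B m) (hn : PT A B n) :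
    PT A B (fun x => Bin.mk ((m x).val - (n x).val)) := by
  have h := bin_mk (reverse (snd.comp (snd.comp (serialLoop sum₃ carrySub hm.bits hn.bits))))
  convert (bin_lt hm hn).ite (const ⟨0⟩) h using 2 with x
  by_cases hx : (m x).val < (n x).val
  · simp [hx, Nat.sub_eq_zero_of_le hx.le]
  · have := (serialLoop_sub (m x).val.bits (n x).val.bits).2 (by simpa [listVal_bits] using hx)
    rw [this, listVal_bits, listVal_bits]
    simp [hx]

theorem bin_smul (k : ℕ) {m : γ → Bin} (hm : PT A B m) :
    PT A B (fun x => Bin.mk (k * (m x).val)) := by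
  induction k with
  | zero => simpa using const (A := A) (B := B) (α := γ) (Bin.mk 0)
  | succ k ih =>
    have := bin_add ih hm
    simpa only [Nat.succ_mul] using this

/-- A binary number times a number given in unary. -/
theorem nat_mul_bin {k : γ → ℕ} {m : γ → Bin} (hk : PT A B k) (hm : PT A B m) :
    PT A B (fun x => Bin.mk (k x * (m x).val)) := by
  have := iterate (A := A) (B := B) (h := fun (x : γ × Bin) (s : Bin) => Bin.mk (s.val + x.2.val))
    (γ := γ × Bin) (n := fun x => k x.1) (a := fun _ => Bin.mk 0)
    (bin_add snd (snd.comp fst)) (hk.comp fst) (const _) (.X + 6) (fun x s => by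
      have := dsize_bin_add s x.2
      obtain ⟨y, z⟩ := x
      simp only [dsize_pair, Polynomial.eval_add, Polynomial.eval_X, Polynomial.eval_ofNat] at *
      omega)
  have e : ∀ (z : ℕ) (k s : ℕ), (fun s : Bin => Bin.mk (s.val + z))^[k] ⟨s⟩ = ⟨s + k * z⟩ := by
    intro z k
    induction k with
    | zero => simp
    | succ k ih => intro s; simp only [Function.iterate_succ_apply, ih, Bin.mk.injEq]; ring
  have h := this.comp₂ id hm
  simpa only [e, Nat.zero_add] using h

theorem bin_sum {f : γ → ι → Bin} {l : γ → List ι} (hf : PT A B (fun p : γ × ι => f p.1 p.2))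
    (hl : PT A B l) : PT A B (fun x => Bin.mk ((l x).map fun i => (f x i).val).sum) := by
  obtain ⟨q, hq⟩ := hf.size_le
  have := foldr (A := A) (B := B) (h := fun (x : γ) (i : ι) (s : Bin) => Bin.mk ((f x i).val + s.val))
    (a := fun _ => Bin.mk 0) (bin_add (hf.comp₂ fst (fst.comp snd)) (snd.comp snd)) hl (const _)
    (q.comp (.X + 1) + 6) (fun x i s => by
      have h₁ := dsize_bin_add (f x i) s
      have h₂ := hq (x, i)
      simp only [dsize_pair, Polynomial.eval_add, Polynomial.eval_X, Polynomial.eval_ofNat,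
        Polynomial.eval_comp, Polynomial.eval_one] at *
      omega)
  have e : ∀ (x : γ) (l : List ι), List.foldr (fun i s => Bin.mk ((f x i).val + s.val)) ⟨0⟩ l =
      ⟨(l.map fun i => (f x i).val).sum⟩ := by
    intro x l
    induction l with
    | nil => rfl
    | cons i l ih => simp [ih]
  simpa only [e] using this

end PT


/-! ### From programs on trees to Turing machines on words -/

variable {A B : Type}

theorem store_inp_eq_update (x : List A) :
    store x ([] : List B) (wk [] [] [] []) =
      Function.update (β := fun k => List (Alph A B k)) (fun _ => []) Reg.inp x := by
  funext k
  rcases k with _ | _ | _ | _ | _ | _ <;> rfl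

theorem store_out_eq_update (y : List B) :
    store ([] : List A) y (wk [] [] [] []) =
      Function.update (β := fun k => List (Alph A B k)) (fun _ => []) Reg.out y := by
  funext k
  rcases k with _ | _ | _ | _ | _ | _ <;> rfl

namespace Cmd

def readBody [Coded A] : Cmd (Alph A B) :=
  .cases (G := Alph A B) .inp fun o =>
    match o with
    | none => .skip
    | some a => .seq (.pop .inp) (.seq (pushWord (dword (a : A))) (pushW .s true))

/-- Moves the input to the main work stack. -/
def readInput [Coded A] : Cmd (Alph A B) := .loop (G := Alph A B) .inp Option.isSome readBody

theorem takes_readInput [Coded A] (l m : List A) (o : List B) (r : List Bool) :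
    Takes readInput (main l o (dword m ++ r)) (main [] o (dword (l.reverse ++ m) ++ r))
      ((2 * Coded.bound A + 6) * l.length + 1) := by
  induction l generalizing m with
  | nil => exact (Takes.loop_false rfl).mono (by simp)
  | cons a l ih =>
    have h₁ : Takes (G := Alph A B) (.pop .inp) (main (a :: l) o (dword m ++ r))
        (main l o (dword m ++ r)) 1 := by
      have := Takes.pop (G := Alph A B) .inp (main (a :: l) o (dword m ++ r))
      rwa [update_store_inp] at this
    have h₂ := takes_pushWord (i := l) (o := o) (dword a) (dword m ++ r)
    have h₃ := takes_push_s true l o (dword a ++ (dword m ++ r)) [] [] []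
    have h₄ := ih (a :: m)
    rw [dword_cons, List.cons_append, List.append_assoc] at h₄
    have h₅ : Takes readBody (main (a :: l) o (dword m ++ r))
        (main l o (true :: (dword a ++ (dword m ++ r)))) (1 + ((dword a).length + 1 + 1) + 1) :=
      Takes.cases (h₁.seq (h₂.seq h₃))
    have h₆ := Takes.loop_true (k := Reg.inp) (p := Option.isSome) rfl h₅ h₄
    rw [List.reverse_cons, List.append_assoc]
    refine h₆.mono ?_
    have : (dword a).length ≤ _ := PT.dsize_coded_le a
    rw [List.length_cons, Nat.mul_succ]
    omega

/-- Removes a number `n ≤ N` in unary from the main stack, and continues with `k n`. -/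
def branchNat : ℕ → (ℕ → Cmd (Alph A B)) → Cmd (Alph A B)
  | 0, k => .seq (popW .s) (k 0)
  | N + 1, k => casesW .s fun o =>
      if o = some true then .seq (popW .s) (.seq (popW .s) (branchNat N fun n => k (n + 1)))
      else .seq (popW .s) (k 0)

theorem takes_branchNat {N : ℕ} {k : ℕ → Cmd (Alph A B)} {n : ℕ} (hn : n ≤ N) {i : List A}
    {o : List B} {r : List Bool} {S : ∀ k, List (Alph A B k)} {b : ℕ}
    (h : Takes (k n) (main i o r) S b) :
    Takes (branchNat N k) (main i o (dword n ++ r)) S (b + 3 * N + 1) := by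
  induction N generalizing k n with
  | zero =>
    obtain rfl : n = 0 := by omega
    exact ((takes_pop_s false i o r [] [] []).seq h).mono (by omega)
  | succ N ih =>
    cases n with
    | zero =>
      refine (Takes.cases (b := 1 + b) ?_).mono (by omega)
      exact (takes_pop_s false i o r [] [] []).seq h
    | succ n =>
      have h₁ := ih (k := fun n => k (n + 1)) (n := n) (by omega) h
      refine (Takes.cases (b := 1 + (1 + (b + 3 * N + 1))) ?_).mono (by omega)
      exact (takes_pop_s true i o _ [] [] []).seq ((takes_pop_s false i o _ [] [] []).seq h₁)

open Classical in
noncomputable def pushCode [Coded B] (n : ℕ) : Cmd (Alph A B) :=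
  if h : ∃ b : B, Coded.code b = n then .push (G := Alph A B) .out (h.choose : B) else .skip

theorem takes_pushCode [Coded B] (b : B) (i : List A) (o : List B) (r : List Bool) :
    Takes (pushCode (Coded.code b)) (main i o r) (main i (b :: o) r) 1 := by
  have h : ∃ b' : B, Coded.code b' = Coded.code b := ⟨b, rfl⟩
  rw [pushCode, dif_pos h, Coded.code_injective h.choose_spec]
  have := Takes.push (G := Alph A B) .out b (main i o r)
  rwa [update_store_out] at this

/-- Moves a list from the main work stack to the output. -/
noncomputable def writeOutput [Coded B] : Cmd (Alph A B) :=
  loopW .s (fun o => o = some true) (.seq (popW .s) (branchNat (Coded.bound B) pushCode))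

theorem takes_writeOutput [Coded B] (l o : List B) (i : List A) (r : List Bool) :
    Takes writeOutput (main i o (dword l ++ r)) (main i (l.reverse ++ o) (false :: r))
      ((3 * Coded.bound B + 4) * l.length + 1) := by
  induction l generalizing o with
  | nil => exact (Takes.loop_false rfl).mono (by simp)
  | cons b l ih =>
    have h₁ := takes_pop_s true i o (dword b ++ (dword l ++ r)) [] [] []
    have h₂ := takes_branchNat (Coded.code_le b) (takes_pushCode b i o (dword l ++ r))
    have h₃ := Takes.loop_true (G := Alph A B) (p := fun o => decide (o = some true))
      (S := main i o (true :: (dword b ++ (dword l ++ r)))) (k := Reg.work .s) (by rfl)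
      (h₁.seq h₂) (ih (b :: o))
    rw [List.reverse_cons, List.append_assoc, dword_cons, List.cons_append, List.append_assoc]
    refine h₃.mono ?_
    rw [List.length_cons, Nat.mul_succ]
    omega

end Cmd

theorem dsize_coded_list_le {A : Type} [Coded A] (l : List A) :
    dsize l ≤ (2 * Coded.bound A + 2) * l.length + 1 := by
  induction l with
  | nil => simp [dsize_nil]
  | cons a l ih =>
    have := PT.dsize_coded_le a
    rw [dsize_cons, List.length_cons, Nat.mul_succ]
    omega

/-- Reading and writing each reverse a word, hence the reversed encodings. `F` enters only through
encodings, so `f` is free to work on other data. -/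
theorem nonempty_polyTime_of_PT [Finite A] [Finite B] [Coded A] [Coded B] {X Y : Type}
    {ea : X → List A} {eb : Y → List B} {F : X → Y} {f : List A → List B} (hf : PT A B f)
    (h : ∀ x, f (ea x).reverse = (eb (F x)).reverse) :
    Nonempty (Turing.TM2ComputableInPolyTime ea eb F) := by
  obtain ⟨q, hq⟩ := hf.size_le
  obtain ⟨c, p, hc⟩ := hf
  set a : ℕ := 2 * Coded.bound A + 2 with ha
  set b : ℕ := 3 * Coded.bound B + 4 with hb
  -- The leaf pushed at the start is the empty list on which the input is built up. The leaf that
  -- remains after writing is popped, because all stacks but the output must end empty.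
  let prog : Cmd (Alph A B) := .seq (Cmd.pushW .s false) (.seq Cmd.readInput
    (.seq c (.seq Cmd.writeOutput (Cmd.popW .s))))
  let time : Polynomial ℕ := 1 + (((a + 4 : ℕ) * .X + 1) + (p.comp ((a : Polynomial ℕ) * .X + 1) +
    (((b : Polynomial ℕ) * q.comp ((a : Polynomial ℕ) * .X + 1) + 1) + 1))) + 1
  have key : ∀ x l m, l = ea x → m = eb (F x) →
      Nonempty (Turing.TM2OutputsInTime (prog.toFinTM2 .inp .out) l (some m)
        (time.eval (ea x).length)) := by
    rintro x _ _ rfl rfl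
    have h₁ := Cmd.takes_push_s false (ea x) ([] : List B) [] [] [] []
    have h₂ := Cmd.takes_readInput (ea x) [] ([] : List B) []
    have h₃ := hc (ea x).reverse ([] : List A) ([] : List B) []
    have h₄ := Cmd.takes_writeOutput (f (ea x).reverse) [] ([] : List A) []
    have h₅ := Cmd.takes_pop_s false ([] : List A) (eb (F x)) [] [] [] []
    rw [List.append_nil (ea x).reverse] at h₂
    rw [List.append_nil (f (ea x).reverse).reverse, h x, List.reverse_reverse] at h₄
    rw [h x] at h₃
    obtain ⟨t, ht, hr⟩ := h₁.seq (h₂.seq (h₃.seq (h₄.seq h₅)))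
    rw [store_inp_eq_update, store_out_eq_update] at hr
    refine Cmd.outputsInTime_of_runs hr ?_
    have s₁ := dsize_coded_list_le (ea x).reverse
    rw [List.length_reverse, ← ha] at s₁
    have s₂ : (eb (F x)).reverse.length ≤ q.eval (a * (ea x).length + 1) := by
      rw [← h x]
      exact (length_lt_dsize _).le.trans ((hq _).trans (eval_mono q s₁))
    have s₃ := eval_mono p s₁
    have s₄ := Nat.mul_le_mul_left b s₂
    simp only [time, Polynomial.eval_add, Polynomial.eval_mul, Polynomial.eval_X,
      Polynomial.eval_one, Polynomial.eval_comp, Polynomial.eval_natCast, Nat.cast_id] at s₃ s₄ ⊢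
    rw [← hb, show 2 * Coded.bound A + 6 = a + 4 by omega] at ht
    omega
  exact ⟨⟨⟨prog.toFinTM2 .inp .out, Equiv.refl _, Equiv.refl _⟩, time, fun x =>
    (key x _ _ (List.map_id _) (List.map_id _)).some⟩⟩


/-! ### Sums of constraint applications -/

/-- A constraint applied to references in `ρ`. -/
structure Template (Γ : ConstraintLanguage) (ρ : Type) where
  con : {f : Constraint // f ∈ Γ}
  ref : Fin con.val.arity → ρ

namespace Template

variable {Γ : ConstraintLanguage} {ρ : Type}

def sat (τ : Template Γ ρ) (y : ρ → Bool) : Bool := τ.con.val.toFun fun j => y (τ.ref j)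

end Template

section Implements

variable {Γ : ConstraintLanguage} {ρ : Type}

/-- The number of satisfied templates of a list. -/
def satCount (E : List (Template Γ ρ)) (y : ρ → Bool) : ℕ := (E.map fun τ => (τ.sat y).toNat).sum

/-- `h` counts the satisfied templates of some list. -/
def Implements (Γ : ConstraintLanguage) (h : (ρ → Bool) → ℕ) : Prop :=
  ∃ E : List (Template Γ ρ), ∀ y, satCount E y = h y

theorem satCount_append (E E' : List (Template Γ ρ)) (y : ρ → Bool) :
    satCount (E ++ E') y = satCount E y + satCount E' y := by simp [satCount]

theorem satCount_le (E : List (Template Γ ρ)) (y : ρ → Bool) : satCount E y ≤ E.length := by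
  induction E with
  | nil => simp [satCount]
  | cons τ E ih =>
    have := Bool.toNat_le (τ.sat y)
    simp only [satCount, List.map_cons, List.sum_cons, List.length_cons] at ih ⊢
    omega

namespace Implements

theorem zero : Implements Γ (fun _ : ρ → Bool => 0) := ⟨[], fun _ => rfl⟩

theorem add {h h' : (ρ → Bool) → ℕ} (H : Implements Γ h) (H' : Implements Γ h') :
    Implements Γ fun y => h y + h' y :=
  let ⟨E, hE⟩ := H
  let ⟨E', hE'⟩ := H'
  ⟨E ++ E', fun y => by rw [satCount_append, hE, hE']⟩

theorem smul (n : ℕ) {h : (ρ → Bool) → ℕ} (H : Implements Γ h) :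
    Implements Γ fun y => n * h y := by
  induction n with
  | zero => simpa using zero
  | succ n ih => simpa [Nat.succ_mul] using ih.add H

theorem single {f : Constraint} (hf : f ∈ Γ) (r : Fin f.arity → ρ) :
    Implements Γ fun y => (f.toFun fun j => y (r j)).toNat :=
  ⟨[⟨⟨f, hf⟩, r⟩], fun y => by simp [satCount, Template.sat]⟩

theorem bounded {h : (ρ → Bool) → ℕ} (H : Implements Γ h) : ∃ N, ∀ y, h y ≤ N :=
  let ⟨E, hE⟩ := H
  ⟨E.length, fun y => hE y ▸ satCount_le E y⟩

/-- Two sums that attain their maxima on `P` and, within `P`, on `Q`, are combined. -/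
theorem combine {C D : (ρ → Bool) → ℕ} (hC : Implements Γ C) (hD : Implements Γ D)
    {P Q : (ρ → Bool) → Prop} {α δ : ℕ} (h₁ : ∀ y, C y ≤ α ∧ (C y = α ↔ P y))
    (h₂ : ∀ y, P y → D y ≤ δ ∧ (D y = δ ↔ Q y)) :
    ∃ (H : (ρ → Bool) → ℕ) (β : ℕ), Implements Γ H ∧ ∀ y, H y ≤ β ∧ (H y = β ↔ P y ∧ Q y) := by
  obtain ⟨N, hN⟩ := hD.bounded
  -- With the factor `N + 1`, one unit lost in `C` outweighs everything that `D` can contribute.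
  refine ⟨_, (N + 1) * α + δ, (hC.smul (N + 1)).add hD, fun y => ?_⟩
  by_cases hP : P y
  · have h₃ := (h₁ y).2.2 hP
    have h₄ := h₂ y hP
    rw [h₃]
    refine ⟨by omega, ⟨fun h => ⟨hP, h₄.2.1 (by omega)⟩, fun h => ?_⟩⟩
    rw [h₄.2.2 h.2]
  · have h₃ : C y < α := lt_of_le_of_ne (h₁ y).1 fun h => hP ((h₁ y).2.1 h)
    have h₄ := hN y
    have h₅ : (N + 1) * (C y + 1) ≤ (N + 1) * α := Nat.mul_le_mul_left _ h₃
    rw [Nat.mul_succ] at h₅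
    exact ⟨by omega, ⟨fun h => by omega, fun h => (hP h.1).elim⟩⟩

end Implements

/-- A function of `n` Boolean arguments whose substitution instances are sums of applications. -/
def Implements₂ (Γ : ConstraintLanguage) (h : Bool → Bool → ℕ) : Prop :=
  ∀ i j : Fin 4, Implements Γ fun y : Fin 4 → Bool => h (y i) (y j)

def HasXor (Γ : ConstraintLanguage) : Prop :=
  ∃ (h : Bool → Bool → ℕ) (ξ : ℕ), Implements₂ Γ h ∧ ∀ a b, h a b ≤ ξ ∧ (h a b = ξ ↔ a ≠ b)

def HasConstants (Γ : ConstraintLanguage) : Prop :=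
  ∃ (h : Bool → Bool → ℕ) (ξ : ℕ), Implements₂ Γ h ∧
    ∀ a b, h a b ≤ ξ ∧ (h a b = ξ ↔ a = false ∧ b = true)

def ComplementClosed (Γ : ConstraintLanguage) : Prop :=
  ∀ f ∈ Γ, ∀ x, f.toFun (fun i => !x i) = f.toFun x

/-- The resulting binary function takes at (0,1) and (1,0) the values of `f` at `s` and its
complement, and on the diagonal those at the constant assignments. -/
theorem implements₂_of_mem {f : Constraint} (hf : f ∈ Γ) (s : Fin f.arity → Bool) :
    Implements₂ Γ fun a b => (f.toFun fun i => if s i = true then b else a).toNat := by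
  intro i j
  convert Implements.single hf (fun k => if s k = true then j else i) using 4 with y
  funext k
  split_ifs <;> rfl

theorem exists_or_like (h₀ : ¬ Γ.IsZeroValid) : ∃ a : Bool → Bool → Bool,
    (Implements₂ Γ fun x y => (a x y).toNat) ∧ a false false = false ∧ a false true = true := by
  simp only [ConstraintLanguage.IsZeroValid, not_forall] at h₀
  obtain ⟨f, hf, hn, h₀⟩ := h₀
  have : ∃ s, f.toFun s = true := by
    by_contra! h
    exact hn (.inl fun x => by simpa using h x)
  obtain ⟨s, hs⟩ := this
  refine ⟨_, implements₂_of_mem hf s, ?_, ?_⟩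
  · simpa [Constraint.IsZeroValid] using h₀
  · refine (congrArg f.toFun (funext fun i => ?_)).trans hs
    cases s i <;> rfl

theorem exists_nand_like (h₁ : ¬ Γ.IsOneValid) : ∃ a : Bool → Bool → Bool,
    (Implements₂ Γ fun x y => (a x y).toNat) ∧ a true true = false ∧ a false true = true := by
  simp only [ConstraintLanguage.IsOneValid, not_forall] at h₁
  obtain ⟨f, hf, hn, h₁⟩ := h₁
  have : ∃ s, f.toFun s = true := by
    by_contra! h
    exact hn (.inl fun x => by simpa using h x)
  obtain ⟨s, hs⟩ := this
  refine ⟨_, implements₂_of_mem hf s, ?_, ?_⟩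
  · simpa [Constraint.IsOneValid] using h₁
  · refine (congrArg f.toFun (funext fun i => ?_)).trans hs
    cases s i <;> rfl

/-- The sum of `a` and `b` is 2 at (0,1) and at most 1 on the diagonal. Its value at (1,0) decides
between the alternatives. -/
theorem hasXor_or_hasConstants {a b : Bool → Bool → Bool}
    (ha : Implements₂ Γ fun x y => (a x y).toNat) (hb : Implements₂ Γ fun x y => (b x y).toNat)
    (a₀ : a false false = false) (a₁ : a false true = true) (b₀ : b true true = false)
    (b₁ : b false true = true) : HasXor Γ ∨ HasConstants Γ := by
  have h : Implements₂ Γ fun x y => (a x y).toNat + (b x y).toNat := fun i j => (ha i j).add (hb i j)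
  by_cases h₁ : a true false = true ∧ b true false = true
  · refine .inl ⟨_, 2, h, ?_⟩
    rintro (_ | _) (_ | _) <;> simp [a₀, a₁, b₀, b₁, h₁]
    · cases b false false <;> simp
    · cases a true true <;> simp
  · refine .inr ⟨_, 2, h, ?_⟩
    rintro (_ | _) (_ | _) <;> simp [a₀, a₁, b₀, b₁]
    · cases b false false <;> simp
    · revert h₁
      cases a true false <;> cases b true false <;> simp
    · cases a true true <;> simp

/-- A constraint with value 1 at some `s` and 0 at its complement prefers (0,1) to (1,0). Doubling
`h` keeps the diagonal below the maximum. -/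
theorem HasXor.hasConstants (h : HasXor Γ) (hc : ¬ ComplementClosed Γ) : HasConstants Γ := by
  obtain ⟨h, ξ, hi, hξ⟩ := h
  have : ∃ f ∈ Γ, ∃ x, f.toFun x = true ∧ f.toFun (fun i => !x i) = false := by
    simp only [ComplementClosed, not_forall] at hc
    obtain ⟨f, hf, x, hx⟩ := hc
    cases h₁ : f.toFun x with
    | true => exact ⟨f, hf, x, h₁, by simpa [h₁] using hx⟩
    | false => exact ⟨f, hf, fun i => !x i, by simpa [h₁] using hx, by simpa using h₁⟩
  obtain ⟨f, hf, s, h₁, h₂⟩ := this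
  refine ⟨fun a b => 2 * h a b + (f.toFun fun i => if s i = true then b else a).toNat, 2 * ξ + 1,
    fun i j => ((hi i j).smul 2).add (implements₂_of_mem hf s i j), ?_⟩
  intro a b
  dsimp only
  have h₃ := hξ a b
  have h₄ := Bool.toNat_le (f.toFun fun i => if s i = true then b else a)
  refine ⟨by omega, ?_⟩
  by_cases hab : a = b
  · have h₅ : h a b ≠ ξ := fun e => h₃.2.1 e hab
    constructor
    · intro h₆; have := lt_of_le_of_ne h₃.1 h₅; omega
    · rintro ⟨rfl, rfl⟩; simp at hab
  · rw [h₃.2.2 hab]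
    have e₁ : (fun i => if s i = true then true else false) = s := by funext i; cases s i <;> rfl
    have e₂ : (fun i => if s i = true then false else true) = fun i => !s i := by
      funext i; cases s i <;> rfl
    cases a <;> cases b <;> simp at hab
    · simp [h₁]
    · rw [e₂]; simp [h₂]

/-! ### Constraints that are not 2-monotone -/

namespace Constraint

/-- Every assignment that is 1 on `O` satisfies `f`. -/
def OneForced (f : Constraint) (O : Finset (Fin f.arity)) : Prop :=
  ∀ t, (∀ i ∈ O, t i = true) → f.toFun t = true

def ZeroForced (f : Constraint) (Z : Finset (Fin f.arity)) : Prop :=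
  ∀ t, (∀ i ∈ Z, t i = false) → f.toFun t = true

/-- A predicate on finite sets that is closed under intersections has a least element. -/
theorem exists_least {k : ℕ} {p : Finset (Fin k) → Prop} {O : Finset (Fin k)} (h : p O)
    (hp : ∀ O₁ O₂, p O₁ → p O₂ → p (O₁ ∩ O₂)) : ∃ P, p P ∧ ∀ O, p O → P ⊆ O := by
  induction hn : O.card using Nat.strong_induction_on generalizing O with
  | _ n ih =>
    by_cases h₁ : ∀ O', p O' → O ⊆ O'
    · exact ⟨O, h, h₁⟩
    · push Not at h₁
      obtain ⟨O', h₂, h₃⟩ := h₁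
      refine ih (O ∩ O').card ?_ (hp O O' h h₂) rfl
      rw [← hn]
      refine Finset.card_lt_card ⟨Finset.inter_subset_left, fun h₄ => h₃ ?_⟩
      exact h₄.trans Finset.inter_subset_right

/-- By `hb` and `hc` there are least forced sets `P` and `Q`; they are the two terms of the DNF, and
by `ha` these cover all satisfying assignments. A forced set is nonempty, as otherwise `f` would be
constantly 1; the empty set marks an absent term. -/
theorem isTwoMonotone_of_forced {f : Constraint} (hn : ¬ f.IsTrivial)
    (ha : ∀ s, f.toFun s = true → f.OneForced {i | s i = true} ∨ f.ZeroForced {i | s i = false})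
    (hb : ∀ O₁ O₂, f.OneForced O₁ → f.OneForced O₂ → f.OneForced (O₁ ∩ O₂))
    (hc : ∀ O₁ O₂, f.ZeroForced O₁ → f.ZeroForced O₂ → f.ZeroForced (O₁ ∩ O₂)) :
    f.IsTwoMonotone := by
  have hP : ∃ P : Finset (Fin f.arity), (P.Nonempty → f.OneForced P) ∧
      ∀ O, f.OneForced O → P.Nonempty ∧ P ⊆ O := by
    by_cases h : ∃ O, f.OneForced O
    · obtain ⟨O, h⟩ := h
      obtain ⟨P, h₁, h₂⟩ := exists_least h hb
      refine ⟨P, fun _ => h₁, fun O h₃ => ⟨?_, h₂ O h₃⟩⟩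
      rw [Finset.nonempty_iff_ne_empty]
      rintro rfl
      exact hn (.inr fun x => h₁ x (by simp))
    · push Not at h
      exact ⟨∅, by simp, fun O h₁ => (h O h₁).elim⟩
  have hQ : ∃ P : Finset (Fin f.arity), (P.Nonempty → f.ZeroForced P) ∧
      ∀ O, f.ZeroForced O → P.Nonempty ∧ P ⊆ O := by
    by_cases h : ∃ O, f.ZeroForced O
    · obtain ⟨O, h⟩ := h
      obtain ⟨P, h₁, h₂⟩ := exists_least h hc
      refine ⟨P, fun _ => h₁, fun O h₃ => ⟨?_, h₂ O h₃⟩⟩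
      rw [Finset.nonempty_iff_ne_empty]
      rintro rfl
      exact hn (.inr fun x => h₁ x (by simp))
    · push Not at h
      exact ⟨∅, by simp, fun O h₁ => (h O h₁).elim⟩
  obtain ⟨P, hP₁, hP₂⟩ := hP
  obtain ⟨Q, hQ₁, hQ₂⟩ := hQ
  have key : ∀ x, f.toFun x = true ↔
      (P.Nonempty ∧ ∀ i ∈ P, x i = true) ∨ (Q.Nonempty ∧ ∀ j ∈ Q, x j = false) := by
    intro x
    constructor
    · intro hx
      rcases ha x hx with h | h
      · obtain ⟨h₁, h₂⟩ := hP₂ _ h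
        exact .inl ⟨h₁, fun i hi => by simpa using h₂ hi⟩
      · obtain ⟨h₁, h₂⟩ := hQ₂ _ h
        exact .inr ⟨h₁, fun i hi => by simpa using h₂ hi⟩
    · rintro (⟨h₁, h₂⟩ | ⟨h₁, h₂⟩)
      · exact hP₁ h₁ x h₂
      · exact hQ₁ h₁ x h₂
  refine ⟨P, Q, ?_, key⟩
  by_contra h
  push Not at h
  refine hn (.inl fun x => ?_)
  rw [← Bool.not_eq_true, key x]
  simp [h.1, h.2]

end Constraint

/-- The constraint with four arguments put into the places given by `e`. -/
def Constraint.plug (f : Constraint) (e : Fin f.arity → Fin 4) (a b c d : Bool) : Bool :=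
  f.toFun fun l => (![a, b, c, d] : Fin 4 → Bool) (e l)

/-- The values of a constraint when the remaining two arguments are the constants 0 and 1. -/
theorem exists_xor_part (hm : ¬ Γ.IsTwoMonotone) : ∃ k : Bool → Bool → Bool → Bool → Bool,
    (∀ i j i' j' : Fin 4, Implements Γ fun y : Fin 4 → Bool =>
      (k (y i) (y j) (y i') (y j')).toNat) ∧
    ((k false true false true = true ∧ k false false false true = false ∧
        k true true false true = false) ∨
      (k false true false true = true ∧ k true false false true = true ∧
        k true true false true = true ∧ k false false false true = false) ∨
      (k false true false true = true ∧ k true false false true = true ∧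
        k false false false true = true ∧ k true true false true = false)) := by
  simp only [ConstraintLanguage.IsTwoMonotone, not_forall] at hm
  obtain ⟨f, hf, hn, hm⟩ := hm
  have hk : ∀ e : Fin f.arity → Fin 4, ∀ i j i' j' : Fin 4,
      Implements Γ fun y : Fin 4 → Bool => (f.plug e (y i) (y j) (y i') (y j')).toNat := by
    intro e i j i' j'
    convert Implements.single hf (fun l => (![i, j, i', j'] : Fin 4 → Fin 4) (e l)) using 3 with y
    refine congrArg f.toFun (funext fun l => ?_)
    generalize e l = m
    fin_cases m <;> rfl
  by_cases ha : ∀ s, f.toFun s = true →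
      f.OneForced {i | s i = true} ∨ f.ZeroForced {i | s i = false}
  · by_cases hb : ∀ O₁ O₂, f.OneForced O₁ → f.OneForced O₂ → f.OneForced (O₁ ∩ O₂)
    · by_cases hc : ∀ O₁ O₂, f.ZeroForced O₁ → f.ZeroForced O₂ → f.ZeroForced (O₁ ∩ O₂)
      · exact (hm (Constraint.isTwoMonotone_of_forced hn ha hb hc)).elim
      · push Not at hc
        obtain ⟨O₁, O₂, h₁, h₂, h₃⟩ := hc
        simp only [Constraint.ZeroForced, not_forall] at h₃
        obtain ⟨t, ht, h₃⟩ := h₃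
        -- Places 2 and 3 hold the constants 0 and 1. Here `t` falsifies `f` and is 0 on the
        -- intersection of `O₁` and `O₂`. Its ones become the first variable on `O₁` and the second
        -- on `O₂`, which gives NAND.
        refine ⟨f.plug _, hk fun l => if t l = false then 2 else if l ∈ O₁ then 0
          else if l ∈ O₂ then 1 else 3, .inr (.inr ⟨h₁ _ ?_, h₂ _ ?_, h₁ _ ?_, ?_⟩)⟩
        · intro l hl; by_cases h : t l = false <;> simp [h, hl]
        · intro l hl
          by_cases h : t l = false
          · simp [h]
          · have : l ∉ O₁ := fun h' => h (ht l (Finset.mem_inter.2 ⟨h', hl⟩))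
            simp [h, hl, this]
        · intro l hl; by_cases h : t l = false <;> simp [h, hl]
        · rw [Bool.not_eq_true] at h₃
          refine (congrArg f.toFun (funext fun l => ?_)).trans h₃
          dsimp only
          by_cases h : t l = false
          · simp [h]
          · rw [Bool.not_eq_false] at h
            by_cases h' : l ∈ O₁ <;> by_cases h'' : l ∈ O₂ <;> simp [h, h', h'']
    · push Not at hb
      obtain ⟨O₁, O₂, h₁, h₂, h₃⟩ := hb
      simp only [Constraint.OneForced, not_forall] at h₃
      obtain ⟨t, ht, h₃⟩ := h₃
      -- Dually, the zeros of the falsifying `t` become variables, which gives OR.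
      refine ⟨f.plug _, hk fun l => if t l = true then 3 else if l ∈ O₁ then 0
        else if l ∈ O₂ then 1 else 2, .inr (.inl ⟨h₂ _ ?_, h₁ _ ?_, h₁ _ ?_, ?_⟩)⟩
      · intro l hl
        by_cases h : t l = true
        · simp [h]
        · have : l ∉ O₁ := fun h' => h (ht l (Finset.mem_inter.2 ⟨h', hl⟩))
          simp [h, hl, this]
      · intro l hl; by_cases h : t l = true <;> simp [h, hl]
      · intro l hl; by_cases h : t l = true <;> simp [h, hl]
      · rw [Bool.not_eq_true] at h₃
        refine (congrArg f.toFun (funext fun l => ?_)).trans h₃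
        dsimp only
        by_cases h : t l = true
        · simp [h]
        · rw [Bool.not_eq_true] at h
          by_cases h' : l ∈ O₁ <;> by_cases h'' : l ∈ O₂ <;> simp [h, h', h'']
  · push Not at ha
    obtain ⟨s, hs, h₁, h₂⟩ := ha
    simp only [Constraint.OneForced, Constraint.ZeroForced, not_forall] at h₁ h₂
    obtain ⟨t₁, ht₁, h₁⟩ := h₁
    obtain ⟨t₀, ht₀, h₂⟩ := h₂
    simp only [Finset.mem_filter, Finset.mem_univ, true_and] at ht₀ ht₁
    rw [Bool.not_eq_true] at h₁ h₂
    -- Here `t₀ ≤ s ≤ t₁` pointwise, and of the three only `s` satisfies `f`. The first variable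
    -- changes `s` into `t₁`, the second one changes `s` into `t₀`.
    refine ⟨f.plug _, hk fun l => if s l = true then (if t₀ l = true then 3 else 1)
      else (if t₁ l = true then 0 else 2), .inl ⟨?_, ?_, ?_⟩⟩
    · refine (congrArg f.toFun (funext fun l => ?_)).trans hs
      dsimp only
      cases s l <;> cases t₀ l <;> cases t₁ l <;> rfl
    · refine (congrArg f.toFun (funext fun l => ?_)).trans h₂
      dsimp only
      have := ht₀ l
      cases hs : s l <;> cases h : t₀ l <;> cases t₁ l <;> simp_all
    · refine (congrArg f.toFun (funext fun l => ?_)).trans h₁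
      dsimp only
      have := ht₁ l
      cases hs : s l <;> cases t₀ l <;> cases h : t₁ l <;> simp_all

/-- A sum of constraint applications to `x, x', z₀, z₁` that is maximal if and only if `x'` is the
negation of `x`, and `z₀, z₁` are the two constants (up to exchanging 0 and 1 if this is a
symmetry of the language). -/
theorem exists_negation_gadget (h₀ : ¬ Γ.IsZeroValid) (h₁ : ¬ Γ.IsOneValid)
    (hm : ¬ Γ.IsTwoMonotone) :
    ∃ (D : List (Template Γ (Fin 4))) (β : ℕ), (∀ y, satCount D y ≤ β) ∧
      ((∀ y, satCount D y = β ↔ (y 2 = false ∧ y 3 = true) ∧ y 0 ≠ y 1) ∨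
        (ComplementClosed Γ ∧ ∀ y, satCount D y = β ↔ y 2 ≠ y 3 ∧ y 0 ≠ y 1)) := by
  obtain ⟨a, ha, a₀, a₁⟩ := exists_or_like h₀
  obtain ⟨b, hb, b₀, b₁⟩ := exists_nand_like h₁
  have hx := hasXor_or_hasConstants ha hb a₀ a₁ b₀ b₁
  by_cases hx' : HasXor Γ ∧ ComplementClosed Γ
  · obtain ⟨⟨h, ξ, hi, hξ⟩, hcc⟩ := hx'
    -- Under complement symmetry the constants can only be forced to differ, and this suffices.
    obtain ⟨H, β, ⟨D, hD⟩, hH⟩ := Implements.combine (hi 2 3) (hi 0 1) (fun y => hξ (y 2) (y 3))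
      (fun y _ => hξ (y 0) (y 1))
    refine ⟨D, β, fun y => hD y ▸ (hH y).1, .inr ⟨hcc, fun y => ?_⟩⟩
    rw [hD]
    exact (hH y).2
  have hc : HasConstants Γ := by
    rcases hx with hx | hx
    · exact hx.hasConstants fun h => hx' ⟨hx, h⟩
    · exact hx
  obtain ⟨c, α, hci, hα⟩ := hc
  suffices ∃ (D : (Fin 4 → Bool) → ℕ) (δ : ℕ), Implements Γ D ∧
      ∀ y, (y 2 = false ∧ y 3 = true) → D y ≤ δ ∧ (D y = δ ↔ y 0 ≠ y 1) by
    obtain ⟨D, δ, hDi, hδ⟩ := this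
    obtain ⟨H, β, ⟨D, hD⟩, hH⟩ := Implements.combine (hci 2 3) hDi (fun y => hα (y 2) (y 3)) hδ
    refine ⟨D, β, fun y => hD y ▸ (hH y).1, .inl fun y => ?_⟩
    rw [hD]
    exact (hH y).2
  obtain ⟨k, hk, hk'⟩ := exists_xor_part hm
  rcases hk' with ⟨k₁, k₂, k₃⟩ | ⟨k₁, k₂, k₃, k₄⟩ | ⟨k₁, k₂, k₃, k₄⟩
  -- Symmetrising `k` leaves 0 on the diagonal and the same positive value off it.
  · refine ⟨_, 1 + (k true false false true).toNat, (hk 0 1 2 3).add (hk 1 0 2 3), ?_⟩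
    rintro y ⟨y₂, y₃⟩
    simp only [y₂, y₃]
    cases y 0 <;> cases y 1 <;> simp [k₁, k₂, k₃, Nat.add_comm]
  -- `k` is OR, and `b` with second argument 1 rewards a zero. Equal pairs get 2, unequal ones 3;
  -- the last case is dual.
  · refine ⟨_, 3, ((hk 0 1 2 3).smul 2).add ((hb 0 3).add (hb 1 3)), ?_⟩
    rintro y ⟨y₂, y₃⟩
    simp only [y₂, y₃]
    cases y 0 <;> cases y 1 <;> simp [k₁, k₂, k₃, k₄, b₀, b₁]
  · refine ⟨_, 3, ((hk 0 1 2 3).smul 2).add ((ha 2 0).add (ha 2 1)), ?_⟩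
    rintro y ⟨y₂, y₃⟩
    simp only [y₂, y₃]
    cases y 0 <;> cases y 1 <;> simp [k₁, k₂, k₃, k₄, a₀, a₁]

end Implements


/-! ### The characteristic polynomial -/

namespace Constraint

/-- The indicator assignment of a set. -/
def ind {k : ℕ} (S : Finset (Fin k)) (i : Fin k) : Bool := decide (i ∈ S)

/-- The coefficient of `∏_{i ∈ T} x_i` in the characteristic polynomial. -/
def coef (f : Constraint) (T : Finset (Fin f.arity)) : ℤ :=
  ∑ S ∈ T.powerset, (-1) ^ (T \ S).card * ((f.toFun (ind S)).toNat : ℤ)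

/-- Every factor is affine in `z i`, and at places in `S` its constant term is 0, so only the sets
`T` that contain `S` survive the expansion. -/
theorem prod_literals {R : Type*} [CommRing R] {k : ℕ} (S : Finset (Fin k)) (z : Fin k → R) :
    ∏ i, (if ind S i = true then z i else 1 - z i) =
      ∑ T : Finset (Fin k), if S ⊆ T then (-1) ^ (T \ S).card * ∏ i ∈ T, z i else 0 := by
  have e : ∀ i, (if ind S i = true then z i else 1 - z i) =
      (if i ∈ S then 1 else -1) * z i + (if i ∈ S then 0 else 1) := by
    intro i
    by_cases h : i ∈ S <;> simp [ind, h]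
    ring
  simp only [e]
  rw [Finset.prod_add]
  simp only [Finset.powerset_univ]
  refine Finset.sum_congr rfl fun T _ => ?_
  have h₁ : ∏ i ∈ Finset.univ \ T, (if i ∈ S then (0 : R) else 1) = if S ⊆ T then 1 else 0 := by
    split_ifs with h
    · refine Finset.prod_eq_one fun i hi => ?_
      rw [if_neg fun h' => (Finset.mem_sdiff.1 hi).2 (h h')]
    · obtain ⟨i, h₁, h₂⟩ := Finset.not_subset.1 h
      exact Finset.prod_eq_zero (i := i) (by simp [h₂]) (by simp [h₁])
  rw [h₁, Finset.prod_mul_distrib]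
  split_ifs with h
  · rw [mul_one, Finset.prod_ite, Finset.prod_const_one, one_mul, Finset.prod_const,
      Finset.sdiff_eq_filter]
  · rw [mul_zero]

/-- The ring is arbitrary so that this serves both for the polynomial itself and for its evaluation
at 0 and 1. -/
theorem sum_prod_literals {R : Type*} [CommRing R] (f : Constraint) (z : Fin f.arity → R) :
    (∑ s : Fin f.arity → Bool with f.toFun s = true, ∏ i, if s i = true then z i else 1 - z i) =
      ∑ T : Finset (Fin f.arity), (f.coef T : R) * ∏ i ∈ T, z i := by
  have e₁ : (∑ s : Fin f.arity → Bool with f.toFun s = true,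
      ∏ i, if s i = true then z i else 1 - z i) =
      ∑ S : Finset (Fin f.arity), ((f.toFun (ind S)).toNat : R) *
        ∏ i, if ind S i = true then z i else 1 - z i := by
    rw [Finset.sum_filter]
    refine Finset.sum_bij' (fun s _ => ({i | s i = true} : Finset (Fin f.arity)))
      (fun S _ => ind S) (by simp) (by simp) (fun s _ => by funext i; simp [ind])
      (fun S _ => by ext i; simp [ind]) (fun s _ => ?_)
    have e : ind ({i | s i = true} : Finset (Fin f.arity)) = s := by funext i; simp [ind]
    rw [e]
    cases f.toFun s <;> simp
  rw [e₁]
  simp only [prod_literals, Finset.mul_sum]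
  rw [Finset.sum_comm]
  refine Finset.sum_congr rfl fun T _ => ?_
  rw [coef, Int.cast_sum, Finset.sum_mul, ← Finset.sum_filter_add_sum_filter_not Finset.univ
    (fun S => S ⊆ T), Finset.sum_eq_zero (s := Finset.univ.filter fun S => ¬ S ⊆ T), add_zero]
  · refine Finset.sum_congr (by ext S; simp) fun S hS => ?_
    rw [Finset.mem_powerset] at hS
    rw [if_pos hS]
    push_cast
    ring
  · intro S hS
    rw [if_neg (Finset.mem_filter.1 hS).2, mul_zero]

theorem value_eq_sum_coef (f : Constraint) (x : Fin f.arity → Bool) :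
    ((f.toFun x).toNat : ℤ) =
      ∑ T : Finset (Fin f.arity), f.coef T * if ∀ i ∈ T, x i = true then 1 else 0 := by
  have h := sum_prod_literals f (fun i => ((x i).toNat : ℤ))
  have e₁ : ∀ T : Finset (Fin f.arity), ∏ i ∈ T, ((x i).toNat : ℤ) =
      if ∀ i ∈ T, x i = true then 1 else 0 := by
    intro T
    split_ifs with hT
    · exact Finset.prod_eq_one fun i hi => by simp [hT i hi]
    · push Not at hT
      obtain ⟨i, h₁, h₂⟩ := hT
      exact Finset.prod_eq_zero h₁ (by simpa using h₂)
  have e₂ : ∀ s : Fin f.arity → Bool,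
      (∏ i, if s i = true then ((x i).toNat : ℤ) else 1 - ((x i).toNat : ℤ)) =
        if s = x then 1 else 0 := by
    intro s
    split_ifs with hs
    · subst hs
      exact Finset.prod_eq_one fun i _ => by cases s i <;> simp
    · obtain ⟨i, hi⟩ := Function.ne_iff.1 hs
      refine Finset.prod_eq_zero (Finset.mem_univ i) ?_
      cases hs : s i <;> cases hx : x i <;> simp_all
  simp only [e₁, e₂, Int.cast_id] at h
  rw [← h, Finset.sum_filter, Finset.sum_eq_single x]
  · cases f.toFun x <;> simp
  · intro s _ hs
    simp [hs]
  · simp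

open MvPolynomial in
theorem charPoly_eq_sum (f : Constraint) :
    f.charPoly = ∑ T : Finset (Fin f.arity),
      monomial (Finsupp.indicator T fun _ _ => 1) (f.coef T : ℝ) := by
  rw [charPoly, sum_prod_literals]
  refine Finset.sum_congr rfl fun T _ => ?_
  have : ∏ i ∈ T, (X i : MvPolynomial (Fin f.arity) ℝ) =
      monomial (Finsupp.indicator T fun _ _ => 1) 1 := by
    rw [monomial_eq, Finsupp.prod, C_1, one_mul]
    refine (Finset.prod_subset_one_on_sdiff (Finsupp.support_indicator_subset T _) ?_ ?_).symm
    · intro i hi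
      simp at hi
    · intro i hi
      have : i ∈ T := Finsupp.support_indicator_subset T _ hi
      simp [this]
  rw [this, show ((f.coef T : ℤ) : MvPolynomial (Fin f.arity) ℝ) = C (f.coef T : ℝ) by simp,
    C_mul_monomial, mul_one]

theorem indicator_injective {k : ℕ} {T T' : Finset (Fin k)}
    (h : Finsupp.indicator T (fun _ _ => 1) = Finsupp.indicator T' fun _ _ => (1 : ℕ)) : T = T' := by
  ext i
  have := DFunLike.congr_fun h i
  simp only [Finsupp.indicator_apply] at this
  by_cases h₁ : i ∈ T <;> by_cases h₂ : i ∈ T' <;> simp_all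

theorem indicator_degree {k : ℕ} (T : Finset (Fin k)) :
    ((Finsupp.indicator T fun _ _ => (1 : ℕ)).sum fun _ e => e) = T.card := by
  rw [Finsupp.sum_of_support_subset _ (Finsupp.support_indicator_subset T _) _ (by simp),
    Finset.card_eq_sum_ones]
  exact Finset.sum_congr rfl fun i hi => by simp [hi]

/-- Distinct sets give distinct monomials, so nothing cancels. -/
theorem card_le_deg {f : Constraint} {T : Finset (Fin f.arity)} (h : f.coef T ≠ 0) :
    T.card ≤ f.deg := by
  rw [deg, ← indicator_degree T]
  refine MvPolynomial.le_totalDegree ?_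
  rw [MvPolynomial.mem_support_iff, charPoly_eq_sum, MvPolynomial.coeff_sum,
    Finset.sum_eq_single T]
  · simpa using h
  · intro T' _ hT
    rw [MvPolynomial.coeff_monomial, if_neg fun e => hT (indicator_injective e)]
  · simp

theorem exists_deg_le_card {f : Constraint} (h : 0 < f.deg) :
    ∃ T, f.coef T ≠ 0 ∧ f.deg ≤ T.card := by
  by_contra! hT
  have : f.deg ≤ f.deg - 1 := by
    conv_lhs => rw [deg, charPoly_eq_sum]
    refine MvPolynomial.totalDegree_finsetSum_le fun T _ => ?_
    by_cases h₀ : f.coef T = 0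
    · simp [h₀]
    · refine (MvPolynomial.totalDegree_monomial_le _ _).trans ?_
      have e : (Finsupp.indicator T fun _ _ => (1 : ℕ)).sum (fun _ => id) = T.card :=
        indicator_degree T
      rw [e]
      have := hT T h₀
      omega
  omega

/-- In degree 0 only the empty set has a nonzero coefficient, which makes `f` constant. -/
theorem deg_pos {f : Constraint} (h : ¬ f.IsTrivial) : 0 < f.deg := by
  by_contra h₀
  have hc : ∀ T, T ≠ ∅ → f.coef T = 0 := by
    intro T hT
    by_contra h₁
    have := card_le_deg h₁
    have := Finset.card_pos.2 (Finset.nonempty_iff_ne_empty.2 hT)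
    omega
  have hv : ∀ x, ((f.toFun x).toNat : ℤ) = f.coef ∅ := by
    intro x
    rw [value_eq_sum_coef, Finset.sum_eq_single ∅ (fun T _ hT => by rw [hc T hT, zero_mul])
      (by simp)]
    simp
  refine h ?_
  have hx := hv fun _ => false
  cases hf : f.toFun fun _ => false with
  | false =>
    refine .inl fun x => ?_
    have := (hv x).trans hx.symm
    rw [hf] at this
    simpa using this
  | true =>
    refine .inr fun x => ?_
    have := (hv x).trans hx.symm
    rw [hf] at this
    simpa using this

/-- The coefficient of a monomial, as an alternating sum over the subcubes of an assignment. -/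
theorem sum_restrict (f : Constraint) (T : Finset (Fin f.arity)) (y : Fin f.arity → Bool) :
    ∑ S ∈ T.powerset, (-1) ^ (T \ S).card *
      ((f.toFun fun i => if i ∈ S then y i else false).toNat : ℤ) =
        f.coef T * if ∀ i ∈ T, y i = true then 1 else 0 := by
  split_ifs with h
  · rw [mul_one, coef]
    refine Finset.sum_congr rfl fun S hS => ?_
    have e : (fun i => if i ∈ S then y i else false) = ind S := by
      funext i
      by_cases hi : i ∈ S
      · simp [ind, hi, h i (Finset.mem_powerset.1 hS hi)]
      · simp [ind, hi]
    rw [e]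
  · push Not at h
    obtain ⟨i, hi, hy⟩ := h
    -- If `y i = 0` for some `i` in `T`, adding `i` to `S` changes the sign of the term but not the
    -- value of `f`.
    rw [mul_zero]
    obtain ⟨T', hT', rfl⟩ : ∃ T', i ∉ T' ∧ insert i T' = T :=
      ⟨T.erase i, by simp, Finset.insert_erase hi⟩
    rw [Finset.sum_powerset_insert hT', ← Finset.sum_add_distrib]
    refine Finset.sum_eq_zero fun S hS => ?_
    rw [Finset.mem_powerset] at hS
    have hiS : i ∉ S := fun h => hT' (hS h)
    have e₁ : (insert i T' \ S).card = (T' \ S).card + 1 := by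
      rw [Finset.insert_sdiff_of_notMem _ hiS, Finset.card_insert_of_notMem (by simp [hT'])]
    have e₂ : insert i T' \ insert i S = T' \ S := by
      ext j
      by_cases hj : j = i <;> simp [hj, hT']
    have e₃ : (fun j => if j ∈ insert i S then y j else false) =
        fun j => if j ∈ S then y j else false := by
      funext j
      by_cases hj : j = i
      · subst hj; simpa [hiS] using hy
      · simp [hj]
    rw [e₁, e₂, e₃, pow_succ]
    ring

end Constraint

/-! ### Expressing constraints of small degree -/

/-- Literals over `k` variables, and the constants. The literal `inl (j, b)` is `x_j ⊕ b`. -/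
abbrev Lit (k : ℕ) : Type := (Fin k × Bool) ⊕ Bool

def litVal {k : ℕ} (x : Fin k → Bool) : Lit k → Bool
  | .inl (j, b) => xor (x j) b
  | .inr b => b

def litFlip {k : ℕ} (b : Bool) : Lit k → Lit k
  | .inl (j, c) => .inl (j, xor c b)
  | .inr c => .inr (xor c b)

theorem litVal_litFlip {k : ℕ} (x : Fin k → Bool) (b : Bool) (l : Lit k) :
    litVal x (litFlip b l) = xor (litVal x l) b := by
  rcases l with ⟨j, c⟩ | c <;> simp [litVal, litFlip]

variable {Γ : ConstraintLanguage} {k : ℕ}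

/-- Up to a constant summand, `h` counts the satisfied templates of a list. -/
def Expresses (Γ : ConstraintLanguage) (h : (Fin k → Bool) → ℤ) : Prop :=
  ∃ (E : List (Template Γ (Lit k))) (κ : ℕ), ∀ x, (satCount E (litVal x) : ℤ) = h x + κ

namespace Expresses

theorem zero : Expresses Γ (fun _ : Fin k → Bool => 0) := ⟨[], 0, fun _ => rfl⟩

theorem add {h h' : (Fin k → Bool) → ℤ} (H : Expresses Γ h) (H' : Expresses Γ h') :
    Expresses Γ fun x => h x + h' x :=
  let ⟨E, κ, hE⟩ := H
  let ⟨E', κ', hE'⟩ := H'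
  ⟨E ++ E', κ + κ', fun x => by rw [satCount_append]; push_cast; rw [hE, hE']; ring⟩

theorem sum {ι : Type} (s : Finset ι) {h : ι → (Fin k → Bool) → ℤ}
    (H : ∀ i, Expresses Γ (h i)) : Expresses Γ fun x => ∑ i ∈ s, h i x := by
  classical
  induction s using Finset.induction_on with
  | empty => simpa using zero
  | insert i s hi ih =>
    simp only [Finset.sum_insert hi]
    exact (H i).add ih

theorem nsmul (n : ℕ) {h : (Fin k → Bool) → ℤ} (H : Expresses Γ h) :
    Expresses Γ fun x => n * h x := by
  induction n with
  | zero => simpa using zero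
  | succ n ih =>
    convert ih.add H using 2 with x
    push_cast
    ring

theorem single {g : Constraint} (hg : g ∈ Γ) (r : Fin g.arity → Lit k) :
    Expresses Γ fun x => ((g.toFun fun i => litVal x (r i)).toNat : ℤ) :=
  ⟨[⟨⟨g, hg⟩, r⟩], 0, fun x => by simp [satCount, Template.sat]⟩

/-- Summing `g` over all flips of its arguments counts its satisfying assignments, whatever `x` is.
Without the trivial flip, this constant minus `g` remains. -/
theorem neg_single {g : Constraint} (hg : g ∈ Γ) (r : Fin g.arity → Lit k) :
    Expresses Γ fun x => -((g.toFun fun i => litVal x (r i)).toNat : ℤ) := by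
  obtain ⟨E, κ, hE⟩ := Expresses.sum (Γ := Γ) (k := k)
    (Finset.univ.erase (fun _ : Fin g.arity => false))
    (fun s => single hg fun i => litFlip (s i) (r i))
  refine ⟨E, κ + ∑ s : Fin g.arity → Bool, (g.toFun s).toNat, fun x => ?_⟩
  have e : ∑ s : Fin g.arity → Bool, ((g.toFun fun i => litVal x (litFlip (s i) (r i))).toNat : ℤ) =
      ∑ s : Fin g.arity → Bool, ((g.toFun s).toNat : ℤ) := by
    simp only [litVal_litFlip]
    refine Fintype.sum_bijective (fun s i => xor (litVal x (r i)) (s i))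
      (Function.Involutive.bijective fun s => ?_) _ _ fun s => rfl
    funext i
    simp
  have e' := Finset.add_sum_erase Finset.univ
    (fun s : Fin g.arity → Bool => ((g.toFun fun i => litVal x (litFlip (s i) (r i))).toNat : ℤ))
    (Finset.mem_univ fun _ => false)
  rw [e] at e'
  rw [hE]
  simp only [litVal_litFlip, Bool.xor_false] at e' ⊢
  push_cast
  linarith

theorem zsmul_single (m : ℤ) {g : Constraint} (hg : g ∈ Γ) (r : Fin g.arity → Lit k) :
    Expresses Γ fun x => m * ((g.toFun fun i => litVal x (r i)).toNat : ℤ) := by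
  obtain ⟨n, rfl | rfl⟩ := m.eq_nat_or_neg
  · exact (single hg r).nsmul n
  · convert (neg_single hg r).nsmul n using 2
    ring

/-- Multiples of a monomial whose degree is at most that of a monomial of `g`. -/
theorem monomial {g : Constraint} (hg : g ∈ Γ) {T₀ : Finset (Fin g.arity)} (T : Finset (Fin k))
    (hT : T.card ≤ T₀.card) (m : ℤ) :
    Expresses Γ fun x => m * (g.coef T₀ * if ∀ i ∈ T, x i = true then 1 else 0) := by
  classical
  obtain ⟨e, he, he'⟩ : ∃ e : T → T₀, Function.Injective e ∧ True := by
    obtain ⟨e⟩ := Function.Embedding.nonempty_of_card_le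
      (by simpa using hT : Fintype.card T ≤ Fintype.card T₀)
    exact ⟨e, e.injective, trivial⟩
  -- Surplus places of `T₀` receive the constant 1. The choice outside `T₀` has no effect, since the
  -- sum below puts 0 there.
  let ρ : Fin g.arity → Lit k := fun i =>
    if h : ∃ j : T, (e j : Fin g.arity) = i then .inl (h.choose, false) else .inr true
  have hρ : ∀ x : Fin k → Bool, (∀ i ∈ T₀, litVal x (ρ i) = true) ↔ ∀ i ∈ T, x i = true := by
    intro x
    constructor
    · intro h j hj
      have h₁ := h (e ⟨j, hj⟩) (e ⟨j, hj⟩).2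
      have h₂ : ∃ j' : T, (e j' : Fin g.arity) = e ⟨j, hj⟩ := ⟨⟨j, hj⟩, rfl⟩
      simp only [ρ] at h₁
      rw [dif_pos h₂, he (Subtype.ext h₂.choose_spec)] at h₁
      simpa [litVal] using h₁
    · intro h i _
      by_cases h₂ : ∃ j : T, (e j : Fin g.arity) = i
      · simp only [ρ]
        rw [dif_pos h₂]
        simpa [litVal] using h _ h₂.choose.2
      · simp only [ρ]
        rw [dif_neg h₂]
        rfl
  have key := Expresses.sum (Γ := Γ) T₀.powerset fun S =>
    zsmul_single (m * (-1) ^ (T₀ \ S).card) hg fun i => if i ∈ S then ρ i else .inr false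
  convert key using 2 with x
  have e₁ := g.sum_restrict T₀ fun i => litVal x (ρ i)
  simp only [hρ x] at e₁
  rw [← e₁, Finset.mul_sum]
  refine Finset.sum_congr rfl fun S _ => ?_
  have e₂ : (fun i => litVal x (if i ∈ S then ρ i else .inr false)) =
      fun i => if i ∈ S then litVal x (ρ i) else false := by
    funext i
    split_ifs <;> rfl
  rw [e₂, mul_assoc]

end Expresses

/-- All constraints whose degree is at most that of `Γ` are, up to a common factor and constant
summands, sums of constraint applications of `Γ` to literals and constants. -/
theorem exists_factor (h : Γ.IsNontrivial) : ∃ c : ℕ, 0 < c ∧ ∀ f : Constraint, f.deg ≤ Γ.deg →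
    ∀ neg : Bool, Expresses Γ fun x : Fin f.arity → Bool =>
      (if neg = true then -1 else 1) * (c * ((f.toFun x).toNat : ℤ)) := by
  obtain ⟨f₀, hf₀, hn⟩ := h
  obtain ⟨g, hg, hd⟩ := Finset.exists_mem_eq_sup Γ ⟨f₀, hf₀⟩ Constraint.deg
  have hpos : 0 < g.deg :=
    (Constraint.deg_pos hn).trans_le (hd ▸ Finset.le_sup (f := Constraint.deg) hf₀)
  obtain ⟨T₀, h₀, h₁⟩ := Constraint.exists_deg_le_card hpos
  -- The common factor is the absolute value of the top coefficient; its sign goes into the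
  -- multiplier of each monomial.
  refine ⟨(g.coef T₀).natAbs, Int.natAbs_pos.2 h₀, fun f hf neg => ?_⟩
  have key := Expresses.sum (Γ := Γ) (k := f.arity) Finset.univ
    (fun T : Finset (Fin f.arity) => show Expresses Γ fun x =>
      ((if neg = true then -1 else 1) * (g.coef T₀).sign * f.coef T) *
        (g.coef T₀ * if ∀ i ∈ T, x i = true then 1 else 0) by
      by_cases hT : f.coef T = 0
      · simpa [hT] using Expresses.zero (Γ := Γ) (k := f.arity)
      · exact .monomial hg T ((Constraint.card_le_deg hT).trans (hf.trans
          ((hd : Γ.deg = _).le.trans h₁))) _)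
  convert key using 2 with x
  rw [Constraint.value_eq_sum_coef, Finset.mul_sum, Finset.mul_sum]
  refine Finset.sum_congr rfl fun T _ => ?_
  rw [Int.natCast_natAbs, ← Int.sign_mul_self_eq_abs]
  ring


/-! ### The transformation on data -/

noncomputable instance (Γ : ConstraintLanguage) : DecidableEq {f : Constraint // f ∈ Γ} :=
  Classical.decEq _

noncomputable instance (Γ : ConstraintLanguage) : Coded {f : Constraint // f ∈ Γ} :=
  Coded.ofFinite _

instance (Γ : ConstraintLanguage) : Finite (Symbol Γ) := by
  let e : Symbol Γ → {f : Constraint // f ∈ Γ} ⊕ Bool ⊕ Bool ⊕ Bool := fun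
    | .con f => .inl f
    | .tick => .inr (.inl true)
    | .sep => .inr (.inl false)
    | .sign b => .inr (.inr (.inl b))
    | .bit b => .inr (.inr (.inr b))
  refine Finite.of_injective e fun x y h => ?_
  cases x <;> cases y <;> simp_all [e]

noncomputable instance (Γ : ConstraintLanguage) : Coded (Symbol Γ) := Coded.ofFinite _

/-- A sign and an absolute value. -/
abbrev SInt : Type := Bool × Bin

/-- A constraint, the indices of its arguments, and a weight. -/
abbrev AppData (Γ : ConstraintLanguage) : Type := {f : Constraint // f ∈ Γ} × (List ℕ × SInt)

/-- The state of the parser: the current digits, number and indices, and the applications. -/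
abbrev ParserState (Γ : ConstraintLanguage) : Type :=
  List Bool × (SInt × (List ℕ × List (AppData Γ)))

/-- From the right, a separator opens an index whose ticks follow, digits arrive with the most
significant one first, and a constraint symbol closes an application. The ticks met last form the
number of variables, in the place of an index. -/
def parseStep {Γ : ConstraintLanguage} (x : Symbol Γ) (s : ParserState Γ) : ParserState Γ :=
  match x with
  | .con f => (s.1, ((false, ⟨0⟩), ([], (f, (s.2.2.1, s.2.1)) :: s.2.2.2)))
  | .tick => (s.1, (s.2.1, ((s.2.2.1.headD 0 + 1) :: s.2.2.1.tail, s.2.2.2)))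
  | .sep => (s.1, (s.2.1, (0 :: s.2.2.1, s.2.2.2)))
  | .sign b => ([], ((b, ⟨listVal s.1⟩), s.2.2))
  | .bit b => (b :: s.1, s.2)

/-- The parser reads an instance from the right. -/
def parse {Γ : ConstraintLanguage} (l : List (Symbol Γ)) : ParserState Γ :=
  l.foldr parseStep ([], ((false, ⟨0⟩), ([], [])))

/-- A constraint with the indices of its arguments, and a weight. -/
abbrev RawApp (Γ : ConstraintLanguage) : Type := ({f : Constraint // f ∈ Γ} × List ℕ) × Bin

/-- An instance, as data. -/
abbrev RawInstance (Γ : ConstraintLanguage) : Type := ℕ × (SInt × List (RawApp Γ))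

def encIndex (Γ : ConstraintLanguage) (i : ℕ) : List (Symbol Γ) :=
  List.replicate i Symbol.tick ++ [Symbol.sep]

def encInt (Γ : ConstraintLanguage) (z : SInt) : List (Symbol Γ) :=
  Symbol.sign z.1 :: z.2.val.bits.map Symbol.bit

def encRaw {Γ : ConstraintLanguage} (r : RawApp Γ) : List (Symbol Γ) :=
  Symbol.con r.1.1 :: (r.1.2.flatMap (encIndex Γ) ++ encInt Γ (false, r.2))

def encInstance {Γ : ConstraintLanguage} (p : RawInstance Γ) : List (Symbol Γ) :=
  List.replicate p.1 Symbol.tick ++ (encInt Γ p.2.1 ++ p.2.2.flatMap encRaw)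

/-- Everything that the transformation needs to know about the two languages. -/
structure Gadgets (Γ₁ Γ₂ : ConstraintLanguage) where
  tmpl : (f : {f : Constraint // f ∈ Γ₁}) → Bool → List (Template Γ₂ (Lit f.val.arity))
  shift : {f : Constraint // f ∈ Γ₁} → Bool → ℕ
  factor : ℕ
  neg : List (Template Γ₂ (Fin 4))
  negMax : ℕ

/-- The variables 0 and 1 stand for the constants; `x_i` and its negation are the variables
`2 * i + 2` and `2 * i + 3`. -/
def litIndex (idx : List ℕ) {k : ℕ} : Lit k → ℕ
  | .inl (j, b) => idx.getD j 0 + idx.getD j 0 + 2 + b.toNat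
  | .inr b => b.toNat

def negIndex (i : ℕ) (m : Fin 4) : ℕ := (![i + i + 2, i + i + 3, 0, 1] : Fin 4 → ℕ) m

section Merge

variable {κ : Type} [DecidableEq κ]

def addStep (r e : κ × Bin) (s : Bool × List (κ × Bin)) : Bool × List (κ × Bin) :=
  if (!s.1 && decide (e.1 = r.1)) = true then (true, (e.1, ⟨e.2.val + r.2.val⟩) :: s.2)
  else (s.1, e :: s.2)

/-- Adds the weight `r.2` to the last entry with the key `r.1`, if there is one. -/
def addTo (r : κ × Bin) (l : List (κ × Bin)) : Bool × List (κ × Bin) :=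
  l.foldr (addStep r) (false, [])

/-- A formula has no repeated applications, so equal ones are merged by adding their weights. -/
def insertRaw (r : κ × Bin) (l : List (κ × Bin)) : List (κ × Bin) :=
  if (addTo r l).1 = true then (addTo r l).2 else r :: (addTo r l).2

/-- Merges the entries with the same key. -/
def mergeRaw (l : List (κ × Bin)) : List (κ × Bin) := l.foldr insertRaw []

end Merge

namespace Gadgets

variable {Γ₁ Γ₂ : ConstraintLanguage} (g : Gadgets Γ₁ Γ₂)

/-- The number of templates. -/
noncomputable def total : ℕ :=
  ∑ f : {f : Constraint // f ∈ Γ₁}, ((g.tmpl f false).length + (g.tmpl f true).length)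

/-- The sign of the weight selects the templates, and only its absolute value remains as a weight.
-/
def appBlock (a : AppData Γ₁) : List (RawApp Γ₂) :=
  (g.tmpl a.1 a.2.2.1).map fun τ =>
    ((τ.con, List.ofFn fun p => litIndex a.2.1 (τ.ref p)), a.2.2.2)

def negBlock (M : Bin) (i : ℕ) : List (RawApp Γ₂) :=
  g.neg.map fun τ => ((τ.con, List.ofFn fun p => negIndex i (τ.ref p)), M)

def absSum (l : List (AppData Γ₁)) : Bin := ⟨(l.map fun a => a.2.2.2.val).sum⟩

def shiftSum (l : List (AppData Γ₁)) : Bin :=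
  ⟨(l.map fun a => (Bin.mk (g.shift a.1 a.2.2.1 * a.2.2.2.val)).val).sum⟩

/-- Exceeds what all translated applications can contribute together, unless all weights are 0. -/
noncomputable def heavy (l : List (AppData Γ₁)) : Bin := ⟨(g.total + 1) * (absSum l).val⟩

/-- The threshold of the new instance. -/
noncomputable def threshold (n : ℕ) (t : SInt) (l : List (AppData Γ₁)) : SInt :=
  if t.1 = true then
    -- In this case every assignment exceeds `t`, and `-1` is never attained but always surpassed.
    -- Otherwise the new threshold is at least the maximal sum of the gadgets, out of reach for
    -- assignments that violate one.
    if decide ((g.shiftSum l).val < g.factor * t.2.val) = true then (true, ⟨1⟩)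
    else (false, ⟨(g.shiftSum l).val + n * (g.negMax * (g.heavy l).val) - g.factor * t.2.val⟩)
  else (false, ⟨(g.shiftSum l).val + n * (g.negMax * (g.heavy l).val) + g.factor * t.2.val⟩)

noncomputable def large (n : ℕ) (t : SInt) (l : List (AppData Γ₁)) : RawInstance Γ₂ :=
  (n + n + 2, (g.threshold n t l,
    mergeRaw ((List.range n).flatMap (g.negBlock (g.heavy l)) ++ l.flatMap g.appBlock)))

end Gadgets

/-- The sum of the absolute values of the weights of sign `neg` of the applications that are
satisfied by the constant assignment `b`. -/
def constSum {Γ : ConstraintLanguage} (b neg : Bool) (l : List (AppData Γ)) : Bin :=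
  ⟨(l.map fun a => (if (a.1.val.toFun (fun _ => b) && (a.2.2.1 == neg)) = true then a.2.2.2
    else ⟨0⟩ : Bin).val).sum⟩

def constLt {Γ : ConstraintLanguage} (b : Bool) (t : SInt) (l : List (AppData Γ)) : Bool :=
  decide ((constSum b false l).val + (if t.1 = true then t.2 else ⟨0⟩ : Bin).val <
    (constSum b true l).val + (if t.1 = true then ⟨0⟩ else t.2 : Bin).val)

def constGt {Γ : ConstraintLanguage} (b : Bool) (t : SInt) (l : List (AppData Γ)) : Bool :=
  decide ((constSum b true l).val + (if t.1 = true then ⟨0⟩ else t.2 : Bin).val <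
    (constSum b false l).val + (if t.1 = true then t.2 else ⟨0⟩ : Bin).val)

/-- The instance for formulas with at most one variable, which are solved directly. -/
def small {Γ₁ : ConstraintLanguage} (Γ₂ : ConstraintLanguage) (t : SInt) (l : List (AppData Γ₁)) :
    RawInstance Γ₂ :=
  -- The empty formula has value 0: the thresholds 0, -1 and 1 mean that `t` is attained, only
  -- surpassed, or out of reach.
  (0, (if ((!constLt false t l && !constGt false t l) ||
      (!constLt true t l && !constGt true t l)) = true then (false, ⟨0⟩)
    else if (!constLt false t l || !constLt true t l) = true then (true, ⟨1⟩)
    else (false, ⟨1⟩), []))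

/-- Constant factors in the weight bound can be absorbed into a power of `n` only for `n ≥ 2`, and
`n = 0` allows no new variables. The `min` makes the distinction a finite one. -/
noncomputable def Gadgets.transform {Γ₁ Γ₂ : ConstraintLanguage} (g : Gadgets Γ₁ Γ₂)
    (s : ParserState Γ₁) : RawInstance Γ₂ :=
  match min (s.2.2.1.headD 0) 2 with
  | 0 => small Γ₂ s.2.1 s.2.2.2
  | 1 => small Γ₂ s.2.1 s.2.2.2
  | _ + 2 => g.large (s.2.2.1.headD 0) s.2.1 s.2.2.2

/-! ### The transformation takes polynomial time -/

namespace PT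

variable {A B : Type} {α β γ δ ι κ : Type} [Data α] [Data β] [Data γ] [Data δ] [Data ι] [Data κ]

theorem ofFn {n : ℕ} {f : γ → Fin n → α} (hf : ∀ i, PT A B (fun x => f x i)) :
    PT A B (fun x => List.ofFn (f x)) := by
  induction n with
  | zero => simpa using nil
  | succ n ih =>
    simp only [List.ofFn_succ]
    exact cons (hf 0) (ih fun i => hf i.succ)

theorem static_map {E : Type} (l : List E) {f : E → γ → α} (hf : ∀ e, PT A B (f e)) :
    PT A B (fun x => l.map fun e => f e x) := by
  induction l with
  | nil => exact nil
  | cons e l ih => exact cons (hf e) ih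

theorem parse {Γ : ConstraintLanguage} {l : γ → List (Symbol Γ)} (hl : PT A B l) :
    PT A B (fun x => MaxCSP.parse (l x)) := by
  refine foldr (h := fun _ => parseStep) (l := l) ?_ hl (const _)
    ((2 * Coded.bound {f : Constraint // f ∈ Γ} : ℕ) + 32) ?_
  · have hs : PT A B (fun p : γ × (Symbol Γ × ParserState Γ) => p.2.2) := snd.comp snd
    have h₁ := fst.comp hs
    have h₂ := fst.comp (snd.comp hs)
    have h₃ := fst.comp (snd.comp (snd.comp hs))
    have h₄ := snd.comp (snd.comp (snd.comp hs))
    refine finite_cases (k := fun (y : Symbol Γ) (p : γ × (Symbol Γ × ParserState Γ)) =>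
      parseStep y p.2.2) (fun y => ?_) (fst.comp snd)
    cases y with
    | con f => exact pair h₁ (pair (const _) (pair nil (cons (pair (const f) (pair h₃ h₂)) h₄)))
    | tick => exact pair h₁ (pair h₂ (pair (cons (h₃.headD 0).succ h₃.tail) h₄))
    | sep => exact pair h₁ (pair h₂ (pair (cons (const 0) h₃) h₄))
    | sign b => exact pair nil (pair (pair (const b) (bin_mk h₁)) (snd.comp (snd.comp hs)))
    | bit b => exact pair (cons (const b) h₁) (snd.comp hs)
  · intro _ y s
    obtain ⟨bs, z, idx, l⟩ := s
    simp only [Polynomial.eval_natCast, Polynomial.eval_add, Polynomial.eval_ofNat]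
    have hz := dsize_pair z.1 z.2
    cases y with
    | con f =>
      have := dsize_coded_le f
      have h₀ : dsize (Bin.mk 0) = 1 := rfl
      simp only [parseStep, dsize_pair, dsize_cons, dsize_bool, dsize_nil, h₀, Nat.cast_id]
      omega
    | tick =>
      cases idx <;>
        simp only [parseStep, dsize_pair, dsize_cons, dsize_nil, dsize_nat, List.headD_nil,
          List.headD_cons, List.tail_nil, List.tail_cons] <;> omega
    | sep => simp only [parseStep, dsize_pair, dsize_cons, dsize_nat]; omega
    | sign b =>
      have : Nat.size (listVal bs) ≤ bs.length := Nat.size_le.2 (listVal_lt bs)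
      simp only [parseStep, dsize_pair, dsize_bin, dsize_bools, dsize_bool, dsize_nil]
      omega
    | bit b => simp only [parseStep, dsize_pair, dsize_cons, dsize_bool]; omega

theorem encIndex {Γ : ConstraintLanguage} {i : γ → ℕ} (hi : PT A B i) :
    PT A B (fun x => MaxCSP.encIndex Γ (i x)) :=
  append (replicate hi (const _)) (const _)

theorem encInt {Γ : ConstraintLanguage} {z : γ → SInt} (hz : PT A B z) :
    PT A B (fun x => MaxCSP.encInt Γ (z x)) :=
  cons (bool_cases (k := fun b _ => Symbol.sign b) (fun _ => const _) (fst.comp hz))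
    (map (f := fun _ b => Symbol.bit b)
      (bool_cases (k := fun b _ => Symbol.bit b) (fun _ => const _) snd) (bits (snd.comp hz)))

theorem encRaw {Γ : ConstraintLanguage} {r : γ → RawApp Γ} (hr : PT A B r) :
    PT A B (fun x => MaxCSP.encRaw (r x)) :=
  cons (finite_cases (k := fun f _ => Symbol.con f) (fun _ => const _) (fst.comp (fst.comp hr)))
    (append (flatMap (f := fun _ i => MaxCSP.encIndex Γ i) (encIndex snd) (snd.comp (fst.comp hr)))
      (encInt (pair (const false) (snd.comp hr))))

theorem encInstance {Γ : ConstraintLanguage} {p : γ → RawInstance Γ} (hp : PT A B p) :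
    PT A B (fun x => MaxCSP.encInstance (p x)) :=
  append (replicate (fst.comp hp) (const _)) (append (encInt (fst.comp (snd.comp hp)))
    (flatMap (f := fun _ r => MaxCSP.encRaw r) (encRaw snd) (snd.comp (snd.comp hp))))

theorem litIndex {k : ℕ} {idx : γ → List ℕ} (hi : PT A B idx) (l : Lit k) :
    PT A B (fun x => MaxCSP.litIndex (idx x) l) := by
  rcases l with ⟨j, b⟩ | b
  · exact add (add (add (hi.getD j 0) (hi.getD j 0)) (const 2)) (const b.toNat)
  · exact const _

theorem negIndex {i : γ → ℕ} (hi : PT A B i) (m : Fin 4) :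
    PT A B (fun x => MaxCSP.negIndex (i x) m) := by
  fin_cases m
  · exact add (add hi hi) (const 2)
  · exact add (add hi hi) (const 3)
  · exact const 0
  · exact const 1

/-- The entries grow with the counter in the state, so the increment bound of `foldl` does not apply
and the final size is bounded directly. -/
theorem range {n : γ → ℕ} (hn : PT A B n) : PT A B (fun x => List.range (n x)) := by
  have e : ∀ (l : List Unit) (i : ℕ) (m : List ℕ),
      List.foldl (fun (s : ℕ × List ℕ) _ => (s.1 + 1, s.1 :: s.2)) (i, m) l =
        (i + l.length, (List.range' i l.length).reverse ++ m) := by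
    intro l
    induction l with
    | nil => intro i m; simp
    | cons a l ih =>
      intro i m
      rw [List.foldl_cons, ih, List.length_cons, List.range'_succ]
      simp
      omega
  have hsize : ∀ k i, dsize (List.range' i k) ≤ k * (2 * (i + k) + 2) + 1 := by
    intro k
    induction k with
    | zero => simp [dsize_nil]
    | succ k ih =>
      intro i
      rw [List.range'_succ, dsize_cons, dsize_nat]
      have := ih (i + 1)
      rw [show i + 1 + k = i + (k + 1) by omega] at this
      rw [Nat.add_mul, Nat.one_mul]
      omega
  have key := foldl_state (A := A) (B := B) (ι := Unit)
    (h := fun (s : ℕ × List ℕ) _ => (s.1 + 1, s.1 :: s.2))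
    (pair (fst.comp fst).succ (cons (fst.comp fst) (snd.comp fst)))
    ⟨3 * .X + 3 + .X * (2 * .X + 2), fun s l => by
      obtain ⟨i, m⟩ := s
      rw [e, dsize_pair, dsize_pair]
      have h₁ := dsize_append (List.range' i l.length).reverse m
      rw [dsize_reverse] at h₁
      have h₂ := hsize l.length i
      have h₃ := length_lt_dsize l
      simp only [dsize_nat, Polynomial.eval_add, Polynomial.eval_mul, Polynomial.eval_ofNat,
        Polynomial.eval_X] at *
      have h₄ : l.length * (2 * (i + l.length) + 2) ≤
          (2 * i + 1 + dsize m + 1 + dsize l) * (2 * (2 * i + 1 + dsize m + 1 + dsize l) + 2) := by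
        gcongr <;> omega
      omega⟩
  have := reverse (snd.comp (key.comp₂ hn.replicate_unit (const (0, []))))
  simpa [e, List.range_eq_range'] using this

section Merge

variable [DecidableEq κ]

theorem addStep (hκ : PT A B (fun p : κ × κ => decide (p.1 = p.2))) {r e : γ → κ × Bin}
    {s : γ → Bool × List (κ × Bin)} (hr : PT A B r) (he : PT A B e) (hs : PT A B s) :
    PT A B (fun x => MaxCSP.addStep (r x) (e x) (s x)) :=
  ite (and (fst.comp hs).not (hκ.comp₂ (fst.comp he) (fst.comp hr)))
    (pair (const true) (cons (pair (fst.comp he) (bin_add (snd.comp he) (snd.comp hr)))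
      (snd.comp hs))) (pair (fst.comp hs) (cons he (snd.comp hs)))

theorem dsize_addStep_le (r e : κ × Bin) (s : Bool × List (κ × Bin)) :
    dsize (MaxCSP.addStep r e s) ≤ dsize s + (dsize r + dsize e) + 20 := by
  obtain ⟨k, w⟩ := r
  obtain ⟨k', w'⟩ := e
  obtain ⟨b, m⟩ := s
  have := dsize_bin_add w' w
  unfold MaxCSP.addStep
  split_ifs <;> simp only [dsize_pair, dsize_cons, dsize_bool] at * <;> omega

theorem addTo (hκ : PT A B (fun p : κ × κ => decide (p.1 = p.2))) :
    PT A B (fun p : (κ × Bin) × List (κ × Bin) => MaxCSP.addTo p.1 p.2) := by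
  have := foldr (A := A) (B := B) (γ := (κ × Bin) × List (κ × Bin)) (l := fun p => p.2)
    (a := fun _ => ((false, []) : Bool × List (κ × Bin)))
    (h := fun p e s => MaxCSP.addStep p.1 e s)
    (addStep hκ (fst.comp fst) (fst.comp snd) (snd.comp snd)) snd (const _) (.X + 20)
  refine this ?_
  intro p e s
  have h₁ := dsize_addStep_le p.1 e s
  have h₂ : dsize p = _ := dsize_pair p.1 p.2
  simp only [Polynomial.eval_add, Polynomial.eval_X, Polynomial.eval_ofNat]
  omega

/-- The flag ensures that at most one entry changes, so the growth depends on `r` alone. Iterated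
insertion needs this sharper bound. -/
theorem dsize_addTo_le (r : κ × Bin) (l : List (κ × Bin)) :
    dsize (MaxCSP.addTo r l).2 ≤ dsize l + if (MaxCSP.addTo r l).1 = true then dsize r.2 + 6 else 0 := by
  induction l with
  | nil => simp [MaxCSP.addTo]
  | cons e l ih =>
    rw [show MaxCSP.addTo r (e :: l) = if (!(MaxCSP.addTo r l).1 && decide (e.1 = r.1)) = true
      then (true, (e.1, ⟨e.2.val + r.2.val⟩) :: (MaxCSP.addTo r l).2)
      else ((MaxCSP.addTo r l).1, e :: (MaxCSP.addTo r l).2) from rfl]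
    have h₁ := dsize_bin_add e.2 r.2
    have h₂ : dsize e = _ := dsize_pair e.1 e.2
    cases hb : (MaxCSP.addTo r l).1 <;> by_cases hk : e.1 = r.1 <;>
      simp only [hb, hk, dsize_pair, dsize_cons, Bool.not_false, Bool.not_true, Bool.true_and,
        Bool.false_and, decide_true, decide_false, if_true, Bool.false_eq_true, if_false] at * <;>
      omega

theorem mergeRaw (hκ : PT A B (fun p : κ × κ => decide (p.1 = p.2))) {l : γ → List (κ × Bin)}
    (hl : PT A B l) : PT A B (fun x => MaxCSP.mergeRaw (l x)) := by
  have h : PT A B (fun p : γ × ((κ × Bin) × List (κ × Bin)) => MaxCSP.addTo p.2.1 p.2.2) :=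
    (addTo hκ).comp snd
  refine foldr (h := fun _ => insertRaw) (ite (fst.comp h) (snd.comp h)
    (cons (fst.comp snd) (snd.comp h))) hl nil (.X + 8) ?_
  intro x r l
  have h₁ := dsize_addTo_le r l
  have h₂ : dsize r = _ := dsize_pair r.1 r.2
  simp only [insertRaw, Polynomial.eval_add, Polynomial.eval_X, Polynomial.eval_ofNat]
  split_ifs at * with hb
  · omega
  · rw [dsize_cons]; omega

end Merge

theorem key_beq {Γ : ConstraintLanguage} :
    PT A B (fun p : ({f : Constraint // f ∈ Γ} × List ℕ) × ({f : Constraint // f ∈ Γ} × List ℕ) =>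
      decide (p.1 = p.2)) := by
  have := and (nat_beq.comp₂ (code (fst.comp fst)) (code (fst.comp snd)))
    ((list_beq nat_beq).comp₂ (A := A) (B := B)
      (snd.comp (fst (α := {f : Constraint // f ∈ Γ} × List ℕ)
        (β := {f : Constraint // f ∈ Γ} × List ℕ))) (snd.comp snd))
  convert this using 2 with p
  rw [← Bool.decide_and]
  refine decide_eq_decide.2 ?_
  rw [Prod.ext_iff, Coded.code_injective.eq_iff]

variable {Γ₁ Γ₂ : ConstraintLanguage} (g : Gadgets Γ₁ Γ₂)

theorem appBlock {a : γ → AppData Γ₁} (ha : PT A B a) : PT A B (fun x => g.appBlock (a x)) :=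
  finite_cases (k := fun (f : {f : Constraint // f ∈ Γ₁}) x => (g.tmpl f (a x).2.2.1).map
      fun (τ : Template Γ₂ (Lit f.val.arity)) => (((τ.con, List.ofFn
        fun (p : Fin τ.con.val.arity) => MaxCSP.litIndex (a x).2.1 (τ.ref p)), (a x).2.2.2) :
          RawApp Γ₂))
    (fun f => bool_cases (k := fun b x => (g.tmpl f b).map
      fun (τ : Template Γ₂ (Lit f.val.arity)) => (((τ.con, List.ofFn
        fun (p : Fin τ.con.val.arity) => MaxCSP.litIndex (a x).2.1 (τ.ref p)), (a x).2.2.2) :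
          RawApp Γ₂))
      (fun _ => static_map _ fun _ => pair (pair (const _) (ofFn fun _ =>
        litIndex (fst.comp (snd.comp ha)) _)) (snd.comp (snd.comp (snd.comp ha))))
      (fst.comp (snd.comp (snd.comp ha)))) (fst.comp ha)

theorem negBlock {M : γ → Bin} {i : γ → ℕ} (hM : PT A B M) (hi : PT A B i) :
    PT A B (fun x => g.negBlock (M x) (i x)) :=
  static_map _ fun _ => pair (pair (const _) (ofFn fun _ => negIndex hi _)) hM

theorem absSum {l : γ → List (AppData Γ₁)} (hl : PT A B l) :
    PT A B (fun x => Gadgets.absSum (l x)) :=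
  bin_sum (f := fun _ (a : AppData Γ₁) => a.2.2.2) (snd.comp (snd.comp (snd.comp snd))) hl

theorem shiftSum {l : γ → List (AppData Γ₁)} (hl : PT A B l) :
    PT A B (fun x => g.shiftSum (l x)) :=
  bin_sum (f := fun _ (a : AppData Γ₁) => Bin.mk (g.shift a.1 a.2.2.1 * a.2.2.2.val))
    (finite_cases (k := fun f (p : γ × AppData Γ₁) =>
      Bin.mk (g.shift f p.2.2.2.1 * p.2.2.2.2.val)) (fun f =>
        bool_cases (k := fun b (p : γ × AppData Γ₁) => Bin.mk (g.shift f b * p.2.2.2.2.val))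
          (fun _ => bin_smul _ (snd.comp (snd.comp (snd.comp snd))))
          (fst.comp (snd.comp (snd.comp snd)))) (fst.comp snd)) hl

theorem heavy {l : γ → List (AppData Γ₁)} (hl : PT A B l) :
    PT A B (fun x => g.heavy (l x)) := bin_smul _ (absSum hl)

theorem threshold {n : γ → ℕ} {t : γ → SInt} {l : γ → List (AppData Γ₁)} (hn : PT A B n)
    (ht : PT A B t) (hl : PT A B l) : PT A B (fun x => g.threshold (n x) (t x) (l x)) := by
  have h₁ := bin_smul g.factor (snd.comp ht)
  have h₂ := bin_add (shiftSum g hl) (nat_mul_bin hn (bin_smul g.negMax (heavy g hl)))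
  exact ite (fst.comp ht) (ite (bin_lt (shiftSum g hl) h₁) (const _)
    (pair (const _) (bin_sub h₂ h₁))) (pair (const _) (bin_add h₂ h₁))

theorem large {n : γ → ℕ} {t : γ → SInt} {l : γ → List (AppData Γ₁)} (hn : PT A B n)
    (ht : PT A B t) (hl : PT A B l) : PT A B (fun x => g.large (n x) (t x) (l x)) :=
  pair (add (add hn hn) (const 2)) (pair (threshold g hn ht hl) (mergeRaw key_beq
    (append (flatMap (f := fun x i => g.negBlock (g.heavy (l x)) i)
      (negBlock g ((heavy g hl).comp fst) snd) (range hn))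
      (flatMap (f := fun _ a => g.appBlock a) (appBlock g snd) hl))))

theorem constSum (b neg : Bool) {l : γ → List (AppData Γ₁)} (hl : PT A B l) :
    PT A B (fun x => MaxCSP.constSum b neg (l x)) :=
  bin_sum (f := fun _ (a : AppData Γ₁) =>
      (if (a.1.val.toFun (fun _ => b) && (a.2.2.1 == neg)) = true then a.2.2.2 else ⟨0⟩ : Bin))
    (ite (and (finite_cases (k := fun (f : {f : Constraint // f ∈ Γ₁}) _ =>
        f.val.toFun (fun _ => b)) (fun _ => const _) (fst.comp snd))
      (bool_cases (k := fun c _ => (c == neg)) (fun _ => const _)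
        (fst.comp (snd.comp (snd.comp snd))))) (snd.comp (snd.comp (snd.comp snd))) (const _)) hl

theorem constLt (b : Bool) {t : γ → SInt} {l : γ → List (AppData Γ₁)} (ht : PT A B t)
    (hl : PT A B l) : PT A B (fun x => MaxCSP.constLt b (t x) (l x)) :=
  bin_lt (bin_add (constSum b false hl) (ite (fst.comp ht) (snd.comp ht) (const _)))
    (bin_add (constSum b true hl) (ite (fst.comp ht) (const _) (snd.comp ht)))

theorem constGt (b : Bool) {t : γ → SInt} {l : γ → List (AppData Γ₁)} (ht : PT A B t)
    (hl : PT A B l) : PT A B (fun x => MaxCSP.constGt b (t x) (l x)) :=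
  bin_lt (bin_add (constSum b true hl) (ite (fst.comp ht) (const _) (snd.comp ht)))
    (bin_add (constSum b false hl) (ite (fst.comp ht) (snd.comp ht) (const _)))

theorem small {t : γ → SInt} {l : γ → List (AppData Γ₁)} (ht : PT A B t) (hl : PT A B l) :
    PT A B (fun x => MaxCSP.small Γ₂ (t x) (l x)) :=
  pair (const _) (pair (ite (or (and (constLt false ht hl).not (constGt false ht hl).not)
    (and (constLt true ht hl).not (constGt true ht hl).not)) (const _)
    (ite (or (constLt false ht hl).not (constLt true ht hl).not) (const _) (const _))) nil)

theorem transform {s : γ → ParserState Γ₁} (hs : PT A B s) :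
    PT A B (fun x => g.transform (s x)) := by
  have hn := (fst.comp (snd.comp (snd.comp hs))).headD 0
  have ht := fst.comp (snd.comp hs)
  have hl := snd.comp (snd.comp (snd.comp hs))
  refine min_cases (k := fun m x => match m with
    | 0 => MaxCSP.small Γ₂ (s x).2.1 (s x).2.2.2
    | 1 => MaxCSP.small Γ₂ (s x).2.1 (s x).2.2.2
    | _ + 2 => g.large ((s x).2.2.1.headD 0) (s x).2.1 (s x).2.2.2) 2 (fun i => ?_) hn
  match i with
  | 0 => exact small ht hl
  | 1 => exact small ht hl
  | _ + 2 => exact large g hn ht hl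

end PT


/-! ### Instances as data -/

theorem encodePosNum_eq_bits (m : PosNum) : Computability.encodePosNum m = (m : ℕ).bits := by
  induction m with
  | one => simp [Computability.encodePosNum]
  | bit0 m ih =>
    rw [Computability.encodePosNum, ih, PosNum.cast_bit0, ← two_mul,
      Nat.bit0_bits _ (PosNum.to_nat_pos m).ne']
  | bit1 m ih => rw [Computability.encodePosNum, ih, PosNum.cast_bit1, ← two_mul, Nat.bit1_bits]

theorem encodeNat_eq_bits (n : ℕ) : Computability.encodeNat n = n.bits := by
  conv_rhs => rw [← Num.to_of_nat n]
  unfold Computability.encodeNat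
  cases (n : Num) with
  | zero => simp [Computability.encodeNum]
  | pos m => exact encodePosNum_eq_bits m

def intData (z : ℤ) : SInt := (decide (z < 0), ⟨z.natAbs⟩)

def SInt.toInt (z : SInt) : ℤ := if z.1 = true then -z.2.val else z.2.val

theorem toInt_intData (z : ℤ) : (intData z).toInt = z := by
  simp only [SInt.toInt, intData, decide_eq_true_eq]
  split_ifs <;> omega

theorem intData_toInt {z : SInt} (hz : z.1 = true → z.2.val ≠ 0) : intData z.toInt = z := by
  obtain ⟨_ | _, ⟨n⟩⟩ := z
  · simp [SInt.toInt, intData]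
  · have : 0 < n := Nat.pos_of_ne_zero (hz rfl)
    simp [SInt.toInt, intData, this]

theorem encodeInt_eq (Γ : ConstraintLanguage) (z : ℤ) :
    encodeInt Γ z = encInt Γ (intData z) := by
  rw [encodeInt, encInt, encodeNat_eq_bits, intData]

section Parse

variable {Γ : ConstraintLanguage} {W : Set ℤ} {n : ℕ}

def appData (a : Application Γ W n) : AppData Γ :=
  (a.con, (List.ofFn fun j => (a.idx j).val, intData a.weight))

theorem foldr_parseStep_encodeInt (z : ℤ) (s : SInt × (List ℕ × List (AppData Γ))) :
    (encodeInt Γ z).foldr parseStep ([], s) = ([], (intData z, s.2)) := by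
  have h : ∀ (l bs : List Bool), (l.map Symbol.bit).foldr parseStep ((bs, s) : ParserState Γ) =
      (l ++ bs, s) := by
    intro l bs
    induction l with
    | nil => rfl
    | cons b l ih => rw [List.map_cons, List.foldr_cons, ih]; rfl
  rw [encodeInt_eq, encInt, List.foldr_cons, h]
  simp [parseStep, listVal_bits]

theorem foldr_parseStep_tick (k : ℕ) (s : ParserState Γ) (hs : s.2.2.1 ≠ []) :
    (List.replicate k Symbol.tick).foldr parseStep s =
      (s.1, (s.2.1, ((s.2.2.1.headD 0 + k) :: s.2.2.1.tail, s.2.2.2))) := by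
  obtain ⟨bs, z, idx, l⟩ := s
  obtain ⟨i, idx, rfl⟩ := List.exists_cons_of_ne_nil hs
  induction k with
  | zero => rfl
  | succ k ih => rw [List.replicate_succ, List.foldr_cons, ih]; rfl

theorem foldr_parseStep_encodeIndex (l : List ℕ) (s : ParserState Γ) :
    (l.flatMap (encodeIndex Γ)).foldr parseStep s =
      (s.1, (s.2.1, (l ++ s.2.2.1, s.2.2.2))) := by
  induction l with
  | nil => rfl
  | cons i l ih =>
    rw [List.flatMap_cons, List.foldr_append, ih, encodeIndex, List.foldr_append, List.foldr_cons,
      List.foldr_nil, foldr_parseStep_tick _ _ (by simp [parseStep])]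
    simp [parseStep]

theorem flatMap_encodeIndex {k : ℕ} (idx : Fin k → Fin n) :
    (List.ofFn idx).flatMap (fun i => encodeIndex Γ i.val) =
      (List.ofFn fun j => (idx j).val).flatMap (encodeIndex Γ) := by
  rw [show (List.ofFn fun j => (idx j).val) = (List.ofFn idx).map Fin.val by
    rw [List.map_ofFn]; rfl, List.flatMap_map]

theorem foldr_parseStep_encodeApplication (l : List (Application Γ W n)) :
    (l.flatMap encodeApplication).foldr parseStep ([], ((false, ⟨0⟩), ([], []))) =
      (([], ((false, ⟨0⟩), ([], l.map appData))) : ParserState Γ) := by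
  induction l with
  | nil => rfl
  | cons a l ih =>
    rw [List.flatMap_cons, List.foldr_append, ih, encodeApplication, List.foldr_cons,
      List.foldr_append, foldr_parseStep_encodeInt, flatMap_encodeIndex,
      foldr_parseStep_encodeIndex]
    simp [parseStep, appData]

theorem parse_encodeInstance (p : Formula Γ W × ℤ) :
    (parse (encodeInstance p)).2.2.1.headD 0 = p.1.n ∧
      (parse (encodeInstance p)).2.1 = intData p.2 ∧
      (parse (encodeInstance p)).2.2.2 = p.1.apps.map appData := by
  rw [parse, encodeInstance, List.foldr_append, List.foldr_append,
    foldr_parseStep_encodeApplication, foldr_parseStep_encodeInt]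
  generalize p.1.apps.map appData = l
  generalize p.1.n = n
  cases n with
  | zero => exact ⟨rfl, rfl, rfl⟩
  | succ n =>
    rw [List.replicate_succ', List.foldr_append, foldr_parseStep_tick _ _ (by simp [parseStep])]
    simp [parseStep]
    omega

end Parse

/-! ### Formulas from data with distinct keys -/

section RawFormula

variable {Γ : ConstraintLanguage} {n : ℕ}

/-- An assignment is extended to all natural numbers. -/
theorem exists_assignment_iff {P : (Fin n → Bool) → Prop} :
    (∃ x, P x) ↔ ∃ x : ℕ → Bool, P fun i => x i :=
  ⟨fun ⟨x, hx⟩ => ⟨fun i => if h : i < n then x ⟨i, h⟩ else false, by simpa using hx⟩,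
    fun ⟨_, hx⟩ => ⟨_, hx⟩⟩

/-- The weight that a weighted constraint contributes to the value of an assignment. -/
def rawValue (y : ℕ → Bool) (r : RawApp Γ) : ℕ :=
  (r.1.1.val.toFun fun j => y (r.1.2.getD j 0)).toNat * r.2.val

def IsIndexList (n k : ℕ) (l : List ℕ) : Prop := l.length = k ∧ ∀ i ∈ l, i < n

theorem IsIndexList.getD_lt {k : ℕ} {l : List ℕ} (h : IsIndexList n k l) (j : Fin k) :
    l.getD j 0 < n := by
  rw [List.getD_eq_getElem _ _ (by rw [h.1]; exact j.2)]
  exact h.2 _ (List.getElem_mem _)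

theorem isIndexList_ofFn {k : ℕ} {f : Fin k → ℕ} (h : ∀ j, f j < n) :
    IsIndexList n k (List.ofFn f) := by
  refine ⟨List.length_ofFn, fun i hi => ?_⟩
  obtain ⟨j, rfl⟩ := (List.mem_ofFn' f i).1 hi
  exact h j

def rawData (a : Application Γ natWeights n) : RawApp Γ :=
  ((a.con, List.ofFn fun j => (a.idx j).val), ⟨(a.weight : ℤ).natAbs⟩)

theorem exists_rawData {r : RawApp Γ} (h : IsIndexList n r.1.1.val.arity r.1.2) :
    ∃ a : Application Γ natWeights n, rawData a = r := by
  obtain ⟨⟨f, idx⟩, ⟨w⟩⟩ := r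
  refine ⟨⟨f, fun j => ⟨idx.getD j 0, h.getD_lt j⟩, ⟨w, Int.natCast_nonneg w⟩⟩, ?_⟩
  simp only [rawData, Int.natAbs_natCast, Prod.mk.injEq, and_true, true_and]
  refine List.ext_getElem (by simpa using h.1.symm) fun i h₁ h₂ => ?_
  simp only [List.getElem_ofFn]
  exact List.getD_eq_getElem _ _ h₂

theorem encRaw_rawData (a : Application Γ natWeights n) :
    encRaw (rawData a) = encodeApplication a := by
  have h : ¬ (a.weight : ℤ) < 0 := not_lt.2 a.weight.2
  rw [encRaw, encodeApplication, flatMap_encodeIndex, encodeInt_eq, intData, rawData]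
  simp only [h, decide_false]
  rfl

theorem rawValue_rawData (y : ℕ → Bool) (a : Application Γ natWeights n) :
    (rawValue y (rawData a) : ℤ) =
      if a.con.val.toFun (fun j => y (a.idx j)) = true then (a.weight : ℤ) else 0 := by
  have h : |(a.weight : ℤ)| = a.weight := abs_of_nonneg a.weight.2
  have e : (fun j : Fin a.con.val.arity =>
      y ((List.ofFn fun j => (a.idx j).val).getD j 0)) = fun j => y (a.idx j) := by
    funext j
    rw [List.getD_eq_getElem _ _ (by simp)]
    simp
  simp only [rawValue, rawData, e, Nat.cast_mul, Int.natCast_natAbs, h]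
  split_ifs with hs <;> simp [hs]

/-- Data with pairwise distinct keys describe an instance. -/
theorem exists_formula (r : RawInstance Γ)
    (hi : ∀ a ∈ r.2.2, IsIndexList r.1 a.1.1.val.arity a.1.2)
    (hk : (r.2.2.map Prod.fst).Nodup) (ht : r.2.1.1 = true → r.2.1.2.val ≠ 0) :
    ∃ Φ : Formula Γ natWeights, Φ.n = r.1 ∧ encodeInstance (Φ, r.2.1.toInt) = encInstance r ∧
      Φ.size = r.2.2.length ∧ Φ.totalWeight = (r.2.2.map fun a => a.2.val).sum ∧
      ∀ y : ℕ → Bool, Φ.value (fun i => y i) = ((r.2.2.map (rawValue y)).sum : ℕ) := by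
  obtain ⟨n, t, l⟩ := r
  obtain ⟨apps, rfl⟩ : ∃ apps : List (Application Γ natWeights n), apps.map rawData = l := by
    clear hk ht
    induction l with
    | nil => exact ⟨[], rfl⟩
    | cons a l ih =>
      obtain ⟨b, hb⟩ := exists_rawData (hi a List.mem_cons_self)
      obtain ⟨apps, rfl⟩ := ih fun a ha => hi a (List.mem_cons_of_mem _ ha)
      exact ⟨b :: apps, by rw [List.map_cons, hb]⟩
  refine ⟨⟨n, apps, (hk.of_map _).of_map _⟩, rfl, ?_, ?_, ?_, fun y => ?_⟩
  · rw [encodeInstance, encInstance, encodeInt_eq, intData_toInt ht, List.flatMap_map,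
      List.append_assoc]
    simp only [encRaw_rawData]
  · simp [Formula.size]
  · simp only [Formula.totalWeight, List.map_map]
    rfl
  · rw [Formula.value]
    simp only [← rawValue_rawData]
    rw [List.map_map, Nat.cast_list_sum, List.map_map]
    rfl

end RawFormula

/-! ### Correctness of merging -/

section Merge

variable {κ : Type} [DecidableEq κ]

theorem addTo_cons (r e : κ × Bin) (l : List (κ × Bin)) :
    addTo r (e :: l) = addStep r e (addTo r l) := rfl

theorem addTo_keys (r : κ × Bin) (l : List (κ × Bin)) :
    (addTo r l).2.map Prod.fst = l.map Prod.fst ∧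
      ((addTo r l).1 = true ↔ r.1 ∈ l.map Prod.fst) := by
  induction l with
  | nil => simp [addTo]
  | cons e l ih =>
    rw [addTo_cons, addStep, List.map_cons, List.mem_cons, ← ih.2, ← ih.1]
    split_ifs with h
    · simp_all
    · simp only [Bool.and_eq_true, Bool.not_eq_true', decide_eq_true_eq, not_and] at h
      simp only [List.map_cons, true_and]
      refine ⟨.inr, fun h' => h'.elim (fun h' => ?_) id⟩
      by_contra hb
      exact h (by simpa using hb) h'.symm

theorem sum_addTo {V : κ × Bin → ℕ} (hV : ∀ k m n, V (k, ⟨m + n⟩) = V (k, ⟨m⟩) + V (k, ⟨n⟩))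
    (r : κ × Bin) (l : List (κ × Bin)) :
    ((addTo r l).2.map V).sum = (l.map V).sum + if (addTo r l).1 = true then V r else 0 := by
  induction l with
  | nil => simp [addTo]
  | cons e l ih =>
    rw [addTo_cons, addStep]
    split_ifs with h₁ h₂ h₂
    · simp only [Bool.and_eq_true, Bool.not_eq_true', decide_eq_true_eq] at h₁
      obtain ⟨k, ⟨w⟩⟩ := r
      obtain ⟨k', ⟨w'⟩⟩ := e
      obtain rfl : k' = k := h₁.2
      simp only [List.map_cons, List.sum_cons, ih, h₁.1, hV]
      simp
      omega
    · exact absurd rfl h₂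
    · rw [if_pos h₂] at ih
      simp only [List.map_cons, List.sum_cons, ih]
      omega
    · rw [if_neg h₂] at ih
      simp only [List.map_cons, List.sum_cons, ih]
      omega

theorem mergeRaw_cons (r : κ × Bin) (l : List (κ × Bin)) :
    mergeRaw (r :: l) = insertRaw r (mergeRaw l) := rfl

/-- Used twice: for the value under an assignment and for the total weight, both additive in the
weight. -/
theorem sum_mergeRaw {V : κ × Bin → ℕ} (hV : ∀ k m n, V (k, ⟨m + n⟩) = V (k, ⟨m⟩) + V (k, ⟨n⟩))
    (l : List (κ × Bin)) : ((mergeRaw l).map V).sum = (l.map V).sum := by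
  induction l with
  | nil => rfl
  | cons r l ih =>
    have := sum_addTo hV r (mergeRaw l)
    rw [mergeRaw_cons, insertRaw, List.map_cons, List.sum_cons, ← ih]
    split_ifs at * with h
    · omega
    · rw [List.map_cons, List.sum_cons]; omega

theorem nodup_mergeRaw (l : List (κ × Bin)) : ((mergeRaw l).map Prod.fst).Nodup := by
  induction l with
  | nil => simp [mergeRaw]
  | cons r l ih =>
    have := addTo_keys r (mergeRaw l)
    rw [mergeRaw_cons, insertRaw]
    split_ifs with h
    · rwa [this.1]
    · rw [List.map_cons, this.1, List.nodup_cons, ← this.2]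
      exact ⟨h, ih⟩

theorem mergeRaw_keys_subset (l : List (κ × Bin)) :
    (mergeRaw l).map Prod.fst ⊆ l.map Prod.fst := by
  induction l with
  | nil => simp [mergeRaw]
  | cons r l ih =>
    have := addTo_keys r (mergeRaw l)
    rw [mergeRaw_cons, insertRaw, List.map_cons]
    split_ifs with h
    · rw [this.1]; exact List.subset_cons_of_subset _ ih
    · rw [List.map_cons, this.1]; exact List.cons_subset_cons _ ih

theorem length_mergeRaw_le (l : List (κ × Bin)) : (mergeRaw l).length ≤ l.length := by
  induction l with
  | nil => rfl
  | cons r l ih =>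
    have : (addTo r (mergeRaw l)).2.length = (mergeRaw l).length := by
      simpa using congrArg List.length (addTo_keys r (mergeRaw l)).1
    rw [mergeRaw_cons, insertRaw, List.length_cons]
    split_ifs
    · omega
    · rw [List.length_cons]; omega

end Merge


/-! ### Values of formulas as sums over data -/

section Sums

variable {Γ : ConstraintLanguage} {ρ : Type}

theorem sum_map_flatMap {α β : Type} (f : α → List β) (V : β → ℕ) (l : List α) :
    ((l.flatMap f).map V).sum = (l.map fun a => ((f a).map V).sum).sum := by
  induction l with
  | nil => rfl
  | cons a l ih => simp [ih]

theorem sum_rawValue_templates (y : ℕ → Bool) (h : ρ → ℕ) (w : Bin) (E : List (Template Γ ρ)) :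
    ((E.map fun τ => (((τ.con, List.ofFn fun p => h (τ.ref p)), w) : RawApp Γ)).map
      (rawValue y)).sum = satCount E (fun r => y (h r)) * w.val := by
  induction E with
  | nil => simp [satCount]
  | cons τ E ih =>
    have e : rawValue y (((τ.con, List.ofFn fun p => h (τ.ref p)), w) : RawApp Γ) =
        (τ.sat fun r => y (h r)).toNat * w.val := by
      simp [rawValue, Template.sat]
    rw [List.map_cons, List.map_cons, List.sum_cons, ih, e, satCount, satCount, List.map_cons,
      List.sum_cons, add_mul]

theorem rawValue_not (hc : ComplementClosed Γ) (y : ℕ → Bool) :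
    rawValue (Γ := Γ) (fun i => !y i) = rawValue y := by
  funext r
  rw [rawValue, hc _ r.1.1.2]
  rfl

/-- The weight that an application contributes to the value of an assignment. -/
def appValue (x : ℕ → Bool) (a : AppData Γ) : ℤ :=
  (a.1.val.toFun fun j => x (a.2.1.getD j 0)).toNat * a.2.2.toInt

theorem value_eq_sum_appValue {W : Set ℤ} (Φ : Formula Γ W) (x : ℕ → Bool) :
    Φ.value (fun i => x i) = ((Φ.apps.map appData).map (appValue x)).sum := by
  rw [Formula.value, List.map_map]
  congr 2
  funext a
  have e : (fun j : Fin a.con.val.arity =>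
      x ((List.ofFn fun j => (a.idx j).val).getD j 0)) = fun j => x (a.idx j) := by
    funext j
    rw [List.getD_eq_getElem _ _ (by simp)]
    simp
  simp only [Function.comp_apply, appValue, appData, toInt_intData, e]
  split_ifs with hs <;> simp [hs]

theorem totalWeight_eq_absSum {W : Set ℤ} (Φ : Formula Γ W) :
    Φ.totalWeight = (Gadgets.absSum (Φ.apps.map appData)).val := by
  simp only [Formula.totalWeight, Gadgets.absSum, List.map_map]
  rfl

theorem constSum_sub (b : Bool) (l : List (AppData Γ)) :
    ((constSum b false l).val : ℤ) - (constSum b true l).val =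
      (l.map (appValue fun _ => b)).sum := by
  induction l with
  | nil => rfl
  | cons a l ih =>
    have h : ∀ neg, (constSum b neg (a :: l)).val =
        (if (a.1.val.toFun (fun _ => b) && (a.2.2.1 == neg)) = true then a.2.2.2
          else ⟨0⟩ : Bin).val + (constSum b neg l).val := fun neg => rfl
    rw [List.map_cons, List.sum_cons, ← ih, h, h, appValue, SInt.toInt]
    cases a.1.val.toFun (fun _ => b) <;> cases a.2.2.1 <;> simp <;> ring

end Sums

theorem exists_fin_iff_of_le_one {n : ℕ} (hn : n ≤ 1) {P : (Fin n → Bool) → Prop} :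
    (∃ x, P x) ↔ ∃ b, P fun _ => b := by
  refine ⟨fun ⟨x, hx⟩ => ?_, fun ⟨b, hb⟩ => ⟨_, hb⟩⟩
  rcases Nat.le_one_iff_eq_zero_or_eq_one.1 hn with rfl | rfl
  · exact ⟨true, by rwa [Subsingleton.elim (fun _ => true) x]⟩
  · refine ⟨x 0, ?_⟩
    convert hx using 2
    exact congrArg x (Subsingleton.elim _ _)

theorem small_spec {Γ₁ Γ₂ : ConstraintLanguage} (t : ℤ) (l : List (AppData Γ₁)) :
    ((small Γ₂ (intData t) l).2.1.1 = true → (small Γ₂ (intData t) l).2.1.2.val ≠ 0) ∧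
    ((∃ b, (l.map (appValue fun _ => b)).sum = t) ↔
      (0 : ℤ) = (small Γ₂ (intData t) l).2.1.toInt) ∧
    ((∃ b, (l.map (appValue fun _ => b)).sum ≥ t) ↔
      (0 : ℤ) ≥ (small Γ₂ (intData t) l).2.1.toInt) := by
  have hp : ((if (intData t).1 = true then ⟨0⟩ else (intData t).2 : Bin).val : ℤ) -
      (if (intData t).1 = true then (intData t).2 else ⟨0⟩ : Bin).val = t := by
    rcases lt_or_ge t 0 with h | h
    · simp [intData, h, abs_of_neg h]
    · simp [intData, h.not_gt, abs_of_nonneg h]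
  have hl : ∀ b, constLt b (intData t) l = decide ((l.map (appValue fun _ => b)).sum < t) := by
    intro b
    rw [constLt, decide_eq_decide, ← constSum_sub]
    omega
  have hg : ∀ b, constGt b (intData t) l = decide (t < (l.map (appValue fun _ => b)).sum) := by
    intro b
    rw [constGt, decide_eq_decide, ← constSum_sub]
    omega
  simp only [small, hl, hg, Bool.exists_bool]
  generalize (l.map (appValue fun _ => false)).sum = u
  generalize (l.map (appValue fun _ => true)).sum = v
  simp only [Bool.or_eq_true, Bool.and_eq_true, Bool.not_eq_true', decide_eq_false_iff_not]
  split_ifs with h₁ h₂ <;> simp [SInt.toInt] <;> omega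

/-! ### Correctness of the transformation -/

namespace Gadgets

variable {Γ₁ Γ₂ : ConstraintLanguage}

structure Correct (g : Gadgets Γ₁ Γ₂) : Prop where
  factor_pos : 0 < g.factor
  tmpl : ∀ f neg x, (satCount (g.tmpl f neg) (litVal x) : ℤ) =
    (if neg = true then -1 else 1) * (g.factor * ((f.val.toFun x).toNat : ℤ)) + g.shift f neg
  neg_le : ∀ y, satCount g.neg y ≤ g.negMax
  neg_eq : (∀ y, satCount g.neg y = g.negMax ↔ (y 2 = false ∧ y 3 = true) ∧ y 0 ≠ y 1) ∨
    (ComplementClosed Γ₂ ∧ ∀ y, satCount g.neg y = g.negMax ↔ y 2 ≠ y 3 ∧ y 0 ≠ y 1)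

theorem exists_correct (h₂ : Γ₂.IsNontrivial) (hdeg : Γ₁.deg ≤ Γ₂.deg) (h0 : ¬ Γ₂.IsZeroValid)
    (h1 : ¬ Γ₂.IsOneValid) (hmon : ¬ Γ₂.IsTwoMonotone) : ∃ g : Gadgets Γ₁ Γ₂, g.Correct := by
  obtain ⟨D, β, hD⟩ := exists_negation_gadget h0 h1 hmon
  obtain ⟨c, hc, hE⟩ := exists_factor h₂
  have hf : ∀ f : {f : Constraint // f ∈ Γ₁}, f.val.deg ≤ Γ₂.deg := fun f =>
    (Finset.le_sup (f := Constraint.deg) f.2).trans hdeg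
  choose E κ hE using fun (f : {f : Constraint // f ∈ Γ₁}) (neg : Bool) => hE f.val (hf f) neg
  exact ⟨⟨E, κ, c, D, β⟩, hc, hE, hD.1, hD.2⟩

variable {g : Gadgets Γ₁ Γ₂}

theorem length_tmpl_le (f : {f : Constraint // f ∈ Γ₁}) (neg : Bool) :
    (g.tmpl f neg).length ≤ g.total := by
  refine le_trans ?_ (Finset.single_le_sum (f := fun f => (g.tmpl f false).length +
    (g.tmpl f true).length) (fun _ _ => Nat.zero_le _) (Finset.mem_univ f))
  cases neg
  · exact Nat.le_add_right _ _
  · exact Nat.le_add_left _ _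

variable (g)

def negCount (n : ℕ) (y : ℕ → Bool) : ℕ :=
  ∑ i ∈ Finset.range n, satCount g.neg fun m => y (negIndex i m)

def appCount (y : ℕ → Bool) (a : AppData Γ₁) : ℕ :=
  satCount (g.tmpl a.1 a.2.2.1) (fun ℓ => y (litIndex a.2.1 ℓ)) * a.2.2.2.val

theorem sum_rawValue_large (y : ℕ → Bool) (n : ℕ) (t : SInt) (l : List (AppData Γ₁)) :
    ((g.large n t l).2.2.map (rawValue y)).sum =
      g.negCount n y * (g.heavy l).val + (l.map (g.appCount y)).sum := by
  rw [large, sum_mergeRaw (fun k m n => by simp only [rawValue, Nat.mul_add]), List.map_append,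
    List.sum_append, sum_map_flatMap, sum_map_flatMap, negCount]
  congr 1
  · simp only [negBlock, sum_rawValue_templates]
    rw [Finset.sum_mul]
    rfl
  · simp only [appBlock, sum_rawValue_templates]
    rfl

theorem sum_appCount_le (y : ℕ → Bool) (l : List (AppData Γ₁)) :
    (l.map (g.appCount y)).sum ≤ g.total * (absSum l).val := by
  induction l with
  | nil => simp
  | cons a l ih =>
    have h : g.appCount y a ≤ g.total * a.2.2.2.val :=
      Nat.mul_le_mul_right _ ((satCount_le _ _).trans (length_tmpl_le _ _))
    simp only [absSum, List.map_cons, List.sum_cons, Nat.mul_add] at ih ⊢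
    exact Nat.add_le_add h ih

/-- The first two variables are the constants, and `x_i` is followed by its negation. -/
def IsGood (n : ℕ) (y : ℕ → Bool) : Prop :=
  y 0 = false ∧ y 1 = true ∧ ∀ i < n, y (i + i + 3) = !y (i + i + 2)

variable {g} {n : ℕ} {y : ℕ → Bool}

/-- On a good assignment the variables that stand for literals have the intended values, so the
specification of the templates applies term by term. -/
theorem Correct.sum_appCount (hg : g.Correct) (hy : IsGood n y) {l : List (AppData Γ₁)}
    (hl : ∀ a ∈ l, IsIndexList n a.1.val.arity a.2.1) :
    ((l.map (g.appCount y)).sum : ℤ) =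
      g.factor * (l.map (appValue fun i => y (i + i + 2))).sum + (g.shiftSum l).val := by
  induction l with
  | nil => simp [shiftSum]
  | cons a l ih =>
    have e : (fun ℓ => y (litIndex a.2.1 ℓ)) =
        litVal fun j : Fin a.1.val.arity => y (a.2.1.getD j 0 + a.2.1.getD j 0 + 2) := by
      funext ℓ
      rcases ℓ with ⟨j, b⟩ | b
      · have := hy.2.2 _ ((hl a List.mem_cons_self).getD_lt j)
        cases b
        · simp [litIndex, litVal]
        · rw [litVal, Bool.xor_true]
          exact this
      · cases b
        · exact hy.1
        · exact hy.2.1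
    have h : ((g.shiftSum (a :: l)).val : ℤ) = g.shift a.1 a.2.2.1 * a.2.2.2.val +
        (g.shiftSum l).val := by
      simp [shiftSum]
    rw [List.map_cons, List.sum_cons, List.map_cons, List.sum_cons, Nat.cast_add,
      ih fun a ha => hl a (List.mem_cons_of_mem _ ha), h, appCount, Nat.cast_mul, e, hg.tmpl,
      appValue, SInt.toInt]
    split_ifs <;> ring

theorem Correct.negCount_of_isGood (hg : g.Correct) (hy : IsGood n y) :
    g.negCount n y = n * g.negMax := by
  rw [negCount, ← smul_eq_mul, ← Finset.card_range n, ← Finset.sum_const, Finset.card_range]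
  refine Finset.sum_congr rfl fun i hi => ?_
  have h₁ := hy.2.2 i (Finset.mem_range.1 hi)
  have h₂ : y (i + i + 2) ≠ y (i + i + 3) := by simp [h₁]
  rcases hg.neg_eq with h | ⟨-, h⟩
  · exact (h _).2 ⟨⟨hy.1, hy.2.1⟩, h₂⟩
  · refine (h _).2 ⟨?_, h₂⟩
    show y 0 ≠ y 1
    simp [hy.1, hy.2.1]

theorem Correct.negCount_le (hg : g.Correct) : g.negCount n y ≤ n * g.negMax := by
  refine (Finset.sum_le_card_nsmul _ _ g.negMax fun i _ => hg.neg_le _).trans ?_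
  rw [Finset.card_range, smul_eq_mul]

/-- A sum of bounded terms is maximal only if each term is. Without any variable there would be no
gadget to control the constants. -/
theorem Correct.isGood_or (hg : g.Correct) (hn : 0 < n) (h : g.negCount n y = n * g.negMax) :
    IsGood n y ∨ ComplementClosed Γ₂ ∧ IsGood n fun i => !y i := by
  rw [negCount, ← smul_eq_mul, ← Finset.card_range n, ← Finset.sum_const, Finset.card_range,
    Finset.sum_eq_sum_iff_of_le fun i _ => hg.neg_le _] at h
  simp only [Finset.mem_range] at h
  have hnot : ∀ a b : Bool, a ≠ b → b = !a := by decide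
  rcases hg.neg_eq with hs | ⟨hc, hs⟩
  · refine .inl ⟨((hs _).1 (h 0 hn)).1.1, ((hs _).1 (h 0 hn)).1.2, fun i hi => ?_⟩
    exact hnot _ _ ((hs _).1 (h i hi)).2
  · have h₁ : y 1 = !y 0 := hnot _ _ ((hs _).1 (h 0 hn)).1
    have h₂ : ∀ i < n, y (i + i + 3) = !y (i + i + 2) := fun i hi =>
      hnot _ _ ((hs _).1 (h i hi)).2
    cases h₀ : y 0
    · exact .inl ⟨h₀, by simp [h₁, h₀], h₂⟩
    · exact .inr ⟨hc, by simp [h₀], by simp [h₁, h₀], fun i hi => by simp [h₂ i hi]⟩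

/-- An assignment for the new instance that extends `x`. -/
theorem exists_isGood (n : ℕ) (x : ℕ → Bool) :
    ∃ y, IsGood n y ∧ (fun i => y (i + i + 2)) = x := by
  -- Index `j + 2` belongs to `x (j / 2)`, negated for odd `j`.
  refine ⟨fun | 0 => false | 1 => true | j + 2 => xor (x (j / 2)) (decide (j % 2 = 1)),
    ⟨rfl, rfl, fun i _ => ?_⟩, funext fun i => ?_⟩
  · show xor (x ((i + i + 1) / 2)) (decide ((i + i + 1) % 2 = 1)) =
      !xor (x ((i + i) / 2)) (decide ((i + i) % 2 = 1))
    rw [show (i + i + 1) / 2 = i by omega, show (i + i) / 2 = i by omega,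
      decide_eq_true (show (i + i + 1) % 2 = 1 by omega),
      decide_eq_false (show ¬ (i + i) % 2 = 1 by omega), Bool.xor_true, Bool.xor_false]
  · show xor (x ((i + i) / 2)) (decide ((i + i) % 2 = 1)) = x i
    rw [show (i + i) / 2 = i by omega, decide_eq_false (show ¬ (i + i) % 2 = 1 by omega),
      Bool.xor_false]

section Large

variable {t : SInt} {l : List (AppData Γ₁)}

theorem Correct.large_of_isGood (hg : g.Correct) (hy : IsGood n y)
    (hl : ∀ a ∈ l, IsIndexList n a.1.val.arity a.2.1) :
    (((g.large n t l).2.2.map (rawValue y)).sum : ℤ) = n * (g.negMax * (g.heavy l).val) +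
      (g.factor * (l.map (appValue fun i => y (i + i + 2))).sum + (g.shiftSum l).val) := by
  rw [sum_rawValue_large, Nat.cast_add, hg.sum_appCount hy hl, hg.negCount_of_isGood hy]
  push_cast
  ring

theorem Correct.large_cases (hg : g.Correct) (hn : 0 < n)
    (hl : ∀ a ∈ l, IsIndexList n a.1.val.arity a.2.1) (y : ℕ → Bool) :
    (∃ x, (((g.large n t l).2.2.map (rawValue y)).sum : ℤ) = n * (g.negMax * (g.heavy l).val) +
      (g.factor * (l.map (appValue x)).sum + (g.shiftSum l).val)) ∨
    ((g.large n t l).2.2.map (rawValue y)).sum < n * (g.negMax * (g.heavy l).val) := by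
  -- If all weights are 0, the gadgets enforce nothing, but every value is 0 and thus agrees with
  -- that of a good assignment.
  rcases (absSum l).val.eq_zero_or_pos with h₀ | h₀
  · have h : ∀ y, ((g.large n t l).2.2.map (rawValue y)).sum = 0 := by
      intro y
      have := g.sum_appCount_le y l
      rw [sum_rawValue_large, heavy]
      simp_all
    obtain ⟨y', hy', -⟩ := exists_isGood n fun _ => true
    refine .inl ⟨fun i => y' (i + i + 2), ?_⟩
    rw [h, ← h y']
    exact hg.large_of_isGood hy' hl
  by_cases hc : g.negCount n y = n * g.negMax
  · rcases hg.isGood_or hn hc with h | ⟨hcc, h⟩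
    · exact .inl ⟨_, hg.large_of_isGood h hl⟩
    -- The complemented assignment is good and has the same value.
    · rw [← rawValue_not hcc]
      exact .inl ⟨_, hg.large_of_isGood h hl⟩
  · right
    -- One unit missing from the gadgets costs the heavy weight, more than all applications can
    -- return.
    have h₁ := g.sum_appCount_le y l
    have h₂ : g.negCount n y + 1 ≤ n * g.negMax := lt_of_le_of_ne hg.negCount_le hc
    have h₃ := Nat.mul_le_mul_right (g.heavy l).val h₂
    have h₄ : (g.heavy l).val = g.total * (absSum l).val + (absSum l).val := Nat.succ_mul _ _
    rw [sum_rawValue_large, ← Nat.mul_assoc]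
    rw [Nat.succ_mul] at h₃
    omega

theorem Correct.large_spec (hg : g.Correct) (hn : 0 < n)
    (hl : ∀ a ∈ l, IsIndexList n a.1.val.arity a.2.1) (t : ℤ) :
    ((g.large n (intData t) l).2.1.1 = true → (g.large n (intData t) l).2.1.2.val ≠ 0) ∧
    ((∃ x, (l.map (appValue x)).sum = t) ↔
      ∃ y, (((g.large n (intData t) l).2.2.map (rawValue y)).sum : ℤ) =
        (g.large n (intData t) l).2.1.toInt) ∧
    ((∃ x, (l.map (appValue x)).sum ≥ t) ↔
      ∃ y, (((g.large n (intData t) l).2.2.map (rawValue y)).sum : ℤ) ≥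
        (g.large n (intData t) l).2.1.toInt) := by
  have hc := hg.large_cases (t := intData t) hn hl
  have hx : ∀ x : ℕ → Bool, 0 ≤ g.factor * (l.map (appValue x)).sum + (g.shiftSum l).val ∧
      ∃ y, (((g.large n (intData t) l).2.2.map (rawValue y)).sum : ℤ) =
        n * (g.negMax * (g.heavy l).val) +
          (g.factor * (l.map (appValue x)).sum + (g.shiftSum l).val) := by
    intro x
    obtain ⟨y, hy, rfl⟩ := exists_isGood n x
    exact ⟨hg.sum_appCount hy hl ▸ Int.natCast_nonneg _, y, hg.large_of_isGood hy hl⟩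
  have hpos : (0 : ℤ) < g.factor := by exact_mod_cast hg.factor_pos
  -- The two cases for the threshold; in the second it is the image of `t` under the map that sends
  -- old values to new ones.
  have ht : ((g.large n (intData t) l).2.1.1 = true →
      (g.large n (intData t) l).2.1.2.val ≠ 0) ∧
      ((g.shiftSum l).val + g.factor * t < 0 ∧ (g.large n (intData t) l).2.1.toInt = -1 ∨
      0 ≤ (g.shiftSum l).val + g.factor * t ∧ (g.large n (intData t) l).2.1.toInt =
        n * (g.negMax * (g.heavy l).val) + (g.factor * t + (g.shiftSum l).val)) := by
    rw [show (g.large n (intData t) l).2.1 = g.threshold n (intData t) l from rfl, threshold]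
    rcases lt_or_ge t 0 with h | h
    · have e : ((g.factor * (intData t).2.val : ℕ) : ℤ) = -(g.factor * t) := by
        rw [Nat.cast_mul, intData, Int.natCast_natAbs, abs_of_neg h, mul_neg]
      rw [if_pos (by simp [intData, h])]
      split_ifs with h' <;> simp only [decide_eq_true_eq] at h'
      · exact ⟨by simp, .inl ⟨by omega, rfl⟩⟩
      · refine ⟨by simp, .inr ⟨by omega, ?_⟩⟩
        rw [SInt.toInt, if_neg (by simp), Nat.cast_sub (by omega), e]
        push_cast
        ring
    · have h₀ := mul_nonneg hpos.le h
      rw [if_neg (by simp [intData, h])]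
      refine ⟨by simp, .inr ⟨by omega, ?_⟩⟩
      rw [SInt.toInt, if_neg (by simp), intData]
      push_cast
      rw [abs_of_nonneg h]
      ring
  refine ⟨ht.1, ?_⟩
  obtain ⟨-, ⟨h₁, h₂⟩ | ⟨h₁, h₂⟩⟩ := ht
  · rw [h₂]
    -- The translated applications have a nonnegative sum, while the image of `t` under the same
    -- affine map is negative.
    have hlt : ∀ x, t < (l.map (appValue x)).sum := fun x => by
      have := (hx x).1
      by_contra! h
      have := mul_le_mul_of_nonneg_left h hpos.le
      omega
    refine ⟨⟨fun ⟨x, h⟩ => absurd h (hlt x).ne', fun ⟨y, h⟩ => by omega⟩,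
      fun _ => ⟨fun _ => true, by omega⟩, fun _ => ⟨fun _ => true, (hlt _).le⟩⟩
  · rw [h₂]
    -- An assignment that reaches the maximal sum of the gadgets falls under the first alternative
    -- of `large_cases`.
    have hc' : ∀ y, (n * (g.negMax * (g.heavy l).val) : ℤ) ≤
        ((g.large n (intData t) l).2.2.map (rawValue y)).sum → ∃ x,
        (((g.large n (intData t) l).2.2.map (rawValue y)).sum : ℤ) =
          n * (g.negMax * (g.heavy l).val) +
            (g.factor * (l.map (appValue x)).sum + (g.shiftSum l).val) :=
      fun y h => (hc y).resolve_right fun h' => h.not_gt (by exact_mod_cast h')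
    refine ⟨⟨fun ⟨x, h⟩ => ?_, fun ⟨y, h⟩ => ?_⟩, fun ⟨x, h⟩ => ?_, fun ⟨y, h⟩ => ?_⟩
    · obtain ⟨-, y, hy⟩ := hx x
      exact ⟨y, by rw [hy, h]⟩
    · obtain ⟨x, hx⟩ := hc' y (by omega)
      refine ⟨x, ?_⟩
      rw [hx] at h
      exact mul_left_cancel₀ hpos.ne' (by omega)
    · obtain ⟨-, y, hy⟩ := hx x
      have := mul_le_mul_of_nonneg_left h hpos.le
      exact ⟨y, by rw [hy]; omega⟩
    · obtain ⟨x, hx⟩ := hc' y (by omega)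
      refine ⟨x, ?_⟩
      rw [hx] at h
      exact le_of_mul_le_mul_left (by omega) hpos

theorem large_isIndexList (hl : ∀ a ∈ l, IsIndexList n a.1.val.arity a.2.1) :
    ∀ r ∈ (g.large n t l).2.2, IsIndexList (n + n + 2) r.1.1.val.arity r.1.2 := by
  intro r hr
  obtain ⟨r', hr', h⟩ := List.mem_map.1 (mergeRaw_keys_subset _ (List.mem_map_of_mem hr))
  rw [← h]
  simp only [List.mem_append, List.mem_flatMap, List.mem_range] at hr'
  rcases hr' with ⟨i, hi, hr'⟩ | ⟨a, ha, hr'⟩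
  · obtain ⟨τ, -, rfl⟩ := List.mem_map.1 hr'
    refine isIndexList_ofFn fun p => ?_
    generalize τ.ref p = m
    fin_cases m <;> simp [negIndex] <;> omega
  · obtain ⟨τ, -, rfl⟩ := List.mem_map.1 hr'
    refine isIndexList_ofFn fun p => ?_
    rcases τ.ref p with ⟨j, b⟩ | b
    · have h₁ := (hl a ha).getD_lt j
      have h₂ := Bool.toNat_le b
      simp only [litIndex]
      omega
    · have h₂ := Bool.toNat_le b
      simp only [litIndex]
      omega

theorem sum_map_const_templates {Γ : ConstraintLanguage} {ρ : Type} (h : ρ → ℕ) (w : Bin)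
    (V : Bin → ℕ) (E : List (Template Γ ρ)) :
    ((E.map fun τ => (((τ.con, List.ofFn fun p => h (τ.ref p)), w) : RawApp Γ)).map
      fun r => V r.2).sum = E.length * V w := by
  simp [Function.comp_def]

theorem length_large_le : (g.large n t l).2.2.length ≤ n * g.neg.length + g.total * l.length := by
  refine (length_mergeRaw_le _).trans ?_
  rw [List.length_append, List.length_flatMap, List.length_flatMap]
  refine Nat.add_le_add (by simp [negBlock]) ?_
  induction l with
  | nil => simp
  | cons a l ih =>
    have : (g.appBlock a).length ≤ g.total := by
      rw [appBlock, List.length_map]; exact length_tmpl_le _ _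
    rw [List.map_cons, List.sum_cons, List.length_cons, Nat.mul_succ]
    omega

theorem sum_weight_large_le : ((g.large n t l).2.2.map fun r => r.2.val).sum ≤
    (n * g.neg.length * (g.total + 1) + g.total) * (absSum l).val := by
  rw [large, sum_mergeRaw (fun k m n => rfl), List.map_append, List.sum_append, sum_map_flatMap,
    sum_map_flatMap, Nat.add_mul]
  refine Nat.add_le_add ?_ ?_
  · simp only [negBlock, sum_map_const_templates _ _ Bin.val]
    simp [heavy, mul_assoc]
  · induction l with
    | nil => simp
    | cons a l ih =>
      have h : ((g.appBlock a).map fun r => r.2.val).sum ≤ g.total * a.2.2.2.val := by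
        rw [appBlock, sum_map_const_templates _ _ Bin.val]
        exact Nat.mul_le_mul_right _ (length_tmpl_le _ _)
      simp only [absSum, List.map_cons, List.sum_cons, Nat.mul_add] at ih ⊢
      exact Nat.add_le_add h ih

end Large

theorem transform_eq (s : ParserState Γ₁) : g.transform s =
    if s.2.2.1.headD 0 < 2 then small Γ₂ s.2.1 s.2.2.2
    else g.large (s.2.2.1.headD 0) s.2.1 s.2.2.2 := by
  rw [transform]
  split_ifs with h
  · rw [min_eq_left h.le]
    generalize s.2.2.1.headD 0 = n at h
    interval_cases n <;> rfl
  · rw [min_eq_right (not_lt.1 h)]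

theorem Correct.exists_transform (hg : g.Correct) (Φ₁ : Formula Γ₁ intWeights) (t₁ : ℤ) :
    ∃ (Φ₂ : Formula Γ₂ natWeights) (t₂ : ℤ),
      encInstance (g.transform (parse (encodeInstance (Φ₁, t₁)))) = encodeInstance (Φ₂, t₂) ∧
      Φ₂.n ≤ 3 * Φ₁.n ∧
      Φ₂.size ≤ (g.neg.length + g.total) * (Φ₁.size + Φ₁.n) ∧
      Φ₂.totalWeight ≤
        Φ₁.totalWeight * Φ₁.n ^ (1 + (g.neg.length + 1) * (g.total + 1)) ∧
      ((∃ x, Φ₁.value x = t₁) ↔ ∃ y, Φ₂.value y = t₂) ∧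
      ((∃ x, Φ₁.value x ≥ t₁) ↔ ∃ y, Φ₂.value y ≥ t₂) := by
  obtain ⟨hn, ht, hl⟩ := parse_encodeInstance (Φ₁, t₁)
  rw [transform_eq, hn, ht, hl]
  split_ifs with h
  all_goals simp only at h ⊢
  · obtain ⟨h₁, h₂, h₃⟩ := small_spec (Γ₂ := Γ₂) t₁ (Φ₁.apps.map appData)
    obtain ⟨Φ₂, hn₂, he, hs, hw, hv⟩ := exists_formula (small Γ₂ (intData t₁)
      (Φ₁.apps.map appData)) (by simp [small]) (by simp [small]) h₁
    have hb : ∀ b, (Φ₁.value fun _ => b) =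
        ((Φ₁.apps.map appData).map (appValue fun _ => b)).sum := fun b =>
      value_eq_sum_appValue Φ₁ fun _ => b
    have hv' : ∀ y : ℕ → Bool, (Φ₂.value fun i => y i) = 0 := fun y => by rw [hv]; rfl
    refine ⟨Φ₂, _, he.symm, ?_, ?_, ?_, ?_, ?_⟩
    · simp [hn₂, small]
    · simp [hs, small]
    · simp [hw, small]
    · rw [exists_fin_iff_of_le_one (by omega), exists_assignment_iff]
      simp only [hv', hb, h₂, exists_const]
    · rw [exists_fin_iff_of_le_one (by omega), exists_assignment_iff]
      simp only [hv', hb, h₃, exists_const]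
  · have hi : ∀ a ∈ Φ₁.apps.map appData, IsIndexList Φ₁.n a.1.val.arity a.2.1 := by
      intro a ha
      obtain ⟨b, -, rfl⟩ := List.mem_map.1 ha
      exact isIndexList_ofFn fun j => (b.idx j).2
    obtain ⟨h₁, h₂, h₃⟩ := hg.large_spec (by omega) hi t₁
    obtain ⟨Φ₂, hn₂, he, hs, hw, hv⟩ := exists_formula (g.large Φ₁.n (intData t₁)
      (Φ₁.apps.map appData)) (large_isIndexList hi) (nodup_mergeRaw _) h₁
    refine ⟨Φ₂, _, he.symm, ?_, ?_, ?_, ?_, ?_⟩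
    · rw [hn₂, large]
      omega
    · rw [hs]
      refine length_large_le.trans ?_
      rw [List.length_map, Formula.size, Nat.add_mul, Nat.mul_comm Φ₁.n]
      exact Nat.add_le_add (Nat.mul_le_mul_left _ (Nat.le_add_left _ _))
        (Nat.mul_le_mul_left _ (Nat.le_add_right _ _))
    · rw [hw, totalWeight_eq_absSum, mul_comm]
      refine sum_weight_large_le.trans (Nat.mul_le_mul_right _ ?_)
      -- Since `n ≥ 2`, a constant `C` is absorbed by `C ≤ 2 ^ C ≤ n ^ C`.
      calc Φ₁.n * g.neg.length * (g.total + 1) + g.total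
          ≤ Φ₁.n * ((g.neg.length + 1) * (g.total + 1)) := by
            nlinarith [Nat.mul_le_mul_right g.total (show 1 ≤ Φ₁.n by omega)]
        _ ≤ Φ₁.n * Φ₁.n ^ ((g.neg.length + 1) * (g.total + 1)) :=
            Nat.mul_le_mul_left _ (Nat.lt_two_pow_self.le.trans (Nat.pow_le_pow_left (not_lt.1 h) _))
        _ = _ := by rw [pow_add, pow_one]
    · rw [exists_assignment_iff, exists_assignment_iff]
      simp only [hv, value_eq_sum_appValue Φ₁, h₂]
    · rw [exists_assignment_iff, exists_assignment_iff]
      simp only [hv, value_eq_sum_appValue Φ₁, h₃]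

end Gadgets

/-- The formulas are merely chosen from an existence statement, but their encodings are determined,
and these are what the program computes. -/
theorem Gadgets.Correct.linearlyTransforms {Γ₁ Γ₂ : ConstraintLanguage} {g : Gadgets Γ₁ Γ₂}
    (hg : g.Correct) : LinearlyTransforms Γ₁ intWeights Γ₂ natWeights := by
  choose Φ t h using hg.exists_transform
  refine ⟨fun p => (Φ p.1 p.2, t p.1 p.2), ?_, 3, g.neg.length + g.total,
    1 + (g.neg.length + 1) * (g.total + 1), fun Φ₁ t₁ Φ₂ t₂ e => ?_⟩
  · refine nonempty_polyTime_of_PT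
      (f := fun l => (encInstance (g.transform (parse l.reverse))).reverse)
      (PT.encInstance (PT.transform g PT.id.reverse.parse)).reverse fun p => ?_
    rw [List.reverse_reverse, (h p.1 p.2).1]
  · obtain ⟨rfl, rfl⟩ := Prod.mk.inj e
    exact (h Φ₁ t₁).2

end MaxCSP

theorem mainTheorem5 (Γ₁ Γ₂ : MaxCSP.ConstraintLanguage)
    (h₁ : Γ₁.IsNontrivial) (h₂ : Γ₂.IsNontrivial)
    (hdeg : Γ₁.deg ≤ Γ₂.deg)
    (h0 : ¬ Γ₂.IsZeroValid) (h1 : ¬ Γ₂.IsOneValid) (hmon : ¬ Γ₂.IsTwoMonotone) :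
    MaxCSP.LinearlyTransforms Γ₁ MaxCSP.intWeights Γ₂ MaxCSP.natWeights :=
  let ⟨_, hg⟩ := MaxCSP.Gadgets.exists_correct h₂ hdeg h0 h1 hmon
  hg.linearlyTransforms
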